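/- For finite simple graphs $G$ and $H$, let $R(G,H)$ denote the smallest natural number $n$ such that, for every simple graph $F$ of order $n$, either $F$ contains $G$ as a (not necessarily induced) subgraph or the complement $\overline{F}$ contains $H$ as a (not necessarily induced) subgraph. Let $W_8$ be the wheel graph of order $9$, obtained by joining a new vertex to every vertex of the cycle $C_8$. Let $A,B,C,D,E$ be the five trees of order $7$ and maximum degree $3$, that is, the graphs on the vertex set $\{0,1,\dots,6\}$ with the following edge sets: - $A$: $\{01,12,23,34,45,16\}$; - $B$: $\{01,12,23,34,45,26\}$; - $C$: $\{01,12,23,34,15,26\}$; - $D$: $\{01,12,23,34,25,56\}$; - $E$: $\{01,12,23,34,15,36\}$. Then $R(A,W_8)=R(B,W_8)=R(C,W_8)=13$, $R(D,W_8)=14$ and $R(E,W_8)=15$. -/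

import Mathlib

/-- `IsRamseyNumber G H n` says that `n = R(G, H)`: `n` is the smallest natural number such that
every simple graph `F` of order `n` contains `G` as a (not necessarily induced) subgraph, or its
complement `Fᶜ` contains `H` as a subgraph. -/
def IsRamseyNumber {α β : Type*} (G : SimpleGraph α) (H : SimpleGraph β) (n : ℕ) : Prop :=
  IsLeast {k : ℕ | ∀ F : SimpleGraph (Fin k), G.IsContained F ∨ H.IsContained Fᶜ} n

/-- The wheel graph `W_m` of order `m + 1`: the hub `none` is joined to every vertex of
the cycle graph `C_m` (whose vertices are the `some i`). -/
def wheelGraph (m : ℕ) : SimpleGraph (Option (Fin m)) where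
  Adj
    | none, none => False
    | none, some _ => True
    | some _, none => True
    | some i, some j => (SimpleGraph.cycleGraph m).Adj i j
  symm := ⟨by
    rintro (_ | i) (_ | j) h
    · exact h
    · trivial
    · trivial
    · exact SimpleGraph.Adj.symm h⟩
  loopless := ⟨by
    rintro (_ | i) h
    · exact h
    · exact SimpleGraph.irrefl _ h⟩

/-- The tree `A`: the path `0 - 1 - 2 - 3 - 4 - 5` with the vertex `6` attached to `1`. -/
def treeA : SimpleGraph (Fin 7) :=
  SimpleGraph.fromEdgeSet {s(0, 1), s(1, 2), s(2, 3), s(3, 4), s(4, 5), s(1, 6)}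

/-- The tree `B`: the path `0 - 1 - 2 - 3 - 4 - 5` with the vertex `6` attached to `2`. -/
def treeB : SimpleGraph (Fin 7) :=
  SimpleGraph.fromEdgeSet {s(0, 1), s(1, 2), s(2, 3), s(3, 4), s(4, 5), s(2, 6)}

/-- The tree `C`: the path `0 - 1 - 2 - 3 - 4` with the vertex `5` attached to `1` and the vertex
`6` attached to `2`. -/
def treeC : SimpleGraph (Fin 7) :=
  SimpleGraph.fromEdgeSet {s(0, 1), s(1, 2), s(2, 3), s(3, 4), s(1, 5), s(2, 6)}

/-- The tree `D`: the path `0 - 1 - 2 - 3 - 4` with a path `2 - 5 - 6` attached to its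
middle vertex. -/
def treeD : SimpleGraph (Fin 7) :=
  SimpleGraph.fromEdgeSet {s(0, 1), s(1, 2), s(2, 3), s(3, 4), s(2, 5), s(5, 6)}

/-- The tree `E`: the path `0 - 1 - 2 - 3 - 4` with the vertex `5` attached to `1` and the vertex
`6` attached to `3`. -/
def treeE : SimpleGraph (Fin 7) :=
  SimpleGraph.fromEdgeSet {s(0, 1), s(1, 2), s(2, 3), s(3, 4), s(1, 5), s(3, 6)}

/-! Let `T` be one of the trees and put `d = 3` for `A`, `B`, `C`, `d = 4` for `D` and `d = 5` for
`E`; the number to be established is `10 + d`.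

The upper bound rests on two facts about a graph `F` that does not contain `T`. (i) If `F` has at
least ten vertices, its complement contains `C₈` (`exists_complCycle`). Indeed a complement cycle of
length `k ≤ 7`, together with further vertices up to a total of ten, always yields `T` in `F` or a
complement cycle whose length lies between `k + 1` and `8`. (ii) If `F` is nonempty with all degrees
at least `d`, then four vertices `X` have all their neighbours in a set `Q ⊇ X` of at most six
vertices (`exists_small_closure`).

Now let `F` have `10 + d` vertices (`wheelGraph_isContained_compl_of_card`). If a vertex `v` has
fewer than `d` neighbours, at least ten vertices lie outside its closed neighbourhood, and (i) gives
a rim among them for the hub `v`. Otherwise take `X` and `Q` from (ii), and a set `U` of `4 + d`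
vertices outside `Q`. If some `u ∈ U` has fewer than `d` neighbours in `U`, it has four
non-neighbours there; these and `X` span a `K₄,₄` in the complement, hence a rim, and `u` is a hub.
If there is no such `u`, (ii) applies to the subgraph induced on `U`. A vertex of `U` outside the
resulting six-element set misses itself and four more of the `4 + d` vertices, so its degree in `U`
is below `d`, a contradiction.

For the lower bound take the disjoint union of `K₆` and a graph `H` on `d + 3` vertices: `K₆` for
`A`, `B`, `C`, two copies of `K₄` sharing a vertex for `D`, and `K₄,₄` for `E`. The connected tree
`T` fits neither into `K₆` nor into `H`. In the complement, a hub in `K₆` forces an 8-cycle in the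
complement of `H`, and a hub in `H` forces four non-neighbours within `H`
(`not_wheelGraph_isContained_compl_top_sum`); neither exists.

Facts (i) and (ii) are finite case analyses. Each is recorded as a list of steps that branch on an
adjacency or on the existence of a new neighbour, and that close a branch by exhibiting a forbidden
configuration. The kernel evaluates `check` on the list, and `not_realizes_of_check` turns a
successful evaluation into a statement about arbitrary graphs. -/

/-! ### Partial graphs: the states of a case analysis -/

/-- What is known about a simple graph on some distinct named vertices `0, …, size - 1`:
pairs that are adjacent, pairs that are not, and vertices without unnamed neighbours. -/
structure PartialGraph where
  size : ℕ
  present : ℕ → ℕ → Bool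
  absent : ℕ → ℕ → Bool
  closed : ℕ → Bool

namespace PartialGraph

/-- Mark the unordered pair `i, j` in a table. -/
def mark (f : ℕ → ℕ → Bool) (i j : ℕ) : ℕ → ℕ → Bool :=
  fun a b => (a.beq i && b.beq j) || (a.beq j && b.beq i) || f a b

/-- Record that `i` and `j` are adjacent. -/
def addEdge (s : PartialGraph) (i j : ℕ) : PartialGraph :=
  { s with present := mark s.present i j }

/-- Record that `i` and `j` are not adjacent. -/
def addNonedge (s : PartialGraph) (i j : ℕ) : PartialGraph :=
  { s with absent := mark s.absent i j }

/-- Record that all neighbours of `i` are named. -/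
def close (s : PartialGraph) (i : ℕ) : PartialGraph :=
  { s with closed := fun a => a.beq i || s.closed a }

/-- Name a new neighbour of `i`. It is not adjacent to any closed vertex. -/
def grow (s : PartialGraph) (i : ℕ) : PartialGraph where
  size := s.size + 1
  present := mark s.present i s.size
  absent := fun a b =>
    (b.beq s.size && s.closed a) || (a.beq s.size && s.closed b) || s.absent a b
  closed := s.closed

/-- The named vertices which are possibly neighbours of `i`. -/
def possibleNeighbors (s : PartialGraph) (i : ℕ) : List ℕ :=
  (List.range s.size).filter fun j => !(j.beq i) && !s.absent i j

/-- The named vertices which lie in `X` or are possibly neighbours of a vertex of `X`. -/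
def possibleClosure (s : PartialGraph) (X : List ℕ) : List ℕ :=
  (List.range s.size).filter fun j => X.any fun x => j.beq x || !s.absent x j

/-- `n` vertices, the first `k` of which form a cycle in the complement. -/
def ofCycle (n k : ℕ) : PartialGraph where
  size := n
  present := fun _ _ => false
  absent := fun a b => Nat.blt a k && Nat.blt b k &&
    (b.beq ((a + 1) % k) || a.beq ((b + 1) % k))
  closed := fun _ => false

/-- A single vertex. -/
def vertex : PartialGraph where
  size := 1
  present := fun _ _ => false
  absent := fun _ _ => false
  closed := fun _ => false

variable {V : Type*}

/-- The naming `φ` identifies the named vertices of `s` with vertices of `F`. -/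
structure Realizes (F : SimpleGraph V) (φ : ℕ → V) (s : PartialGraph) : Prop where
  inj : ∀ i < s.size, ∀ j < s.size, φ i = φ j → i = j
  present : ∀ i j, s.present i j = true → i < s.size ∧ j < s.size ∧ F.Adj (φ i) (φ j)
  absent : ∀ i j, s.absent i j = true → i < s.size ∧ j < s.size ∧ ¬ F.Adj (φ i) (φ j)
  closed : ∀ i, s.closed i = true → i < s.size ∧ ∀ y, F.Adj (φ i) y → ∃ j < s.size, φ j = y

lemma mark_eq_true {f : ℕ → ℕ → Bool} {i j a b : ℕ} :
    mark f i j a b = true ↔ (a = i ∧ b = j) ∨ (a = j ∧ b = i) ∨ f a b = true := by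
  simp [mark, or_assoc]

namespace Realizes

variable {F : SimpleGraph V} {φ : ℕ → V} {s : PartialGraph}

lemma addEdge (h : Realizes F φ s) {i j : ℕ} (hi : i < s.size) (hj : j < s.size)
    (hij : F.Adj (φ i) (φ j)) : Realizes F φ (s.addEdge i j) where
  inj := h.inj
  present a b hab := by
    rcases mark_eq_true.1 hab with ⟨rfl, rfl⟩ | ⟨rfl, rfl⟩ | hab
    · exact ⟨hi, hj, hij⟩
    · exact ⟨hj, hi, hij.symm⟩
    · exact h.present a b hab
  absent := h.absent
  closed := h.closed

lemma addNonedge (h : Realizes F φ s) {i j : ℕ} (hi : i < s.size) (hj : j < s.size)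
    (hij : ¬ F.Adj (φ i) (φ j)) : Realizes F φ (s.addNonedge i j) where
  inj := h.inj
  present := h.present
  absent a b hab := by
    rcases mark_eq_true.1 hab with ⟨rfl, rfl⟩ | ⟨rfl, rfl⟩ | hab
    · exact ⟨hi, hj, hij⟩
    · exact ⟨hj, hi, fun h' => hij h'.symm⟩
    · exact h.absent a b hab
  closed := h.closed

lemma close (h : Realizes F φ s) {i : ℕ} (hi : i < s.size)
    (hcl : ∀ y, F.Adj (φ i) y → ∃ j < s.size, φ j = y) : Realizes F φ (s.close i) where
  inj := h.inj
  present := h.present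
  absent := h.absent
  closed a ha := by
    simp only [PartialGraph.close, Bool.or_eq_true, Nat.beq_eq] at ha
    rcases ha with rfl | ha
    · exact ⟨hi, hcl⟩
    · exact h.closed a ha

/-- The first unused name `s.size` is given to `y`, so the old names keep their meaning. The
non-adjacencies recorded for the new name are forced: a closed vertex has only named neighbours, and
`y` had no name. -/
lemma grow (h : Realizes F φ s) {i : ℕ} (hi : i < s.size) {y : V} (hy : F.Adj (φ i) y)
    (hnew : ∀ j < s.size, φ j ≠ y) :
    Realizes F (Function.update φ s.size y) (s.grow i) := by
  have hold : ∀ j, j < s.size → Function.update φ s.size y j = φ j := fun j hj =>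
    Function.update_of_ne hj.ne _ _
  have hsz : (s.grow i).size = s.size + 1 := rfl
  have hlast : Function.update φ s.size y s.size = y := Function.update_self _ _ _
  refine ⟨fun a ha b hb hab => ?_, fun a b hab => ?_, fun a b hab => ?_, fun a ha => ?_⟩
  · rw [hsz, Nat.lt_succ_iff_lt_or_eq] at ha hb
    rcases ha with ha | rfl <;> rcases hb with hb | rfl
    · rw [hold a ha, hold b hb] at hab
      exact h.inj a ha b hb hab
    · rw [hold a ha, hlast] at hab
      exact absurd hab (hnew a ha)
    · rw [hold b hb, hlast] at hab
      exact absurd hab.symm (hnew b hb)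
    · rfl
  · rw [hsz]
    rcases mark_eq_true.1 hab with ⟨rfl, rfl⟩ | ⟨rfl, rfl⟩ | hab
    · rw [hold _ hi, hlast]
      exact ⟨by omega, by omega, hy⟩
    · rw [hold _ hi, hlast]
      exact ⟨by omega, by omega, hy.symm⟩
    · obtain ⟨ha, hb, hab⟩ := h.present a b hab
      rw [hold a ha, hold b hb]
      exact ⟨by omega, by omega, hab⟩
  · have hc : ∀ c, s.closed c = true → c < s.size ∧ ¬ F.Adj (φ c) y := fun c hc => by
      refine ⟨(h.closed c hc).1, fun hcy => ?_⟩
      obtain ⟨j, hj, hjy⟩ := (h.closed c hc).2 y hcy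
      exact hnew j hj hjy
    rw [hsz]
    simp only [PartialGraph.grow, Bool.or_eq_true, Bool.and_eq_true, Nat.beq_eq] at hab
    rcases hab with (⟨rfl, ha⟩ | ⟨rfl, hb⟩) | hab
    · obtain ⟨ha, hay⟩ := hc a ha
      rw [hold a ha, hlast]
      exact ⟨by omega, by omega, hay⟩
    · obtain ⟨hb, hby⟩ := hc b hb
      rw [hold b hb, hlast]
      exact ⟨by omega, by omega, fun h' => hby h'.symm⟩
    · obtain ⟨ha, hb, hab⟩ := h.absent a b hab
      rw [hold a ha, hold b hb]
      exact ⟨by omega, by omega, hab⟩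
  · obtain ⟨ha', hcl⟩ := h.closed a ha
    refine ⟨by omega, fun z hz => ?_⟩
    rw [hold a ha'] at hz
    obtain ⟨j, hj, hjz⟩ := hcl z hz
    exact ⟨j, by omega, by rw [hold j hj, hjz]⟩

end Realizes

end PartialGraph

/-! ### Certificates for case analyses and their soundness -/

/-- A list of vertices which traces out a closed walk in the complement of `F`. -/
def IsComplCycle {V : Type*} (F : SimpleGraph V) (c : List V) : Prop :=
  c.Nodup ∧ ∀ p ∈ c.zip (c.rotate 1), ¬ F.Adj p.1 p.2

/-- A step in a case analysis of how a graph may extend a partial graph. Lists of vertices are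
written as numerals with one decimal digit for each vertex. -/
inductive CaseStep
  /-- The seven vertices `w` span the forbidden tree. -/
  | tree (w : ℕ)
  /-- The `n` vertices `w` form a forbidden cycle in the complement. -/
  | cycle (n w : ℕ)
  /-- The degree of `i` is too small. -/
  | degree (i : ℕ)
  /-- The four vertices `w` have too few neighbours. -/
  | separate (w : ℕ)
  /-- Consider first the case that `i` and `j` are adjacent, then the case that they are not. -/
  | edge (i j : ℕ)
  /-- Consider first the case that `i` has an unnamed neighbour, then the case that it has none. -/
  | grow (i : ℕ)

/-- The properties to be refuted by a case analysis: there is no copy of the graph with the given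
edges, the complement has no cycle whose length lies between `minCycle` and `8`, the degrees are
at least `minDegree`, and no four vertices have all their neighbours within a set of `maxClosure`
vertices that contains them. -/
structure Rules where
  edges : List (Fin 7 × Fin 7)
  minCycle : ℕ
  minDegree : ℕ
  maxClosure : ℕ

/-- `F` has the properties listed in `R`. -/
structure Rules.Holds {V : Type*} (R : Rules) (F : SimpleGraph V) : Prop where
  tree : ∀ f : Fin 7 → V, f.Injective → ¬ ∀ e ∈ R.edges, F.Adj (f e.1) (f e.2)
  cycle : ∀ c : List V, IsComplCycle F c → R.minCycle ≤ c.length → ¬ c.length ≤ 8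
  degree : ∀ (v : V) (Q : Finset V), (∀ y, F.Adj v y → y ∈ Q) → R.minDegree ≤ Q.card
  separate : ∀ X Q : Finset V, X.card = 4 → X ⊆ Q → Q.card ≤ R.maxClosure →
    ¬ ∀ x ∈ X, ∀ y, F.Adj x y → y ∈ Q

namespace CaseStep

open PartialGraph

/-- The list of the last `n` decimal digits of `w`. -/
def digits (n w : ℕ) : List ℕ :=
  (List.range n).map fun i => w / 10 ^ (n - 1 - i) % 10

/-- The cases that a step leaves to be considered, if the step is correct. -/
def cases (R : Rules) (s : PartialGraph) : CaseStep → Option (List PartialGraph)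
  | tree w => if decide (digits 7 w).Nodup && (digits 7 w).all (Nat.blt · s.size) &&
      R.edges.all fun e => s.present ((digits 7 w).getD e.1 0) ((digits 7 w).getD e.2 0)
    then some [] else none
  | cycle n w => if Nat.ble R.minCycle n && Nat.ble n 8 && decide (digits n w).Nodup &&
      (digits n w).all (Nat.blt · s.size) &&
      ((digits n w).zip ((digits n w).rotate 1)).all fun p => s.absent p.1 p.2
    then some [] else none
  | degree i => if s.closed i && Nat.blt (s.possibleNeighbors i).length R.minDegree
    then some [] else none
  | separate w => if decide (digits 4 w).Nodup && (digits 4 w).all s.closed &&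
      Nat.ble (s.possibleClosure (digits 4 w)).length R.maxClosure
    then some [] else none
  | edge i j => if Nat.blt i s.size && Nat.blt j s.size
    then some [s.addEdge i j, s.addNonedge i j] else none
  | grow i => if Nat.blt i s.size then some [s.grow i, s.close i] else none

/-- Check that a list of steps deals with a list of cases, the steps for the first case and its
subcases coming first. -/
def check (R : Rules) : List CaseStep → List PartialGraph → Bool
  | [], cs => cs.isEmpty
  | _ :: _, [] => false
  | st :: sts, s :: cs =>
    match st.cases R s with
    | some new => check R sts (new ++ cs)
    | none => false

lemma blt_eq_true {a b : ℕ} : Nat.blt a b = true ↔ a < b := by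
  simp [Nat.blt]

@[simp] lemma length_digits (n w : ℕ) : (digits n w).length = n := by
  simp [digits]

/-- Soundness of a single step. The steps `tree`, `cycle`, `degree` and `separate` leave no case, so
for them a contradiction with `R.Holds F` has to be found; `edge` and `grow` split into two
exhaustive alternatives. The naming is allowed to change because `grow` extends it. -/
theorem exists_realizes_of_cases {V : Type*} {R : Rules} {F : SimpleGraph V} (hR : R.Holds F)
    {s : PartialGraph} {φ : ℕ → V} (hs : Realizes F φ s) {st : CaseStep}
    {new : List PartialGraph} (h : st.cases R s = some new) :
    ∃ s' ∈ new, ∃ φ', Realizes F φ' s' := by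
  classical
  cases st with
  | tree w =>
    exfalso
    simp only [cases, Option.ite_none_right_eq_some, Bool.and_eq_true, decide_eq_true_eq,
      List.all_eq_true, blt_eq_true] at h
    obtain ⟨⟨⟨hnd, hlt⟩, hE⟩, -⟩ := h
    have hlen := length_digits 7 w
    have hget : ∀ i : Fin 7, (digits 7 w).getD i 0 = (digits 7 w)[(i : ℕ)] := fun i =>
      List.getD_eq_getElem _ _ _
    -- The digit of `w` at place `i`, counted from the left, names the image of vertex `i` of the
    -- tree. There are seven digits, so the default value `0` is never used.
    refine hR.tree (fun i => φ ((digits 7 w).getD i 0)) (fun i j hij => ?_)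
      fun e he => (hs.present _ _ (hE e he)).2.2
    simp only [hget] at hij
    have := hs.inj _ (hlt _ (List.getElem_mem _)) _ (hlt _ (List.getElem_mem _)) hij
    exact Fin.ext ((hnd.getElem_inj_iff).1 this)
  | cycle n w =>
    exfalso
    simp only [cases, Option.ite_none_right_eq_some, Bool.and_eq_true, Nat.ble_eq,
      decide_eq_true_eq, List.all_eq_true, blt_eq_true] at h
    obtain ⟨⟨⟨⟨⟨hmin, hmax⟩, hnd⟩, hlt⟩, hN⟩, -⟩ := h
    refine hR.cycle ((digits n w).map φ) ⟨?_, fun p hp => ?_⟩ (by simpa using hmin)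
      (by simpa using hmax)
    · exact hnd.map_on fun a ha b hb hab => hs.inj a (hlt a ha) b (hlt b hb) hab
    · rw [← List.map_rotate, List.zip_map, List.mem_map] at hp
      obtain ⟨q, hq, rfl⟩ := hp
      exact (hs.absent _ _ (hN q hq)).2.2
  | degree i =>
    exfalso
    simp only [cases, Option.ite_none_right_eq_some, Bool.and_eq_true, blt_eq_true] at h
    obtain ⟨⟨hcl, hdeg⟩, -⟩ := h
    -- Since `i` is closed, each of its neighbours is named and not excluded, hence in this set,
    -- which is smaller than the minimum degree.
    refine absurd (hR.degree (φ i) ((s.possibleNeighbors i).map φ).toFinset fun y hy => ?_) ?_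
    · obtain ⟨j, hj, rfl⟩ := (hs.closed i hcl).2 y hy
      simp only [List.mem_toFinset, List.mem_map, possibleNeighbors, List.mem_filter,
        List.mem_range]
      refine ⟨j, ⟨hj, ?_⟩, rfl⟩
      simp only [Bool.and_eq_true, Bool.not_eq_true', ← Bool.not_eq_true, Nat.beq_eq]
      exact ⟨by rintro rfl; exact hy.ne rfl, fun h => (hs.absent i j h).2.2 hy⟩
    · have := List.toFinset_card_le ((s.possibleNeighbors i).map φ)
      rw [List.length_map] at this
      omega
  | separate w =>
    exfalso
    simp only [cases, Option.ite_none_right_eq_some, Bool.and_eq_true, decide_eq_true_eq,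
      List.all_eq_true, Nat.ble_eq] at h
    obtain ⟨⟨⟨hnd, hcl⟩, hQ⟩, -⟩ := h
    have hlen := length_digits 4 w
    generalize digits 4 w = X at *
    have hlt : ∀ x ∈ X, x < s.size := fun x hx => (hs.closed x (hcl x hx)).1
    have hmem : ∀ j, j < s.size → (∃ x ∈ X, j = x ∨ s.absent x j ≠ true) →
        φ j ∈ ((s.possibleClosure X).map φ).toFinset := by
      rintro j hj ⟨x, hx, hxj⟩
      simp only [List.mem_toFinset, List.mem_map, possibleClosure, List.mem_filter,
        List.mem_range]
      refine ⟨j, ⟨hj, List.any_eq_true.2 ⟨x, hx, ?_⟩⟩, rfl⟩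
      simpa using hxj
    -- All four vertices are closed, so the named vertices not known to be non-adjacent to them,
    -- together with `X` itself, contain all their neighbours.
    refine hR.separate (X.map φ).toFinset ((s.possibleClosure X).map φ).toFinset ?_ ?_ ?_ ?_
    · rw [List.toFinset_card_of_nodup, List.length_map, hlen]
      exact hnd.map_on fun a ha b hb hab => hs.inj a (hlt a ha) b (hlt b hb) hab
    · intro v hv
      obtain ⟨x, hx, rfl⟩ := List.mem_map.1 (List.mem_toFinset.1 hv)
      exact hmem x (hlt x hx) ⟨x, hx, .inl rfl⟩
    · have := List.toFinset_card_le ((s.possibleClosure X).map φ)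
      rw [List.length_map] at this
      omega
    · intro v hv y hy
      obtain ⟨x, hx, rfl⟩ := List.mem_map.1 (List.mem_toFinset.1 hv)
      obtain ⟨j, hj, rfl⟩ := (hs.closed x (hcl x hx)).2 y hy
      exact hmem j hj ⟨x, hx, .inr fun h => (hs.absent x j h).2.2 hy⟩
  | edge i j =>
    simp only [cases, Option.ite_none_right_eq_some, Bool.and_eq_true, blt_eq_true,
      Option.some.injEq] at h
    obtain ⟨⟨hi, hj⟩, rfl⟩ := h
    by_cases hij : F.Adj (φ i) (φ j)
    · exact ⟨_, by simp, φ, hs.addEdge hi hj hij⟩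
    · exact ⟨_, by simp, φ, hs.addNonedge hi hj hij⟩
  | grow i =>
    simp only [cases, Option.ite_none_right_eq_some, blt_eq_true, Option.some.injEq] at h
    obtain ⟨hi, rfl⟩ := h
    by_cases hex : ∃ y, F.Adj (φ i) y ∧ ∀ j < s.size, φ j ≠ y
    · obtain ⟨y, hiy, hnew⟩ := hex
      exact ⟨_, by simp, _, hs.grow hi hiy hnew⟩
    · push Not at hex
      exact ⟨_, by simp, φ, hs.close hi hex⟩

/-- The list of cases is a stack of open branches, processed depth first. A realized case would pass
its realization on to one of its subcases, step after step, but a successful check ends with no open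
branch. -/
theorem not_realizes_of_check {V : Type*} {R : Rules} {F : SimpleGraph V} (hR : R.Holds F) :
    ∀ {sts : List CaseStep} {cs : List PartialGraph}, check R sts cs = true →
      ∀ s ∈ cs, ∀ φ, ¬ Realizes F φ s
  | [], [], _ => by simp
  | st :: sts, s₀ :: cs, h => by
    rw [check] at h
    split at h
    case h_2 => simp at h
    case h_1 new hnew =>
      have ih := not_realizes_of_check hR h
      intro s hs φ hφ
      rcases List.mem_cons.1 hs with rfl | hs
      · obtain ⟨s', hs', φ', hφ'⟩ := exists_realizes_of_cases hR hφ hnew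
        exact ih s' (List.mem_append_left _ hs') φ' hφ'
      · exact ih s (List.mem_append_right _ hs) φ hφ

end CaseStep

open PartialGraph CaseStep

/-! ### Upper bound: long cycles in the complement and small closed neighbourhoods -/

section Upper

variable {V : Type*} {F : SimpleGraph V}

lemma isContained_of_forall_edges {T : SimpleGraph (Fin 7)} {E : List (Fin 7 × Fin 7)}
    (hE : ∀ i j, T.Adj i j → (i, j) ∈ E ∨ (j, i) ∈ E) (f : Fin 7 → V) (hf : f.Injective)
    (h : ∀ e ∈ E, F.Adj (f e.1) (f e.2)) : T.IsContained F :=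
  ⟨⟨⟨f, fun {i j} hij => (hE i j hij).elim (h _) fun hji => (h _ hji).symm⟩, hf⟩⟩

lemma IsComplCycle.getElem {w : List V} (hc : IsComplCycle F w) {i j : ℕ} (hi : i < w.length)
    (hj : j < w.length) (hij : j = (i + 1) % w.length) : ¬ F.Adj w[i] w[j] := by
  subst hij
  have hz : i < (w.zip (w.rotate 1)).length := by simpa using hi
  have := hc.2 _ (List.getElem_mem hz)
  rwa [List.getElem_zip, List.getElem_rotate] at this

/-- This provides the initial state for extending a cycle: its vertices get the first names, and the
vertices of `l` the following ones. The default `v` is irrelevant, since only names below the length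
of `w ++ l` matter. -/
lemma IsComplCycle.realizes {w : List V} (hc : IsComplCycle F w) {l : List V}
    (hl : (w ++ l).Nodup) (v : V) :
    Realizes F (fun i => (w ++ l).getD i v) (ofCycle (w ++ l).length w.length) where
  inj i hi j hj hij := by
    rw [List.getD_eq_getElem _ _ hi, List.getD_eq_getElem _ _ hj] at hij
    exact hl.getElem_inj_iff.1 hij
  present i j h := by simp [ofCycle] at h
  closed i h := by simp [ofCycle] at h
  absent i j h := by
    simp only [ofCycle, Bool.and_eq_true, Bool.or_eq_true, Nat.beq_eq, blt_eq_true] at h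
    obtain ⟨⟨hi, hj⟩, h⟩ := h
    have hlen : (w ++ l).length = w.length + l.length := List.length_append
    have hget : ∀ a, (ha : a < w.length) → (w ++ l).getD a v = w[a] := fun a ha => by
      rw [List.getD_eq_getElem _ _ (by omega), List.getElem_append_left ha]
    refine ⟨by simp only [ofCycle]; omega, by simp only [ofCycle]; omega, ?_⟩
    rw [hget i hi, hget j hj]
    rcases h with h | h
    · exact hc.getElem hi hj h
    · exact fun h' => hc.getElem hj hi h h'.symm

lemma exists_append_nodup [Fintype V] {w : List V} (hc : w.Nodup) {n : ℕ} (hn : w.length ≤ n)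
    (hV : n ≤ Fintype.card V) : ∃ l, (w ++ l).Nodup ∧ (w ++ l).length = n := by
  classical
  obtain ⟨s, hs, hcard⟩ := Finset.exists_subset_card_eq
    (s := Finset.univ \ w.toFinset) (n := n - w.length) (by
      rw [Finset.card_sdiff_of_subset (Finset.subset_univ _), List.toFinset_card_of_nodup hc,
        Finset.card_univ]
      omega)
  refine ⟨s.toList, List.nodup_append.2 ⟨hc, s.nodup_toList, ?_⟩, ?_⟩
  · rintro a ha b hb rfl
    have := hs (Finset.mem_toList.1 hb)
    simp [ha] at this
  · rw [List.length_append, Finset.length_toList, hcard]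
    omega

/-- If cycles of each length `k < 8` in the complement can be replaced by longer ones, then the
complement has a cycle of length `8`. -/
theorem exists_complCycle [Fintype V] {T : SimpleGraph (Fin 7)} {E : List (Fin 7 × Fin 7)}
    (hE : ∀ i j, T.Adj i j → (i, j) ∈ E ∨ (j, i) ∈ E)
    (hk : ∀ k, 1 ≤ k → k ≤ 7 → ∃ sts, check ⟨E, k + 1, 0, 0⟩ sts [ofCycle 10 k] = true)
    (hV : 10 ≤ Fintype.card V) (hT : ¬ T.IsContained F) :
    ∃ w, IsComplCycle F w ∧ w.length = 8 := by
  have hstep : ∀ w, IsComplCycle F w → 1 ≤ w.length → w.length ≤ 7 →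
      ∃ w', IsComplCycle F w' ∧ w.length + 1 ≤ w'.length ∧ w'.length ≤ 8 := by
    intro w hc h1 h7
    by_contra! hno
    obtain ⟨sts, hsts⟩ := hk _ h1 h7
    obtain ⟨l, hl, hlen⟩ := exists_append_nodup hc.1 (by omega) hV
    -- Only the tree and cycle rules have content here: the minimum degree `0` is trivial, and no
    -- set of at most `0` vertices contains four.
    refine not_realizes_of_check (F := F) ⟨?_, ?_, ?_, ?_⟩ hsts _ (List.mem_singleton_self _) _
      (hlen ▸ hc.realizes hl (w[0]))
    · exact fun f hf h => hT (isContained_of_forall_edges hE f hf h)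
    · exact fun w' hc' hlong h8 => absurd (hno w' hc' hlong) (by omega)
    · exact fun _ _ _ => Nat.zero_le _
    · intro X Q hX hXQ hQ
      have := Finset.card_le_card hXQ
      simp only at hQ
      omega
  -- An extension may gain more than one vertex, so the induction carries a lower bound on the
  -- length, not its exact value. At `k = 7` the two bounds meet.
  have hind : ∀ k, k ≤ 7 → ∃ w, IsComplCycle F w ∧ k + 1 ≤ w.length ∧ w.length ≤ 8 := by
    intro k
    induction k with
    | zero =>
      intro _
      obtain ⟨v⟩ : Nonempty V := Fintype.card_pos_iff.1 (by omega)
      -- A single vertex counts as a closed walk of length `1`, because it is not adjacent to itself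
      -- in `F`. Likewise a cycle of length `2` is merely a non-adjacent pair.
      exact ⟨[v], ⟨by simp, by simp⟩, by simp, by simp⟩
    | succ k ih =>
      intro hk7
      obtain ⟨w, hc, hk1, hk8⟩ := ih (by omega)
      rcases hk8.eq_or_lt with h8 | h8
      · exact ⟨w, hc, by omega, by omega⟩
      · obtain ⟨w', hc', h, h'⟩ := hstep w hc (by omega) (by omega)
        exact ⟨w', hc', by omega, h'⟩
  obtain ⟨w, hc, h, h'⟩ := hind 7 le_rfl
  exact ⟨w, hc, by omega⟩

/-- A graph of minimum degree at least `d` without a given tree has four vertices all whose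
neighbours lie in a set of at most six vertices. -/
theorem exists_small_closure [Nonempty V] {T : SimpleGraph (Fin 7)} {E : List (Fin 7 × Fin 7)}
    (hE : ∀ i j, T.Adj i j → (i, j) ∈ E ∨ (j, i) ∈ E) {d : ℕ} {sts : List CaseStep}
    (hsts : check ⟨E, 9, d, 6⟩ sts [vertex] = true) (hT : ¬ T.IsContained F)
    (hd : ∀ (v : V) (Q : Finset V), (∀ y, F.Adj v y → y ∈ Q) → d ≤ Q.card) :
    ∃ X Q : Finset V, X.card = 4 ∧ X ⊆ Q ∧ Q.card ≤ 6 ∧ ∀ x ∈ X, ∀ y, F.Adj x y → y ∈ Q := by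
  by_contra! hno
  -- The analysis starts from one arbitrary vertex; a constant naming suffices, as `0` is the only
  -- name in use. With `minCycle = 9` the cycle rule is void, no length being both at least `9` and
  -- at most `8`.
  refine not_realizes_of_check (F := F) ⟨?_, ?_, hd, ?_⟩ hsts _ (List.mem_singleton_self _)
    (fun _ => Classical.arbitrary V) ⟨?_, ?_, ?_, ?_⟩
  · exact fun f hf h => hT (isContained_of_forall_edges hE f hf h)
  · exact fun w' hc' hlong h8 => by simp only at hlong; omega
  · intro X Q hX hXQ hQ h
    obtain ⟨x, hx, y, hxy, hy⟩ := hno X Q hX hXQ hQ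
    exact hy (h x hx y hxy)
  · intro i hi j hj _
    simp only [vertex] at hi hj
    omega
  all_goals simp [vertex]

/-! ### Upper bound: finding the wheel -/

lemma wheelGraph_isContained_compl {w : List V} (hc : IsComplCycle F w) (h8 : w.length = 8)
    {h : V} (hh : h ∉ w) (hhc : ∀ x ∈ w, ¬ F.Adj h x) : (wheelGraph 8).IsContained Fᶜ := by
  have hmem : ∀ i : Fin 8, w[(i : ℕ)] ∈ w := fun i => List.getElem_mem _
  have hcyc : ∀ i j : Fin 8, j - i = 1 → ¬ F.Adj w[(i : ℕ)] w[(j : ℕ)] := by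
    intro i j hij
    refine hc.getElem _ _ ?_
    rw [h8]
    revert i j
    decide
  refine ⟨⟨⟨fun o => o.elim h fun i => w[(i : ℕ)], ?_⟩, ?_⟩⟩
  · rintro (_ | i) (_ | j) hij
    · exact hij.elim
    · exact ⟨fun e : h = w[(j : ℕ)] => hh (e ▸ hmem j), hhc _ (hmem j)⟩
    · exact ⟨fun e : w[(i : ℕ)] = h => hh (e ▸ hmem i), fun h' => hhc _ (hmem i) h'.symm⟩
    · have hij' : (SimpleGraph.cycleGraph 8).Adj i j := hij
      refine ⟨fun e => hij'.ne (Fin.ext (hc.1.getElem_inj_iff.1 e)), ?_⟩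
      rcases SimpleGraph.cycleGraph_adj.1 hij' with h' | h'
      · exact fun h'' => hcyc j i h' h''.symm
      · exact hcyc i j h'
  · rintro (_ | i) (_ | j) hij
    · rfl
    · have e : h = w[(j : ℕ)] := hij
      exact (hh (e ▸ hmem j)).elim
    · have e : w[(i : ℕ)] = h := hij
      exact (hh (e ▸ hmem i)).elim
    · exact congrArg some (Fin.ext (hc.1.getElem_inj_iff.1 hij))

/-- The complement contains all edges between `X` and four vertices of `W`, hence an 8-cycle that
alternates between the two sets, and `h` serves as the hub. -/
lemma wheelGraph_isContained_compl_of_bipartite {X W : Finset V} (hX : X.card = 4)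
    (hW : 4 ≤ W.card) (hXW : ∀ x ∈ X, ∀ w ∈ W, x ≠ w ∧ ¬ F.Adj x w) {h : V}
    (hhX : ∀ x ∈ X, h ≠ x ∧ ¬ F.Adj h x) (hhW : ∀ w ∈ W, h ≠ w ∧ ¬ F.Adj h w) :
    (wheelGraph 8).IsContained Fᶜ := by
  classical
  obtain ⟨W', hW', hcard⟩ := Finset.exists_subset_card_eq hW
  obtain ⟨x, y, z, t, hxy, hxz, hxt, hyz, hyt, hzt, rfl⟩ := Finset.card_eq_four.1 hX
  obtain ⟨x', y', z', t', hxy', hxz', hxt', hyz', hyt', hzt', rfl⟩ := Finset.card_eq_four.1 hcard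
  replace hXW := fun x hx w hw => hXW x hx w (hW' hw)
  replace hhW := fun w hw => hhW w (hW' hw)
  simp only [Finset.mem_insert, Finset.mem_singleton, forall_eq_or_imp, forall_eq] at hXW hhX hhW
  refine wheelGraph_isContained_compl (w := [x, x', y, y', z, z', t, t']) ⟨?_, ?_⟩ rfl (h := h)
    ?_ ?_
  · simp only [List.nodup_cons, List.mem_cons, List.not_mem_nil, or_false, not_or]
    grind
  -- Every second rim edge runs from `W` back to `X`; commuting these four adjacencies brings all
  -- eight into the form supplied by `hXW`.
  · simp only [List.rotate_cons_succ, List.rotate_zero, List.cons_append, List.nil_append,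
      List.zip_cons_cons, List.zip_nil_right, List.mem_cons, List.not_mem_nil, or_false,
      forall_eq_or_imp, forall_eq, F.adj_comm x' y, F.adj_comm y' z, F.adj_comm z' t,
      F.adj_comm t' x]
    grind
  · simp only [List.mem_cons, List.not_mem_nil, or_false, not_or]
    grind
  · simp only [List.mem_cons, List.not_mem_nil, or_false, forall_eq_or_imp, forall_eq]
    grind

/-- A complement cycle of an induced subgraph is a complement cycle of the whole graph. -/
lemma IsComplCycle.map_val {s : Set V} {w : List s} (hc : IsComplCycle (F.induce s) w) :
    IsComplCycle F (w.map Subtype.val) := by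
  refine ⟨hc.1.map Subtype.val_injective, fun p hp => ?_⟩
  rw [← List.map_rotate, List.zip_map, List.mem_map] at hp
  obtain ⟨q, hq, rfl⟩ := hp
  exact hc.2 q hq

/-- The case distinction is on the minimum degree. A vertex of degree below `d` is a hub for an
8-cycle among its non-neighbours. If there is none, a nearly isolated set of four vertices supplies
every second rim vertex, and a second one cannot exist outside the first without leaving a vertex of
low degree. -/
theorem wheelGraph_isContained_compl_of_card [Fintype V] {T : SimpleGraph (Fin 7)}
    {E : List (Fin 7 × Fin 7)} (hE : ∀ i j, T.Adj i j → (i, j) ∈ E ∨ (j, i) ∈ E)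
    (hk : ∀ k, 1 ≤ k → k ≤ 7 → ∃ sts, check ⟨E, k + 1, 0, 0⟩ sts [ofCycle 10 k] = true)
    {d : ℕ} {sts : List CaseStep} (hsts : check ⟨E, 9, d, 6⟩ sts [vertex] = true) (hd : 3 ≤ d)
    (hV : Fintype.card V = 10 + d) (hT : ¬ T.IsContained F) :
    (wheelGraph 8).IsContained Fᶜ := by
  classical
  have hind : ∀ s : Set V, ¬ T.IsContained (F.induce s) := fun s h =>
    hT (h.trans ⟨(SimpleGraph.Embedding.induce s).toCopy⟩)
  by_cases hdeg : ∀ (v : V) (Q : Finset V), (∀ y, F.Adj v y → y ∈ Q) → d ≤ Q.card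
  swap
  · push Not at hdeg
    obtain ⟨v, Q, hvQ, hQ⟩ := hdeg
    -- Removing `v` and the at most `d - 1` vertices of `Q` from `10 + d` vertices leaves at least
    -- ten.
    obtain ⟨w, hc, h8⟩ := exists_complCycle (V := ((insert v Q)ᶜ : Finset V)) hE hk (by
      have := Finset.card_insert_le v Q
      rw [Fintype.card_coe, Finset.card_compl]
      omega) (hind ((insert v Q)ᶜ : Finset V))
    have hmem : ∀ x ∈ w.map Subtype.val, x ∉ insert v Q := by
      intro x hx
      obtain ⟨y, -, rfl⟩ := List.mem_map.1 hx
      exact Finset.mem_compl.1 y.2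
    refine wheelGraph_isContained_compl hc.map_val (by simpa using h8)
      (fun hv => hmem v hv (Finset.mem_insert_self _ _))
      fun x hx hvx => hmem x hx (Finset.mem_insert_of_mem (hvQ x hvx))
  have : Nonempty V := Fintype.card_pos_iff.1 (by omega)
  obtain ⟨X, Q, hX, hXQ, hQ, hXN⟩ := exists_small_closure hE hsts hT hdeg
  obtain ⟨U, hU, hUcard⟩ := Finset.exists_subset_card_eq (s := Qᶜ) (n := 4 + d) (by
    rw [Finset.card_compl]
    omega)
  have hUQ : ∀ u ∈ U, u ∉ Q := fun u hu => Finset.mem_compl.1 (hU hu)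
  by_cases hUdeg : ∃ u ∈ U, (U.filter (F.Adj u)).card < d
  · obtain ⟨u, hu, hud⟩ := hUdeg
    -- Of the `3 + d` other vertices of `U`, at most `d - 1` are neighbours of `u`, so at least four
    -- are not. None of them is adjacent to `X`, because the neighbours of `X` lie in `Q`.
    refine wheelGraph_isContained_compl_of_bipartite (h := u) hX
      (W := (U.erase u).filter (¬ F.Adj u ·)) ?_ ?_ ?_ ?_
    · have h1 := Finset.card_filter_add_card_filter_not (s := U.erase u) (F.Adj u)
      have h2 := Finset.card_le_card (Finset.filter_subset_filter (F.Adj u) (U.erase_subset u))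
      rw [Finset.card_erase_of_mem hu] at h1
      omega
    · intro x hx w hw
      simp only [Finset.mem_filter, Finset.mem_erase] at hw
      exact ⟨fun e => hUQ w hw.1.2 (e ▸ hXQ hx), fun h => hUQ w hw.1.2 (hXN x hx w h)⟩
    · exact fun x hx => ⟨fun e => hUQ u hu (e ▸ hXQ hx),
        fun h => hUQ u hu (hXN x hx u h.symm)⟩
    · intro w hw
      simp only [Finset.mem_filter, Finset.mem_erase] at hw
      exact ⟨hw.1.1.symm, hw.2⟩
  · exfalso
    push Not at hUdeg
    have hUdeg' : ∀ (v : (U : Set V)) (P : Finset (U : Set V)),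
        (∀ y, (F.induce U).Adj v y → y ∈ P) → d ≤ P.card := by
      intro v P hP
      refine (hUdeg v v.2).trans ?_
      rw [← Finset.card_map (Function.Embedding.subtype (· ∈ (U : Set V)))]
      refine Finset.card_le_card fun y hy => ?_
      rw [Finset.mem_filter] at hy
      exact Finset.mem_map.2 ⟨⟨y, hy.1⟩, hP ⟨y, hy.1⟩ hy.2, rfl⟩
    have hcardU : Fintype.card (U : Set V) = 4 + d := by
      rw [← hUcard]
      exact Fintype.card_coe U
    have : Nonempty (U : Set V) := Fintype.card_pos_iff.1 (by omega)
    obtain ⟨Y, P, hY, hYP, hP, hYN⟩ := exists_small_closure hE hsts (hind U) hUdeg'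
    -- This is where `3 ≤ d` enters: `P` has at most `6 < 4 + d` vertices.
    obtain ⟨z, hz⟩ : ∃ z, z ∉ P := by
      by_contra! hall
      have := Finset.card_le_card (fun z _ => hall z : Finset.univ ⊆ P)
      rw [Finset.card_univ] at this
      omega
    have hzY : z ∉ Y := fun h => hz (hYP h)
    -- The neighbours of `Y` lie in `P`, so `z` is adjacent to none of the four vertices of `Y`.
    -- This leaves at most `(4 + d) - 5 = d - 1` neighbours within `U`.
    have := hUdeg' z (insert z Y)ᶜ fun y hy => by
      rw [Finset.mem_compl, Finset.mem_insert, not_or]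
      exact ⟨hy.ne', fun h => hz (hYN y h z hy.symm)⟩
    rw [Finset.card_compl, Finset.card_insert_of_notMem hzY] at this
    omega

end Upper

/-! ### Lower bound: disjoint unions with `K₆` -/

section Lower

open SimpleGraph

lemma preconnected_of_exists_lt {n : ℕ} {T : SimpleGraph (Fin (n + 1))}
    (h : ∀ k, k ≠ 0 → ∃ j < k, T.Adj j k) : T.Preconnected := by
  have h0 : ∀ k, T.Reachable 0 k := fun k => by
    induction k using WellFoundedLT.induction with
    | ind k ih =>
      by_cases hk : k = 0
      · rw [hk]
      · obtain ⟨j, hj, hjk⟩ := h k hk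
        exact (ih j hj).trans hjk.reachable
  exact fun i j => (h0 i).symm.trans (h0 j)

lemma forall_eq_of_forall_adj {T : SimpleGraph (Fin 7)} (hT : T.Preconnected) {p : Fin 7 → Bool}
    (h : ∀ i j, T.Adj i j → p i = p j) (i j : Fin 7) : p i = p j := by
  obtain ⟨w⟩ := hT i j
  induction w with
  | nil => rfl
  | cons hadj _ ih => exact (h _ _ hadj).trans ih

variable {W : Type*} {H : SimpleGraph W}

/-- No edge joins the two summands, so a connected tree lies entirely in one of them, and `K₆` is
too small for seven vertices. -/
lemma not_isContained_top_sum {T : SimpleGraph (Fin 7)} (hT : T.Preconnected)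
    (hH : ¬ T.IsContained H) : ¬ T.IsContained ((⊤ : SimpleGraph (Fin 6)) ⊕g H) := by
  rintro ⟨f⟩
  have hside := forall_eq_of_forall_adj hT (p := fun i => (f i).isLeft) (fun i j hij => by
    have := f.toHom.map_adj hij
    revert this
    change ((⊤ : SimpleGraph (Fin 6)) ⊕g H).Adj (f i) (f j) → _
    rcases f i with a | a <;> rcases f j with b | b <;> simp)
  rcases h0 : (f 0).isLeft with _ | _
  · have hr : ∀ i, ∃ w, f i = Sum.inr w := fun i =>
      Sum.isRight_iff.1 (Sum.isLeft_eq_false.1 ((hside i 0).trans h0))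
    choose g hg using hr
    refine hH ⟨⟨⟨g, fun {i j} hij => ?_⟩, fun i j hij => f.injective ?_⟩⟩
    · have := f.toHom.map_adj hij
      change ((⊤ : SimpleGraph (Fin 6)) ⊕g H).Adj (f i) (f j) at this
      simpa [hg] using this
    · change f i = f j
      rw [hg, hg]
      exact congrArg _ hij
  · have hl : ∀ i, ∃ w, f i = Sum.inl w := fun i => Sum.isLeft_iff.1 ((hside i 0).trans h0)
    choose g hg using hl
    have hinj : g.Injective := fun i j hij => f.injective (by
      change f i = f j
      rw [hg, hg, hij])
    have := Fintype.card_le_of_injective g hinj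
    simp at this

/-- The disjoint union of `K₆` and `H` has no wheel `W₈` in its complement if every vertex of `H`
has at most three non-neighbours and the complement of `H` has no `8`-cycle. -/
lemma not_wheelGraph_isContained_compl_top_sum
    (hdeg : ∀ v, ∀ S : Finset W, (∀ u ∈ S, u ≠ v ∧ ¬ H.Adj v u) → S.card ≤ 3)
    (hcyc : ∀ f : Fin 8 → W, f.Injective → ¬ ∀ i, ¬ H.Adj (f i) (f (i + 1))) :
    ¬ (wheelGraph 8).IsContained ((⊤ : SimpleGraph (Fin 6)) ⊕g H)ᶜ := by
  classical
  rintro ⟨f⟩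
  have hadj : ∀ {a b}, (wheelGraph 8).Adj a b →
      ¬ ((⊤ : SimpleGraph (Fin 6)) ⊕g H).Adj (f a) (f b) := fun hab =>
    (f.toHom.map_adj hab).2
  have hne : ∀ {a b}, f a = f b → a = b := fun h => f.injective h
  have hrim : ∀ i : Fin 8, (wheelGraph 8).Adj (some i) (some (i + 1)) := fun i =>
    cycleGraph_adj.2 (.inr (by simp))
  have hhub : ∀ i : Fin 8, (wheelGraph 8).Adj none (some i) := fun _ => trivial
  rcases hh : f none with a | v
  -- Hub in `K₆`: it is adjacent in the union to all the rest of `K₆`, so the whole rim lies in `H`.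
  · have hr : ∀ i : Fin 8, ∃ w, f (some i) = Sum.inr w := by
      intro i
      rcases hi : f (some i) with b | w
      · have h := hadj (hhub i)
        have h' : f none ≠ f (some i) := fun e => by simpa using hne e
        rw [hh, hi] at h h'
        simp at h h'
        exact absurd h h'
      · exact ⟨w, rfl⟩
    choose g hg using hr
    refine hcyc g (fun i j hij => ?_) fun i => ?_
    · exact Option.some_injective _ (hne (by rw [hg, hg, hij]))
    · have := hadj (hrim i)
      simpa [hg] using this
  -- Hub in `H`: the rim is cut into the four disjoint edges `{2j, 2j + 1}`. Two vertices of `K₆`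
  -- are not adjacent in the complement, so each of these edges has an end in `H`, which gives four
  -- non-neighbours of `v`.
  · have hpair : ∀ j : Fin 4, ∃ i : Fin 8, i.val / 2 = j ∧ ∃ w, f (some i) = Sum.inr w := by
      intro j
      by_contra! hno
      have hl : ∀ i : Fin 8, i.val / 2 = j → ∃ a, f (some i) = Sum.inl a := by
        intro i hi
        rcases hi' : f (some i) with a | w
        · exact ⟨a, rfl⟩
        · exact absurd hi' (hno i hi w)
      obtain ⟨i, hi, hi'⟩ : ∃ i : Fin 8, i.val / 2 = j ∧ (i + 1).val / 2 = j :=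
        (by decide : ∀ j : Fin 4, ∃ i : Fin 8, i.val / 2 = j ∧ (i + 1).val / 2 = j) j
      obtain ⟨a, ha⟩ := hl i hi
      obtain ⟨b, hb⟩ := hl _ hi'
      have h := hadj (hrim i)
      have h' : f (some i) ≠ f (some (i + 1)) := fun e => (hrim i).ne (hne e)
      rw [ha, hb] at h h'
      simp at h h'
      exact absurd h h'
    choose k hk g hg using hpair
    have hinj : g.Injective := fun i j hij => by
      have : some (k i) = some (k j) := hne (by rw [hg, hg, hij])
      have hkk := Option.some_injective _ this
      exact Fin.ext (by rw [← hk i, ← hk j, hkk])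
    have := hdeg v (Finset.univ.map ⟨g, hinj⟩) (by
      intro u hu
      obtain ⟨j, -, rfl⟩ := Finset.mem_map.1 hu
      have h := hadj (hhub (k j))
      have h' : f none ≠ f (some (k j)) := fun e => by simpa using hne e
      rw [hh, hg] at h h'
      simp at h h'
      exact ⟨fun e => h' e.symm, h⟩)
    simp at this

/-- A graph without a copy of `G` and without a copy of `K` in its complement yields a lower bound
for the Ramsey number. -/
lemma card_lt_of_not_isContained {α β U : Type*} [Fintype U] {G : SimpleGraph α}
    {K : SimpleGraph β} {F : SimpleGraph U} (hG : ¬ G.IsContained F) (hK : ¬ K.IsContained Fᶜ)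
    {k : ℕ} (hk : ∀ F : SimpleGraph (Fin k), G.IsContained F ∨ K.IsContained Fᶜ) :
    Fintype.card U < k := by
  by_contra! hle
  -- The induced subgraph on any `k` vertices of `F` would still avoid both graphs.
  obtain ⟨e⟩ : Nonempty (Fin k ↪ U) := Function.Embedding.nonempty_of_card_le (by simpa using hle)
  rcases hk (F.comap e) with h | h
  · exact hG (h.trans ⟨(Embedding.comap e F).toCopy⟩)
  · refine hK (h.trans ⟨⟨⟨e, fun {a b} hab => ?_⟩, e.injective⟩⟩)
    exact ⟨fun h' => hab.1 (e.injective h'), hab.2⟩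

lemma not_isContained_of_card_lt {α β : Type*} [Fintype α] [Fintype β] {G : SimpleGraph α}
    {H : SimpleGraph β} (h : Fintype.card β < Fintype.card α) : ¬ G.IsContained H := fun ⟨f⟩ =>
  (Fintype.card_le_of_injective f f.injective).not_gt h

/-- Two copies of `K₄` that share the vertex `3`. -/
def twoK4 : SimpleGraph (Fin 7) where
  Adj i j := i ≠ j ∧ ((i ≤ 3 ∧ j ≤ 3) ∨ (3 ≤ i ∧ 3 ≤ j))
  symm := ⟨fun _ _ h => ⟨h.1.symm, h.2.imp And.symm And.symm⟩⟩
  loopless := ⟨fun _ h => h.1 rfl⟩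

instance : DecidableRel twoK4.Adj := fun _ _ => inferInstanceAs (Decidable (_ ∧ _))

lemma card_le_three_twoK4 (v : Fin 7) (S : Finset (Fin 7))
    (hS : ∀ u ∈ S, u ≠ v ∧ ¬ twoK4.Adj v u) : S.card ≤ 3 := by
  refine (Finset.card_le_card (t := Finset.univ.filter fun u => u ≠ v ∧ ¬ twoK4.Adj v u)
    fun u hu => by simpa using hS u hu).trans ?_
  clear hS
  revert v
  decide

/-- A copy of `D` would use all seven vertices. Removing the shared vertex leaves two triangles
without edges between them, but removing a vertex of `D` leaves parts of sizes `2, 2, 2` or `1, 5`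
or `6`, which cannot be grouped as `3 + 3`. The proof itself is an enumeration. -/
lemma not_treeD_isContained_twoK4 : ¬ treeD.IsContained twoK4 := by
  -- The centre `c` is followed by its three legs `a a'`, `b b'` and `d d'`. Each condition stands
  -- as early as possible, so that the enumeration abandons impossible partial embeddings at once.
  have key : ∀ c a, twoK4.Adj c a → ∀ a', a' ≠ c → twoK4.Adj a a' →
      ∀ b, b ≠ a → b ≠ a' → twoK4.Adj c b → ∀ b', b' ≠ c → b' ≠ a → b' ≠ a' → twoK4.Adj b b' →
      ∀ d, d ≠ a → d ≠ a' → d ≠ b → d ≠ b' → twoK4.Adj c d →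
      ∀ d', d' ≠ c → d' ≠ a → d' ≠ a' → d' ≠ b → d' ≠ b' → ¬ twoK4.Adj d d' := by
    decide +kernel
  rintro ⟨f⟩
  have hadj : ∀ {i j}, treeD.Adj i j → twoK4.Adj (f i) (f j) := fun h => f.toHom.map_adj h
  have hne : ∀ {i j}, i ≠ j → f i ≠ f j := fun h e => h (f.injective e)
  refine key (f 2) (f 1) (hadj ?_) (f 0) (hne ?_) (hadj ?_) (f 3) (hne ?_) (hne ?_) (hadj ?_)
    (f 4) (hne ?_) (hne ?_) (hne ?_) (hadj ?_) (f 5) (hne ?_) (hne ?_) (hne ?_) (hne ?_) (hadj ?_)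
    (f 6) (hne ?_) (hne ?_) (hne ?_) (hne ?_) (hne ?_) (hadj ?_)
  all_goals first | decide | simp [treeD]

/-- The complete bipartite graph `K₄,₄`. -/
abbrev K44 : SimpleGraph (Fin 4 ⊕ Fin 4) := completeBipartiteGraph (Fin 4) (Fin 4)

lemma not_injective_of_isLeft_eq {n : ℕ} (hn : 4 < n) {f : Fin n → Fin 4 ⊕ Fin 4}
    (hf : ∀ i j, (f i).isLeft = (f j).isLeft) : ¬ f.Injective := by
  intro hinj
  have hinj' : Function.Injective fun i => (f i).elim id id := by
    intro i j hij
    apply hinj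
    have := hf i j
    revert this hij
    dsimp only
    rcases f i with a | a <;> rcases f j with b | b <;> simp
  have := Fintype.card_le_of_injective _ hinj'
  simp at this
  omega

lemma K44_adj_iff {a b : Fin 4 ⊕ Fin 4} : K44.Adj a b ↔ a.isLeft ≠ b.isLeft := by
  rcases a with a | a <;> rcases b with b | b <;> simp [completeBipartiteGraph]

lemma card_le_three_K44 (v : Fin 4 ⊕ Fin 4) (S : Finset (Fin 4 ⊕ Fin 4))
    (hS : ∀ u ∈ S, u ≠ v ∧ ¬ K44.Adj v u) : S.card ≤ 3 := by
  simp only [K44_adj_iff] at hS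
  refine (Finset.card_le_card (t := Finset.univ.filter fun u => u ≠ v ∧ ¬ v.isLeft ≠ u.isLeft)
    fun u hu => by simpa using hS u hu).trans ?_
  clear hS
  revert v
  decide

/-- The complement of `K₄,₄` consists of two disjoint copies of `K₄`, so a closed walk in it stays
on one side and meets at most four vertices. -/
lemma not_complCycle_K44 (f : Fin 8 → Fin 4 ⊕ Fin 4) (hf : f.Injective) :
    ¬ ∀ i, ¬ K44.Adj (f i) (f (i + 1)) := by
  intro h
  simp only [K44_adj_iff, not_not] at h
  have h0 : ∀ i, (f i).isLeft = (f 0).isLeft := by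
    intro i
    induction i using Fin.induction with
    | zero => rfl
    | succ i ih =>
      rw [← ih, h i.castSucc]
      simp
  exact not_injective_of_isLeft_eq (by norm_num) (fun i j => (h0 i).trans (h0 j).symm) hf

/-- The colour classes of `E` are `{0, 2, 4, 5, 6}` and `{1, 3}`. In `K₄,₄` the larger one would
have to lie on a side with only four vertices. -/
lemma not_treeE_isContained_K44 : ¬ treeE.IsContained K44 := by
  rintro ⟨f⟩
  have hadj : ∀ {i j}, treeE.Adj i j → (f i).isLeft = !(f j).isLeft := fun {i j} h => by
    have := K44_adj_iff.1 (f.toHom.map_adj h)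
    exact Bool.eq_not.2 this
  let g : Fin 5 → Fin 7 := ![0, 2, 5, 4, 6]
  have hg : g.Injective := by decide
  refine not_injective_of_isLeft_eq (f := f ∘ g) (by norm_num) ?_ (f.injective.comp hg)
  have h01 := hadj (i := 0) (j := 1) (by simp [treeE])
  have h21 := hadj (i := 2) (j := 1) (by simp [treeE])
  have h51 := hadj (i := 5) (j := 1) (by simp [treeE])
  have h23 := hadj (i := 2) (j := 3) (by simp [treeE])
  have h43 := hadj (i := 4) (j := 3) (by simp [treeE])
  have h63 := hadj (i := 6) (j := 3) (by simp [treeE])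
  have h0 : ∀ i, (f (g i)).isLeft = (f 2).isLeft := by
    intro i
    fin_cases i
    exacts [h01.trans h21.symm, rfl, h51.trans h21.symm, h43.trans h23.symm, h63.trans h23.symm]
  exact fun i j => (h0 i).trans (h0 j).symm

end Lower

open PartialGraph CaseStep SimpleGraph

/-! ### Certificates for the tree `A` -/

/-- The edges of the tree `A`, each vertex following its parent. -/
def treeAEdges : List (Fin 7 × Fin 7) :=
  [(0, 1), (1, 2), (2, 3), (3, 4), (4, 5), (1, 6)]

lemma treeA_adj_iff : ∀ i j, treeA.Adj i j ↔ (i, j) ∈ treeAEdges ∨ (j, i) ∈ treeAEdges := by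
  simp only [treeA, fromEdgeSet_adj, Set.mem_insert_iff, Set.mem_singleton_iff]
  decide

lemma treeA_preconnected : treeA.Preconnected :=
  preconnected_of_exists_lt <| by
    simp only [treeA_adj_iff]
    decide

/-- The cases for `exists_small_closure`: minimum degree at least `3`, no tree `A`. -/
def treeASmallClosure : List CaseStep :=
  [.grow 0, .grow 0, .grow 2, .grow 3, .grow 1, .grow 1, .tree 5102346, .grow 3, .tree 4320156,
  .grow 5, .edge 0 3, .tree 2301564, .grow 6, .edge 4 6, .tree 4651027, .edge 0 6, .tree 5602347,
  .edge 1 2, .tree 0215673, .edge 1 3, .tree 2315674, .grow 6, .tree 7651028, .edge 1 4,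
  .edge 6 2, .tree 0143265, .degree 6, .degree 1, .edge 0 6, .edge 1 3, .tree 1320654, .edge 3 5,
  .tree 1065342, .degree 3, .edge 6 2, .edge 6 4, .edge 1 2, .tree 0123465, .edge 1 3,
  .tree 0132645, .edge 1 4, .tree 0143265, .degree 1, .degree 6, .degree 6, .grow 0, .edge 4 5,
  .tree 1023456, .edge 3 5, .tree 2015346, .edge 5 0, .edge 5 2, .tree 1052346, .degree 5,
  .degree 5, .separate 0135, .grow 0, .grow 4, .tree 1023465, .grow 3, .edge 1 4, .tree 2014365,
  .edge 1 2, .tree 4321056, .degree 1, .grow 5, .edge 1 3, .tree 1320564, .grow 5, .tree 6502347,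
  .edge 1 2, .edge 1 4, .edge 2 5, .tree 0521436, .edge 3 5, .tree 0123564, .edge 4 5,
  .tree 0214563, .degree 5, .degree 1, .degree 1, .separate 1345, .grow 3, .grow 5, .edge 0 4,
  .tree 1023564, .edge 4 5, .tree 4532016, .grow 5, .tree 6532017, .edge 0 3, .edge 5 2,
  .edge 1 3, .tree 1302564, .edge 1 4, .tree 2530146, .degree 1, .degree 5, .degree 0, .edge 5 2,
  .edge 5 4, .grow 3, .tree 4352016, .grow 4, .tree 3452016, .separate 0134, .degree 5, .degree 5,
  .grow 4, .grow 4, .tree 5432016, .separate 0134, .separate 0134, .edge 3 0, .edge 3 1, .grow 1,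
  .grow 4, .grow 0, .tree 2031456, .grow 2, .tree 0231456, .grow 4, .tree 5410236, .separate 0234,
  .edge 4 0, .edge 4 2, .grow 1, .grow 0, .tree 3024156, .grow 1, .tree 5103246, .grow 2,
  .tree 3104265, .separate 0123, .grow 0, .grow 0, .tree 5013246, .grow 2, .tree 3014265,
  .separate 0123, .separate 0134, .degree 4, .degree 4, .edge 1 2, .grow 0, .grow 4, .grow 2,
  .tree 1230456, .grow 4, .tree 5401236, .separate 1234, .degree 4, .grow 2, .grow 4, .grow 4,
  .tree 5420136, .degree 4, .degree 4, .separate 0123, .degree 1, .degree 3, .degree 3, .degree 2,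
  .degree 0, .degree 0]

lemma check_treeASmallClosure :
    check ⟨treeAEdges, 9, 3, 6⟩ treeASmallClosure [vertex] = true := by
  decide +kernel

/-- The cases for `exists_complCycle`: ten vertices, no tree `A`, and in the complement a cycle of
length `k`, but none of a length between `k + 1` and `8`. -/
def treeAExtension : ℕ → List CaseStep
  | 1 =>
    [.edge 2 8, .edge 2 7, .edge 1 7, .edge 3 5, .edge 0 5, .edge 1 5, .tree 0517283, .cycle 2 15,
    .cycle 2 05, .cycle 2 35, .cycle 2 17, .cycle 2 27, .cycle 2 28]
  | 2 =>
    [.edge 0 5, .edge 1 3, .edge 1 8, .edge 0 9, .edge 0 2, .edge 5 8, .tree 2058139, .edge 3 5,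
    .tree 2053189, .edge 3 9, .tree 2093185, .edge 8 9, .tree 2098135, .cycle 4 8539, .edge 1 2,
    .edge 2 9, .tree 3129058, .edge 3 9, .tree 2139058, .edge 2 3, .edge 1 9, .edge 0 4,
    .tree 4091235, .edge 3 4, .tree 2319054, .cycle 5 39204, .cycle 4 1029, .cycle 3 293,
    .cycle 3 102, .edge 1 9, .edge 0 2, .edge 2 8, .tree 3182059, .edge 5 8, .tree 3185029,
    .edge 2 3, .tree 8132059, .edge 3 5, .tree 8135029, .cycle 4 3285, .edge 1 2, .edge 2 9,
    .edge 2 5, .tree 3192508, .edge 5 9, .tree 3129508, .cycle 4 5209, .cycle 3 209, .cycle 3 102,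
    .cycle 3 109, .edge 0 8, .edge 0 7, .edge 1 2, .edge 2 7, .tree 5072138, .edge 2 5,
    .tree 7052138, .edge 3 5, .tree 7053128, .edge 3 7, .tree 5073128, .cycle 4 3527, .edge 0 2,
    .edge 2 8, .edge 2 3, .tree 5082317, .edge 3 8, .tree 5028317, .cycle 4 3218, .cycle 3 218,
    .cycle 3 012, .edge 1 7, .edge 7 8, .edge 0 6, .tree 5087136, .edge 1 6, .tree 3178056,
    .cycle 3 106, .cycle 4 7018, .cycle 3 107, .cycle 3 018, .edge 0 3, .edge 1 9, .edge 0 2,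
    .edge 1 4, .edge 3 9, .tree 2039145, .edge 3 4, .tree 2034195, .edge 5 9, .tree 2059143,
    .edge 4 5, .tree 2054193, .cycle 4 4395, .edge 0 4, .edge 3 4, .edge 4 9, .tree 2034915,
    .edge 3 9, .tree 2043915, .cycle 4 3149, .cycle 3 314, .cycle 3 014, .edge 1 2, .edge 2 3,
    .edge 1 6, .tree 6123059, .edge 2 6, .edge 0 6, .tree 3062195, .cycle 3 016, .cycle 4 2016,
    .cycle 4 2013, .cycle 3 102, .edge 0 9, .edge 3 9, .edge 2 3, .edge 0 4, .edge 2 7,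
    .tree 4093275, .edge 2 6, .tree 4093265, .edge 1 2, .tree 4093215, .edge 1 6, .edge 1 7,
    .edge 3 6, .tree 4036175, .cycle 4 3126, .cycle 3 127, .cycle 3 126, .edge 3 4, .edge 4 9,
    .edge 0 8, .tree 5094328, .edge 1 4, .edge 1 8, .tree 0394182, .cycle 3 108, .cycle 3 104,
    .cycle 4 4019, .cycle 4 3104, .edge 2 9, .edge 1 2, .edge 1 8, .tree 3092185, .edge 0 7,
    .tree 5039217, .edge 7 8, .edge 3 7, .edge 0 2, .tree 0293781, .cycle 4 0132, .cycle 4 3107,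
    .cycle 4 7018, .cycle 3 132, .cycle 4 2319, .cycle 3 319, .cycle 3 019, .cycle 3 013,
    .edge 1 5, .edge 0 2, .edge 1 6, .edge 1 7, .edge 0 3, .edge 3 6, .tree 5163027, .edge 2 7,
    .tree 5172036, .edge 2 6, .tree 5162037, .edge 3 7, .tree 5173026, .cycle 4 3627, .edge 1 3,
    .edge 3 5, .edge 2 3, .tree 6153207, .edge 2 5, .tree 6135207, .cycle 4 2305, .cycle 3 305,
    .cycle 3 103, .edge 0 7, .edge 5 7, .edge 0 4, .tree 2075164, .edge 1 4, .tree 4157026,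
    .cycle 3 104, .cycle 4 5017, .cycle 3 017, .edge 5 6, .edge 0 6, .edge 0 3, .edge 1 8,
    .tree 2065183, .edge 6 8, .edge 0 8, .tree 2086513, .cycle 3 018, .cycle 3 618, .edge 3 5,
    .edge 1 3, .edge 1 8, .tree 3156028, .edge 3 8, .tree 1356028, .cycle 4 3018, .cycle 3 103,
    .cycle 3 305, .cycle 3 016, .cycle 4 5016, .edge 2 5, .edge 1 2, .edge 0 9, .edge 1 8,
    .edge 0 3, .edge 2 9, .tree 5129038, .edge 0 8, .tree 3081259, .edge 8 9, .tree 2189035,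
    .cycle 4 8029, .edge 2 3, .edge 3 9, .tree 5123908, .edge 3 5, .edge 5 9, .edge 1 3,
    .tree 2135908, .cycle 3 103, .cycle 4 5039, .cycle 3 305, .cycle 3 203, .edge 2 8, .edge 5 8,
    .edge 0 8, .edge 2 3, .tree 1258093, .edge 3 5, .tree 1528093, .cycle 4 3205, .cycle 3 018,
    .cycle 4 5018, .cycle 4 2018, .edge 5 9, .edge 1 9, .edge 2 9, .edge 2 6, .edge 0 3,
    .edge 3 9, .tree 1259306, .edge 3 5, .tree 1295306, .cycle 4 3905, .edge 3 5, .edge 3 9,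
    .edge 3 7, .tree 1259376, .edge 1 7, .edge 0 7, .tree 2591703, .cycle 3 037, .cycle 4 1037,
    .cycle 3 309, .cycle 3 305, .edge 5 6, .edge 0 6, .edge 3 6, .tree 0651293, .edge 3 9,
    .tree 1925603, .cycle 5 36209, .cycle 3 026, .cycle 4 5026, .cycle 3 209, .cycle 3 109,
    .cycle 3 509, .cycle 3 102, .cycle 3 205, .cycle 3 105]
  | 3 =>
    [.edge 2 6, .edge 0 7, .edge 0 4, .edge 2 9, .edge 0 3, .edge 6 7, .tree 3076294, .edge 7 9,
    .tree 3079264, .edge 4 9, .tree 3049267, .edge 4 6, .tree 3046297, .cycle 4 4976, .edge 2 3,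
    .edge 1 3, .edge 1 7, .tree 6231709, .edge 7 9, .tree 3297046, .edge 0 9, .tree 4092317,
    .cycle 4 0179, .cycle 4 1203, .cycle 4 2103, .edge 1 9, .edge 0 9, .edge 1 6, .tree 4091627,
    .edge 6 9, .edge 2 5, .tree 4096257, .edge 5 6, .edge 0 5, .tree 4056917, .cycle 4 0125,
    .cycle 4 5216, .cycle 4 6129, .cycle 4 0129, .cycle 4 1029, .edge 2 4, .edge 1 4, .edge 2 3,
    .edge 1 7, .tree 3241706, .edge 4 7, .edge 0 8, .tree 3247086, .edge 1 8, .edge 7 8,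
    .tree 3241876, .cycle 4 7108, .cycle 4 1208, .cycle 4 4017, .edge 1 3, .edge 0 3, .edge 2 9,
    .tree 6241309, .edge 4 9, .tree 2413079, .cycle 4 4029, .cycle 4 0123, .cycle 4 1023,
    .cycle 4 1204, .cycle 4 2104, .edge 1 7, .edge 2 7, .edge 2 3, .edge 0 4, .edge 1 4,
    .tree 3271406, .edge 2 4, .edge 4 7, .edge 1 5, .tree 3247156, .edge 0 5, .tree 3274056,
    .cycle 4 0215, .cycle 4 4107, .cycle 4 2014, .edge 1 4, .edge 4 5, .tree 3271456, .edge 5 7,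
    .edge 1 5, .tree 3275146, .cycle 4 1045, .cycle 4 5407, .cycle 4 1204, .edge 1 3, .edge 0 3,
    .edge 2 4, .tree 4271306, .edge 2 9, .tree 6271309, .edge 1 4, .edge 3 7, .edge 1 9,
    .tree 4137269, .cycle 4 1029, .cycle 4 3207, .cycle 4 1024, .cycle 4 0123, .cycle 4 1023,
    .cycle 4 2107, .cycle 4 1207, .edge 0 6, .edge 1 6, .edge 0 8, .edge 0 9, .edge 1 3,
    .edge 3 4, .tree 8061349, .edge 2 3, .tree 8061329, .edge 4 6, .edge 0 3, .tree 8031649,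
    .cycle 4 0123, .cycle 4 4326, .edge 2 3, .edge 3 6, .edge 2 7, .tree 8063279, .edge 1 7,
    .edge 2 5, .tree 8063259, .edge 1 5, .edge 0 3, .tree 5160327, .cycle 4 0213, .cycle 4 1025,
    .cycle 4 1027, .cycle 4 3126, .cycle 4 2013, .edge 2 9, .edge 1 9, .edge 3 9, .tree 2916083,
    .edge 4 9, .tree 2916084, .edge 0 4, .tree 4061928, .edge 0 3, .tree 3061928, .cycle 4 0493,
    .cycle 4 1209, .cycle 4 2109, .edge 6 8, .edge 1 8, .edge 2 8, .edge 0 3, .edge 4 8,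
    .tree 2816034, .edge 4 6, .edge 0 9, .tree 3061829, .edge 2 3, .tree 0618234, .edge 3 9,
    .tree 1860392, .cycle 4 3209, .cycle 5 48026, .edge 3 6, .edge 2 7, .tree 0618273, .edge 7 8,
    .edge 2 3, .tree 0632871, .cycle 4 2103, .cycle 4 7208, .cycle 4 3026, .cycle 4 2108,
    .cycle 4 1208, .cycle 4 6208, .cycle 4 1026, .cycle 4 0126]
  | 4 =>
    [.edge 1 9, .edge 3 8, .edge 1 6, .edge 1 8, .edge 0 4, .edge 3 4, .tree 6183409, .edge 2 4,
    .edge 4 6, .tree 0461832, .edge 2 6, .tree 8162409, .cycle 6 210346, .cycle 5 21034,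
    .edge 3 4, .edge 2 4, .tree 6183429, .edge 4 7, .tree 6183479, .edge 0 7, .edge 1 4,
    .edge 3 7, .tree 4183706, .cycle 6 301247, .cycle 5 10324, .cycle 5 01247, .cycle 5 32104,
    .edge 2 8, .edge 0 8, .edge 3 6, .tree 0836192, .edge 2 6, .tree 0826193, .cycle 5 21036,
    .cycle 5 03218, .cycle 5 23018, .edge 0 6, .edge 2 6, .edge 1 8, .edge 6 9, .tree 0691832,
    .edge 3 9, .edge 2 9, .edge 0 4, .tree 1926043, .edge 3 4, .tree 4392608, .cycle 5 32104,
    .cycle 6 230169, .cycle 5 30169, .edge 0 8, .edge 2 8, .edge 6 9, .tree 0826913, .edge 0 9,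
    .edge 3 9, .tree 0938261, .cycle 5 30169, .cycle 6 032169, .cycle 5 23018, .cycle 5 03218,
    .cycle 5 23016, .cycle 5 03216, .edge 2 8, .edge 0 8, .edge 6 8, .edge 0 4, .edge 4 9,
    .tree 2804916, .edge 1 4, .tree 2804196, .edge 2 9, .edge 4 8, .edge 0 2, .tree 4802916,
    .edge 3 4, .tree 0482913, .cycle 5 30214, .cycle 5 41038, .cycle 6 230149, .edge 3 4,
    .edge 1 4, .edge 3 6, .tree 0863412, .edge 4 6, .tree 0864192, .cycle 6 401236,
    .cycle 5 12304, .cycle 5 32104, .edge 0 6, .edge 1 6, .edge 7 8, .tree 2806197, .edge 1 7,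
    .tree 7160829, .cycle 5 10387, .cycle 5 10386, .cycle 6 012386, .cycle 5 01238,
    .cycle 5 21038, .edge 2 9, .edge 0 9, .edge 8 9, .edge 0 6, .edge 1 4, .edge 1 6,
    .tree 2906148, .edge 4 6, .tree 2906418, .edge 2 4, .edge 2 6, .edge 4 7, .tree 1426097,
    .edge 2 7, .tree 4260987, .cycle 5 21647, .cycle 5 23016, .cycle 6 230164, .edge 2 4,
    .edge 0 4, .edge 3 9, .tree 3924068, .edge 7 9, .tree 7924068, .edge 4 9, .edge 3 7,
    .edge 0 7, .tree 2940738, .cycle 6 012397, .cycle 5 30197, .cycle 5 41039, .cycle 5 03214,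
    .cycle 5 23014, .edge 3 6, .edge 1 6, .edge 3 8, .tree 0983612, .edge 6 8, .edge 2 8,
    .tree 1682903, .cycle 5 21038, .cycle 6 601238, .cycle 5 12306, .cycle 5 32106, .edge 0 8,
    .edge 3 8, .edge 2 8, .edge 0 4, .edge 6 8, .tree 3829046, .edge 5 8, .tree 3829045,
    .edge 2 5, .edge 2 6, .tree 5290836, .cycle 5 21986, .cycle 5 21985, .edge 1 4, .edge 4 9,
    .tree 0829413, .cycle 6 403219, .cycle 5 12304, .cycle 6 230198, .cycle 5 30198,
    .cycle 6 032198, .cycle 5 03219, .cycle 5 23019]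
  | 5 =>
    [.edge 2 5, .edge 2 9, .edge 1 7, .edge 4 9, .edge 0 7, .edge 4 7, .tree 0749251, .edge 5 7,
    .tree 0752941, .edge 1 5, .edge 3 9, .tree 3925174, .edge 5 9, .tree 2951704,
    .cycle 8 57401239, .cycle 6 123475, .edge 4 7, .edge 2 6, .tree 5294716, .edge 3 7,
    .tree 1749253, .edge 1 6, .edge 1 4, .tree 6149257, .cycle 6 123704, .cycle 6 104326,
    .cycle 6 432107, .edge 3 9, .edge 0 9, .edge 1 5, .tree 0925173, .edge 5 9, .edge 5 7,
    .tree 0925713, .edge 2 7, .tree 0952713, .cycle 7 2340157, .cycle 6 512349, .cycle 6 012349,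
    .cycle 6 321049, .edge 0 7, .edge 2 7, .edge 0 6, .edge 4 6, .tree 5270649, .edge 3 6,
    .tree 5270639, .cycle 6 321046, .edge 1 6, .edge 4 6, .edge 6 7, .edge 4 5, .tree 1645297,
    .edge 0 5, .tree 1670524, .cycle 6 012345, .cycle 7 6043217, .cycle 6 432106, .cycle 6 123406,
    .cycle 6 234017, .cycle 6 043217, .edge 1 9, .edge 3 9, .edge 4 5, .edge 0 3, .edge 0 5,
    .tree 2503914, .edge 1 5, .tree 2519304, .cycle 6 123405, .edge 4 9, .edge 2 8, .tree 1945283,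
    .edge 3 8, .edge 1 8, .edge 4 7, .tree 5491837, .edge 2 7, .tree 1945273, .cycle 6 210347,
    .cycle 6 104328, .cycle 6 340128, .cycle 6 430129, .edge 3 5, .edge 0 5, .edge 1 4,
    .tree 0539142, .edge 1 7, .tree 0539172, .edge 7 9, .edge 0 7, .tree 1970523, .cycle 6 043217,
    .cycle 6 714329, .cycle 6 012345, .cycle 6 321045, .cycle 6 340129, .cycle 6 104329,
    .edge 1 5, .edge 3 5, .edge 5 9, .edge 4 8, .edge 0 8, .edge 0 9, .tree 1590843, .edge 4 9,
    .tree 1594803, .cycle 6 432109, .edge 1 8, .edge 4 6, .tree 3518469, .edge 2 4, .tree 3518429,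
    .edge 5 6, .edge 0 6, .edge 4 9, .tree 3518496, .edge 8 9, .tree 1895604, .cycle 6 801249,
    .cycle 6 012346, .cycle 6 521046, .cycle 6 123408, .edge 5 8, .edge 3 8, .edge 0 8, .edge 0 7,
    .tree 1538079, .edge 5 7, .edge 4 7, .edge 8 9, .tree 0835749, .edge 7 9, .tree 0859743,
    .cycle 8 70123489, .cycle 6 432107, .cycle 6 523407, .cycle 6 012348, .cycle 6 321048,
    .cycle 6 521048, .edge 1 9, .edge 0 9, .edge 4 9, .edge 3 6, .tree 0915364, .edge 3 8,
    .tree 0915384, .edge 2 8, .edge 2 6, .edge 4 8, .tree 0948261, .cycle 6 401238,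
    .cycle 6 210436, .cycle 6 210438, .cycle 6 401259, .cycle 6 043259, .cycle 7 1043259,
    .cycle 6 340125, .cycle 6 104325]
  | 6 =>
    [.edge 2 8, .edge 3 6, .edge 0 9, .edge 5 8, .edge 0 6, .edge 8 9, .tree 2890635, .edge 3 8,
    .tree 2836095, .edge 5 9, .edge 4 8, .tree 2859064, .cycle 7 4501238, .cycle 7 5012389,
    .edge 5 6, .edge 1 6, .edge 0 8, .tree 1658093, .edge 8 9, .tree 1658903, .edge 2 9,
    .tree 1658293, .cycle 7 2345089, .cycle 7 1234506, .cycle 7 5432106, .edge 0 8, .edge 4 8,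
    .edge 6 9, .tree 2809634, .edge 3 9, .tree 2809364, .edge 2 6, .edge 4 6, .tree 2648093,
    .cycle 8 45012396, .cycle 8 21054396, .cycle 7 4321058, .cycle 7 0123458, .edge 5 9,
    .edge 1 9, .edge 2 6, .edge 3 9, .tree 1936285, .edge 8 9, .tree 1982635, .edge 4 8,
    .edge 4 9, .tree 1948265, .cycle 7 4501239, .cycle 7 4321098, .edge 1 6, .edge 6 9, .edge 3 8,
    .tree 1963825, .edge 6 8, .edge 2 5, .tree 1682593, .edge 0 8, .tree 0861952,
    .cycle 7 0125438, .cycle 8 62105438, .cycle 7 6234509, .cycle 7 1054326, .cycle 7 1234509,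
    .cycle 7 5432109, .edge 4 6, .edge 2 6, .edge 6 9, .edge 0 7, .edge 7 8, .tree 4628709,
    .edge 0 8, .tree 4628079, .edge 4 7, .edge 1 7, .tree 0746281, .cycle 8 12345087,
    .cycle 7 4321087, .edge 5 7, .edge 1 7, .edge 7 9, .tree 1796285, .edge 1 9, .tree 2691754,
    .cycle 8 12345079, .cycle 7 1234507, .cycle 7 5432107, .edge 4 9, .edge 1 9, .edge 5 9,
    .tree 1946285, .cycle 7 5012369, .cycle 7 1054369, .cycle 8 45012369, .cycle 7 2105436,
    .cycle 7 4501236, .edge 1 8, .edge 3 8, .edge 8 9, .edge 1 7, .edge 0 6, .edge 6 7,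
    .tree 3817609, .edge 0 7, .tree 3817069, .edge 5 7, .edge 2 6, .edge 5 6, .tree 0657182,
    .cycle 8 54321076, .cycle 7 2345076, .cycle 7 5432107, .edge 6 8, .edge 1 6, .edge 0 7,
    .tree 3861709, .edge 5 7, .tree 3861759, .cycle 7 5432107, .cycle 7 1234506, .cycle 7 6054328,
    .edge 7 8, .edge 0 7, .edge 2 7, .edge 2 9, .tree 1892703, .edge 1 9, .edge 0 9,
    .tree 1890723, .edge 1 3, .tree 0783192, .cycle 7 1290543, .cycle 7 1054329, .cycle 7 2345017,
    .cycle 7 0543217, .cycle 8 71054328, .edge 0 9, .edge 4 9, .edge 1 9, .edge 3 5,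
    .tree 0918354, .edge 3 9, .edge 1 6, .tree 0938164, .edge 2 6, .edge 6 8, .tree 0918623,
    .cycle 7 6105328, .cycle 7 2345016, .cycle 7 3501289, .cycle 8 10543289, .cycle 7 4501289,
    .cycle 7 0543289, .cycle 7 3450128, .cycle 7 1054328]
  | 7 =>
    [.edge 0 9, .edge 2 7, .edge 2 8, .edge 5 9, .edge 0 7, .edge 4 9, .tree 4907285, .edge 3 9,
    .tree 3907285, .cycle 8 32106549, .edge 1 7, .edge 1 9, .tree 0917285, .edge 6 7, .edge 6 9,
    .tree 0967285, .edge 0 2, .tree 1720956, .cycle 8 01965432, .cycle 8 65432107,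
    .cycle 8 12345607, .edge 6 9, .edge 4 9, .edge 0 7, .tree 4907286, .edge 6 7, .tree 0967284,
    .cycle 8 65432107, .cycle 8 43210659, .cycle 8 60123459, .edge 1 8, .edge 3 8, .edge 0 7,
    .edge 8 9, .tree 1890723, .edge 4 9, .edge 4 8, .tree 1849073, .edge 1 3, .edge 7 8,
    .tree 1870943, .edge 3 7, .tree 1370948, .edge 6 7, .edge 0 3, .tree 2703186, .edge 1 5,
    .edge 2 5, .tree 0725136, .cycle 8 21037845, .cycle 8 12843065, .cycle 8 60123487,
    .cycle 8 10654823, .cycle 8 45601289, .edge 1 7, .edge 7 8, .edge 6 7, .edge 0 3,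
    .tree 1783092, .edge 2 9, .tree 1872903, .edge 6 9, .tree 1876903, .cycle 8 65430129,
    .cycle 8 65432107, .cycle 8 70654328, .cycle 8 12345607, .cycle 8 34560128, .cycle 8 10654328,
    .edge 1 7, .edge 3 7, .edge 3 9, .edge 0 8, .edge 4 7, .tree 1739084, .edge 5 7,
    .tree 1739085, .cycle 8 56012347, .edge 7 8, .edge 6 8, .edge 1 8, .tree 1873906,
    .cycle 8 12345608, .cycle 8 65432108, .cycle 8 72345608, .edge 2 9, .edge 4 9, .edge 1 4,
    .tree 0941732, .edge 5 7, .edge 0 5, .tree 1750923, .edge 6 9, .edge 6 7, .edge 0 8,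
    .tree 1769083, .edge 3 8, .tree 0967382, .cycle 8 32145608, .cycle 8 65014327,
    .cycle 8 60541239, .cycle 8 56014327, .cycle 8 45601239, .cycle 8 21065439, .cycle 8 34560127,
    .cycle 8 10654327, .edge 1 9, .edge 6 9, .edge 4 9, .edge 2 8, .edge 1 7, .edge 2 7,
    .tree 4917286, .edge 7 8, .tree 4917826, .edge 4 8, .edge 3 8, .tree 2849173, .edge 1 6,
    .tree 6194827, .cycle 8 12783456, .cycle 8 45601278, .edge 0 7, .edge 2 7, .edge 0 4,
    .tree 1940726, .edge 6 7, .tree 1967284, .edge 3 7, .edge 8 9, .tree 0728913, .edge 0 2,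
    .edge 4 8, .tree 0284917, .cycle 8 45671098, .cycle 8 01765432, .cycle 8 32104567,
    .cycle 8 23456017, .cycle 8 06543217, .edge 1 8, .edge 3 8, .edge 3 5, .tree 4918356,
    .edge 3 7, .tree 4918376, .edge 2 7, .edge 4 8, .edge 7 8, .tree 1948726, .cycle 8 73560128,
    .cycle 8 43560128, .cycle 8 21065437, .cycle 8 34560128, .cycle 8 10654328, .edge 5 9,
    .edge 3 9, .edge 1 5, .edge 3 6, .edge 0 7, .edge 5 7, .tree 3915706, .edge 2 7, .edge 6 7,
    .tree 0763912, .cycle 8 60123457, .cycle 8 23490657, .edge 6 7, .edge 2 7, .tree 1936725,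
    .edge 1 6, .edge 5 8, .tree 1593678, .edge 2 6, .tree 2615937, .edge 1 8, .tree 3695187,
    .cycle 8 10623458, .cycle 8 10723456, .cycle 8 65432107, .cycle 8 32109456, .cycle 8 12349065,
    .cycle 8 32106549, .cycle 8 56012349, .cycle 8 65432109, .cycle 8 12345609]
  | _ => []

/-- Ten named vertices suffice for every `k`. For `k = 1` each non-adjacent pair is already a longer
cycle, so the certificate just runs through the edges of one copy of the tree; for larger `k` every
leaf is a copy of the tree or a complement cycle of length `k + 1` to `8`. -/
lemma check_treeAExtension (k : ℕ) (h1 : 1 ≤ k) (h7 : k ≤ 7) :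
    ∃ sts, check ⟨treeAEdges, k + 1, 0, 0⟩ sts [ofCycle 10 k] = true := by
  refine ⟨treeAExtension k, ?_⟩
  interval_cases k <;> decide +kernel

/-! ### Certificates for the tree `B` -/

/-- The edges of the tree `B`, each vertex following its parent. -/
def treeBEdges : List (Fin 7 × Fin 7) :=
  [(0, 1), (1, 2), (2, 3), (3, 4), (4, 5), (2, 6)]

lemma treeB_adj_iff : ∀ i j, treeB.Adj i j ↔ (i, j) ∈ treeBEdges ∨ (j, i) ∈ treeBEdges := by
  simp only [treeB, fromEdgeSet_adj, Set.mem_insert_iff, Set.mem_singleton_iff]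
  decide

lemma treeB_preconnected : treeB.Preconnected :=
  preconnected_of_exists_lt <| by
    simp only [treeB_adj_iff]
    decide

/-- The cases for `exists_small_closure`: minimum degree at least `3`, no tree `B`. -/
def treeBSmallClosure : List CaseStep :=
  [.grow 0, .grow 1, .grow 2, .grow 3, .grow 4, .grow 2, .tree 0123456, .grow 3, .tree 5432106,
  .grow 5, .edge 3 5, .tree 6532104, .edge 1 3, .tree 0134562, .edge 0 3, .tree 1034562,
  .degree 3, .grow 1, .edge 0 2, .tree 6123450, .edge 0 4, .tree 2340165, .edge 0 3,
  .tree 5430162, .edge 0 5, .tree 3210546, .grow 0, .tree 7012346, .degree 0, .separate 1235,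
  .grow 0, .grow 1, .tree 5012346, .grow 2, .tree 4321056, .grow 5, .edge 1 4, .tree 3210564,
  .edge 1 3, .tree 4310562, .edge 1 5, .tree 6512340, .degree 1, .separate 1245, .grow 3, .grow 5,
  .tree 6532104, .edge 5 2, .grow 2, .tree 0125346, .separate 0245, .degree 5, .grow 1, .grow 5,
  .tree 6512340, .degree 5, .separate 0134, .edge 3 0, .edge 3 1, .grow 2, .grow 0, .grow 1,
  .tree 4213056, .grow 4, .tree 5012463, .grow 5, .tree 4210563, .separate 1345, .grow 4, .grow 1,
  .tree 0312456, .grow 2, .tree 5421036, .separate 0123, .grow 1, .grow 5, .tree 0321564,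
  .degree 5, .separate 0134, .edge 2 0, .grow 0, .grow 4, .grow 0, .tree 5401236, .grow 1,
  .tree 2310456, .separate 0123, .degree 4, .grow 1, .grow 4, .grow 5, .tree 0214563, .degree 5,
  .degree 4, .separate 0123, .degree 2, .degree 3, .degree 3, .degree 2, .degree 1, .degree 0]

lemma check_treeBSmallClosure :
    check ⟨treeBEdges, 9, 3, 6⟩ treeBSmallClosure [vertex] = true := by
  decide +kernel

/-- The cases for `exists_complCycle`: ten vertices, no tree `B`, and in the complement a cycle of
length `k`, but none of a length between `k + 1` and `8`. -/
def treeBExtension : ℕ → List CaseStep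
  | 1 =>
    [.edge 2 8, .edge 1 4, .edge 2 7, .edge 1 7, .edge 0 5, .edge 1 5, .tree 0517284, .cycle 2 15,
    .cycle 2 05, .cycle 2 17, .cycle 2 27, .cycle 2 14, .cycle 2 28]
  | 2 =>
    [.edge 0 3, .edge 1 4, .edge 0 9, .edge 0 6, .edge 3 8, .edge 1 6, .tree 8306149, .edge 1 9,
    .tree 8309146, .edge 4 6, .tree 8306419, .edge 6 9, .edge 4 9, .tree 1490386, .cycle 4 4619,
    .cycle 3 619, .edge 1 3, .edge 5 6, .tree 5603149, .edge 5 9, .tree 5903146, .edge 2 6,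
    .tree 2603149, .edge 2 9, .tree 2903146, .cycle 4 2659, .edge 0 8, .edge 1 8, .edge 3 7,
    .tree 7308146, .edge 1 7, .edge 7 8, .edge 2 8, .tree 3087142, .edge 2 7, .tree 2718034,
    .cycle 4 2837, .cycle 3 738, .cycle 3 137, .cycle 3 138, .cycle 4 0138, .edge 1 6, .edge 1 3,
    .edge 5 6, .tree 5613094, .edge 2 6, .tree 2613094, .edge 2 5, .edge 0 2, .tree 5203149,
    .cycle 3 062, .cycle 3 265, .edge 3 6, .edge 6 7, .tree 4163097, .edge 1 7, .edge 0 7,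
    .tree 3617094, .cycle 3 067, .cycle 4 1067, .cycle 4 3106, .cycle 3 106, .edge 1 9, .edge 8 9,
    .edge 0 2, .edge 1 2, .tree 8912034, .edge 2 9, .tree 4192038, .cycle 4 2109, .edge 1 2,
    .edge 2 3, .tree 8912304, .edge 3 4, .tree 8914302, .edge 0 4, .tree 8914032, .cycle 4 0234,
    .cycle 3 102, .edge 0 8, .edge 1 8, .edge 4 5, .tree 5418039, .edge 2 4, .tree 2418039,
    .edge 2 5, .edge 0 5, .tree 2508143, .edge 1 2, .tree 5218034, .cycle 5 10542, .cycle 3 245,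
    .cycle 4 1098, .cycle 3 098, .cycle 3 109, .edge 0 4, .edge 4 6, .edge 0 5, .edge 1 2,
    .edge 2 3, .tree 6403215, .edge 2 5, .tree 6405213, .edge 3 5, .edge 1 3, .tree 2130465,
    .edge 1 5, .tree 2150463, .cycle 4 1325, .cycle 3 325, .edge 0 2, .edge 2 4, .edge 5 8,
    .tree 8502463, .edge 1 5, .tree 1502463, .edge 2 8, .edge 0 8, .edge 4 5, .tree 2805463,
    .cycle 3 415, .cycle 4 0158, .cycle 4 2158, .cycle 3 214, .cycle 3 012, .edge 1 5, .edge 4 5,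
    .edge 3 8, .tree 1540386, .edge 3 7, .tree 1540376, .edge 7 8, .edge 6 7, .tree 1546780,
    .edge 6 8, .tree 1546870, .cycle 4 6738, .cycle 3 738, .cycle 4 4105, .cycle 3 105, .edge 1 6,
    .edge 0 6, .edge 1 2, .edge 3 9, .tree 9306124, .edge 4 9, .tree 9406123, .edge 6 9,
    .edge 3 4, .tree 2160349, .cycle 3 394, .cycle 3 649, .edge 0 2, .edge 2 4, .edge 1 8,
    .tree 2406183, .edge 4 8, .tree 1602483, .cycle 3 418, .cycle 3 214, .cycle 3 012,
    .cycle 4 0146, .cycle 3 146, .cycle 3 014, .edge 1 3, .edge 1 4, .edge 0 2, .edge 3 7,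
    .edge 0 5, .edge 2 3, .tree 4132057, .edge 1 2, .tree 7312054, .cycle 4 1032, .edge 1 5,
    .edge 2 5, .tree 7315204, .edge 2 4, .tree 7314205, .edge 0 4, .tree 7314025, .cycle 4 0524,
    .cycle 3 105, .edge 1 7, .edge 0 7, .edge 4 8, .tree 8417023, .edge 3 5, .tree 5317024,
    .edge 4 5, .tree 5417023, .edge 3 8, .tree 8317024, .cycle 4 3548, .cycle 3 037,
    .cycle 4 1037, .edge 2 3, .edge 1 2, .edge 3 5, .edge 0 6, .edge 2 6, .tree 4132605,
    .edge 3 6, .tree 0632145, .cycle 4 3026, .edge 3 6, .edge 0 5, .tree 0532146, .edge 6 8,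
    .tree 8632145, .edge 1 8, .edge 5 8, .tree 5812364, .cycle 4 5068, .cycle 4 1068,
    .cycle 3 306, .edge 2 5, .edge 0 5, .edge 1 5, .edge 0 6, .tree 2315064, .edge 4 6,
    .tree 0521463, .edge 2 7, .tree 0513274, .edge 6 7, .edge 4 7, .tree 0514762, .cycle 5 46027,
    .cycle 4 6027, .cycle 4 1035, .cycle 3 035, .cycle 4 2035, .cycle 3 102, .cycle 3 203,
    .edge 0 4, .edge 3 4, .edge 0 9, .edge 0 2, .edge 5 9, .tree 5904312, .edge 2 5,
    .tree 5204319, .edge 2 6, .tree 6204319, .edge 6 9, .tree 6904312, .cycle 4 6259, .edge 2 3,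
    .edge 2 6, .tree 6234091, .edge 3 6, .edge 1 6, .tree 1634092, .cycle 4 1026, .cycle 4 3026,
    .cycle 3 203, .edge 4 9, .edge 3 9, .edge 1 9, .edge 0 2, .edge 4 6, .tree 2043196, .edge 3 6,
    .tree 1934026, .cycle 5 30146, .edge 2 3, .edge 1 7, .tree 0439172, .edge 2 7, .tree 0493271,
    .cycle 4 2017, .cycle 3 203, .cycle 3 109, .cycle 3 309, .cycle 4 4109, .cycle 4 3014,
    .cycle 3 014, .cycle 3 103]
  | 3 =>
    [.edge 0 3, .edge 1 8, .edge 2 6, .edge 1 5, .edge 0 5, .edge 0 6, .tree 2605183, .edge 1 6,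
    .tree 2615038, .cycle 4 1206, .edge 2 5, .edge 2 3, .tree 0325186, .edge 1 3, .tree 0315268,
    .cycle 4 1023, .cycle 4 2105, .edge 0 5, .edge 2 5, .edge 0 8, .tree 1805263, .edge 2 8,
    .tree 1825036, .cycle 4 2108, .cycle 4 2015, .cycle 4 0215, .edge 0 6, .edge 1 6, .edge 0 4,
    .edge 4 9, .tree 9406183, .edge 2 3, .tree 2306184, .edge 2 4, .tree 2406183, .edge 0 9,
    .edge 3 9, .tree 3906184, .cycle 4 3249, .cycle 4 0249, .edge 2 4, .edge 1 4, .tree 2416038,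
    .cycle 4 1204, .cycle 4 2104, .cycle 4 1026, .cycle 4 0126, .edge 0 8, .edge 2 8, .edge 2 6,
    .edge 0 4, .edge 1 3, .tree 1308264, .edge 4 9, .tree 9408263, .edge 1 4, .tree 1408263,
    .edge 3 9, .tree 9308264, .cycle 4 3149, .edge 4 8, .edge 1 6, .tree 3082614, .edge 2 4,
    .edge 0 6, .edge 1 4, .tree 1426038, .cycle 4 1204, .cycle 4 0216, .cycle 4 2104,
    .cycle 4 4018, .edge 1 6, .edge 0 6, .edge 2 4, .tree 1608243, .edge 1 4, .tree 2806143,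
    .cycle 4 1024, .cycle 4 0126, .cycle 4 1026, .cycle 4 2018, .cycle 4 0218, .edge 1 3,
    .edge 2 3, .edge 1 6, .edge 2 5, .edge 0 4, .edge 1 4, .tree 0413256, .edge 2 4,
    .tree 0423165, .cycle 4 2014, .edge 2 4, .edge 5 7, .tree 7523164, .edge 1 4, .edge 4 7,
    .tree 7413256, .edge 3 5, .edge 3 7, .tree 6135247, .cycle 4 3047, .cycle 5 30475,
    .cycle 4 1204, .cycle 4 2104, .edge 0 5, .edge 1 5, .edge 0 4, .tree 2315046, .edge 2 4,
    .tree 0513246, .cycle 4 2104, .cycle 4 1025, .cycle 4 0125, .edge 2 6, .edge 0 6, .edge 3 6,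
    .edge 0 4, .edge 6 7, .tree 4062317, .edge 2 7, .tree 1326047, .cycle 4 2167, .edge 1 4,
    .edge 2 8, .tree 0623148, .edge 2 4, .edge 3 8, .tree 0631428, .cycle 4 3028, .cycle 4 2104,
    .cycle 4 1204, .cycle 4 3016, .cycle 4 0216, .cycle 4 2016, .cycle 4 2103, .cycle 4 1203]
  | 4 =>
    [.edge 2 8, .edge 2 6, .edge 1 9, .edge 2 7, .edge 0 6, .edge 1 7, .tree 0627198, .edge 0 7,
    .edge 2 9, .tree 1926078, .edge 7 9, .tree 0627918, .cycle 6 710329, .cycle 5 03217,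
    .edge 3 6, .edge 1 8, .tree 3628197, .edge 0 8, .edge 1 6, .tree 0826197, .cycle 5 12306,
    .cycle 5 03218, .cycle 5 32106, .edge 3 7, .edge 1 7, .edge 1 6, .tree 3716289, .edge 6 7,
    .tree 9176283, .cycle 6 610327, .cycle 5 10327, .cycle 5 30127, .edge 0 9, .edge 2 9,
    .edge 0 4, .edge 1 6, .tree 1629048, .edge 6 7, .tree 7629048, .edge 2 7, .edge 3 7,
    .tree 3729046, .cycle 5 30167, .cycle 6 230167, .edge 3 4, .edge 3 8, .tree 0928346,
    .edge 4 8, .tree 0928436, .cycle 6 401238, .cycle 5 32104, .cycle 5 23019, .cycle 5 03219,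
    .edge 3 6, .edge 1 6, .edge 6 8, .edge 0 4, .edge 3 4, .tree 2863401, .edge 2 4, .edge 2 5,
    .tree 0428615, .edge 3 5, .tree 5368241, .cycle 5 30125, .cycle 5 21034, .edge 1 4, .edge 4 9,
    .tree 2861493, .edge 4 6, .edge 2 9, .tree 1468293, .cycle 5 21049, .cycle 5 40126,
    .cycle 5 12304, .edge 1 8, .edge 0 8, .edge 2 9, .tree 9281630, .edge 0 4, .tree 4081632,
    .edge 3 4, .edge 1 9, .tree 0816349, .cycle 5 10329, .cycle 5 32104, .cycle 5 01268,
    .cycle 6 103268, .cycle 5 10326, .cycle 5 30126, .edge 1 8, .edge 3 8, .edge 3 5, .edge 8 9,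
    .edge 0 4, .edge 0 9, .tree 5389041, .edge 4 9, .tree 5389401, .edge 1 4, .tree 5381409,
    .cycle 6 123094, .edge 1 4, .edge 5 7, .tree 4183579, .edge 4 7, .tree 5381479, .edge 2 5,
    .tree 4183529, .cycle 6 210475, .cycle 5 12304, .edge 1 9, .edge 3 9, .edge 0 9, .edge 2 5,
    .tree 8193520, .edge 4 5, .tree 8193540, .edge 0 4, .tree 1839045, .cycle 5 01254,
    .cycle 5 01289, .cycle 6 301289, .cycle 6 103289, .edge 2 5, .edge 5 8, .edge 0 5, .edge 0 2,
    .edge 1 9, .tree 9185023, .edge 2 9, .edge 7 9, .tree 1852970, .edge 3 7, .tree 7385021,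
    .cycle 5 30197, .cycle 5 23019, .edge 1 5, .edge 2 7, .tree 7251830, .edge 3 7, .edge 0 9,
    .tree 7385091, .edge 8 9, .tree 7381509, .cycle 5 82109, .cycle 5 30127, .cycle 5 10235,
    .cycle 5 01235, .cycle 6 530128, .cycle 5 21035, .cycle 5 30128, .cycle 5 10328]
  | 5 =>
    [.edge 0 7, .edge 3 6, .edge 2 7, .edge 4 5, .edge 0 6, .edge 4 7, .tree 5470632, .edge 5 7,
    .tree 4570632, .edge 3 5, .edge 0 5, .tree 6350724, .cycle 7 0123475, .cycle 7 3210475,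
    .edge 4 6, .edge 1 6, .edge 2 6, .tree 5462701, .edge 1 4, .edge 1 7, .tree 3641705,
    .edge 4 7, .tree 0741635, .cycle 6 406217, .cycle 6 106234, .cycle 6 123406, .cycle 6 432106,
    .edge 3 5, .edge 0 5, .edge 5 8, .tree 6350728, .edge 1 8, .edge 0 8, .tree 1805367,
    .cycle 7 0123458, .cycle 6 123458, .cycle 6 012345, .cycle 6 321045, .edge 3 7, .edge 1 7,
    .edge 0 5, .edge 5 8, .tree 6370581, .edge 2 5, .tree 6370521, .edge 4 8, .edge 3 8,
    .tree 4837056, .cycle 7 3401258, .cycle 6 401258, .edge 1 5, .edge 4 5, .tree 6371540,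
    .cycle 6 432105, .cycle 6 123405, .cycle 6 104327, .cycle 6 340127, .edge 2 6, .edge 4 6,
    .edge 6 7, .edge 0 5, .edge 1 4, .tree 1467052, .edge 4 9, .tree 9467052, .edge 6 9,
    .edge 3 9, .tree 3967052, .cycle 6 321049, .cycle 6 632149, .edge 1 5, .edge 4 5,
    .tree 0764512, .cycle 6 432105, .cycle 6 123405, .edge 2 7, .edge 1 7, .edge 1 8,
    .tree 8172640, .edge 0 8, .tree 8072641, .cycle 6 043218, .cycle 6 104367, .cycle 7 2104367,
    .cycle 6 401236, .cycle 6 210436, .edge 1 7, .edge 4 7, .edge 5 7, .edge 3 8, .edge 1 6,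
    .edge 5 8, .tree 6175834, .edge 4 8, .tree 6174835, .edge 3 5, .tree 6175384,
    .cycle 7 3210485, .edge 0 6, .edge 2 6, .edge 6 7, .edge 2 8, .tree 1762830, .edge 4 8,
    .tree 0674831, .edge 0 3, .tree 1760382, .cycle 6 012843, .cycle 7 6123407, .cycle 6 234016,
    .cycle 6 043216, .edge 2 8, .edge 4 8, .edge 1 9, .tree 9174825, .edge 3 5, .tree 3574821,
    .edge 5 9, .tree 9574821, .cycle 6 534019, .cycle 6 401238, .cycle 6 210438, .edge 2 5,
    .edge 1 5, .edge 3 5, .edge 3 8, .tree 8351742, .edge 7 8, .edge 2 8, .tree 2871534,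
    .cycle 6 210438, .cycle 6 701238, .cycle 6 321075, .cycle 7 1234075, .cycle 6 234075,
    .cycle 6 432107, .cycle 6 123407]
  | 6 =>
    [.edge 5 7, .edge 5 8, .edge 2 9, .edge 1 8, .edge 0 9, .edge 2 5, .tree 1852907, .edge 0 8,
    .tree 7580921, .edge 3 8, .edge 2 8, .tree 7582901, .edge 1 9, .tree 7581903, .edge 3 9,
    .tree 7583901, .cycle 8 34508219, .cycle 7 3452108, .edge 1 9, .edge 0 8, .tree 7581920,
    .edge 6 8, .tree 7581926, .edge 5 6, .edge 4 6, .tree 4658197, .cycle 7 4321086,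
    .cycle 8 54321086, .cycle 7 1234509, .edge 0 8, .edge 2 8, .edge 3 7, .tree 9285730,
    .edge 4 7, .tree 9285740, .cycle 7 4501237, .cycle 7 2345018, .cycle 7 0543218, .edge 1 9,
    .edge 3 9, .edge 0 7, .edge 1 5, .tree 0751938, .edge 1 7, .tree 8571930, .edge 0 9,
    .edge 6 7, .tree 8570916, .edge 3 6, .tree 6390751, .cycle 7 3450176, .cycle 7 0154329,
    .edge 7 9, .edge 1 7, .edge 0 8, .tree 3975801, .edge 2 8, .tree 3975821, .edge 1 6,
    .tree 3917586, .edge 7 8, .edge 3 6, .tree 5879361, .cycle 8 34508216, .cycle 7 7054328,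
    .cycle 7 1234507, .cycle 7 7054329, .cycle 7 3450129, .cycle 7 1054329, .edge 0 8, .edge 4 8,
    .edge 3 9, .edge 0 7, .edge 7 9, .tree 3970845, .edge 3 7, .tree 9370845, .edge 5 9,
    .edge 4 9, .tree 7594803, .cycle 8 45012379, .cycle 7 5012379, .edge 1 7, .edge 7 8,
    .edge 5 9, .tree 0875931, .edge 4 9, .tree 1784930, .cycle 7 4321059, .cycle 8 70123458,
    .cycle 7 1234507, .edge 4 9, .edge 8 9, .edge 2 9, .edge 0 7, .tree 2980754, .edge 7 8,
    .tree 5784920, .cycle 8 70123458, .cycle 7 2105439, .cycle 7 8501239, .cycle 7 4501239,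
    .cycle 7 4321058, .cycle 7 0123458, .edge 4 7, .edge 0 7, .edge 7 9, .edge 3 6, .edge 0 8,
    .edge 4 6, .tree 8074639, .edge 6 7, .edge 5 8, .tree 3670854, .edge 1 8, .tree 3670814,
    .edge 0 4, .tree 3674089, .cycle 7 0581234, .cycle 8 64321057, .edge 7 8, .edge 5 8,
    .edge 3 9, .tree 5879360, .edge 4 9, .edge 2 9, .tree 5874920, .cycle 7 2105439,
    .cycle 7 4501239, .cycle 7 5432108, .cycle 8 75432108, .edge 4 6, .edge 2 6, .edge 1 9,
    .tree 1974620, .edge 8 9, .tree 8974620, .edge 0 8, .tree 8074629, .cycle 8 05432198,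
    .cycle 7 2105436, .cycle 7 4501236, .edge 3 9, .edge 0 9, .edge 1 9, .edge 3 8, .tree 8390741,
    .edge 1 6, .tree 6190743, .edge 6 7, .edge 6 8, .tree 8670914, .cycle 7 6105438,
    .cycle 7 6123457, .cycle 7 1234579, .cycle 8 01234579, .cycle 7 3210579, .cycle 7 0123457,
    .cycle 7 4321057]
  | 7 =>
    [.edge 4 7, .edge 0 7, .edge 5 8, .edge 4 9, .edge 0 8, .edge 2 7, .tree 9470852, .edge 3 7,
    .tree 9470853, .cycle 8 34560127, .edge 6 8, .edge 1 8, .edge 4 6, .tree 0746819, .edge 5 7,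
    .tree 9475810, .edge 1 7, .tree 9471850, .edge 2 5, .edge 6 7, .tree 2586701,
    .cycle 8 60123457, .cycle 8 23460175, .cycle 8 12345608, .cycle 8 65432108, .edge 5 9,
    .edge 3 9, .edge 0 5, .tree 3950748, .edge 0 9, .tree 8590743, .edge 1 5, .edge 1 6,
    .edge 6 7, .tree 3951678, .edge 1 7, .tree 0715936, .cycle 8 12345067, .cycle 8 12349056,
    .cycle 8 12349065, .cycle 8 32106549, .cycle 8 56012349, .edge 6 8, .edge 4 8, .edge 0 9,
    .edge 3 7, .tree 9074863, .edge 2 7, .tree 9074862, .cycle 8 21065437, .edge 8 9, .edge 2 9,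
    .tree 2984706, .edge 1 9, .tree 1984706, .cycle 8 10654329, .cycle 8 85432109,
    .cycle 8 43210658, .cycle 8 60123458, .edge 1 7, .edge 6 7, .edge 3 9, .edge 4 8, .edge 1 9,
    .tree 8471936, .edge 2 9, .edge 6 9, .tree 8476921, .edge 3 7, .tree 8473921,
    .cycle 8 34569107, .cycle 8 23456019, .edge 3 8, .edge 5 8, .edge 6 8, .tree 9386715,
    .edge 0 8, .edge 1 3, .tree 0831749, .edge 2 8, .edge 2 7, .tree 9382710, .cycle 8 21345607,
    .cycle 8 23106548, .cycle 8 01234568, .cycle 8 56012348, .cycle 8 32106548, .edge 4 9,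
    .edge 2 9, .edge 1 8, .tree 8174926, .edge 0 8, .edge 8 9, .tree 0894712, .cycle 8 81065439,
    .cycle 8 06543218, .cycle 8 21065439, .cycle 8 45601239, .cycle 8 65432107, .cycle 8 12345607,
    .edge 3 7, .edge 5 7, .edge 0 7, .edge 2 9, .edge 3 8, .edge 2 5, .tree 8375290, .edge 1 7,
    .edge 0 9, .tree 8370921, .edge 5 9, .tree 8375920, .edge 6 7, .edge 6 9, .tree 8376920,
    .cycle 8 60123459, .cycle 8 60952347, .cycle 8 10652347, .edge 4 8, .edge 2 8, .edge 5 8,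
    .tree 9285704, .edge 0 2, .tree 4820739, .edge 2 4, .edge 0 8, .tree 9280734, .edge 2 7,
    .edge 5 9, .tree 9572480, .edge 1 7, .edge 1 9, .tree 9172480, .cycle 8 12083459,
    .cycle 8 10238547, .cycle 8 20658347, .cycle 8 21065834, .cycle 8 21065438, .cycle 8 45601238,
    .edge 3 9, .edge 1 9, .edge 5 8, .tree 8573910, .edge 0 8, .tree 8073915, .edge 4 6,
    .edge 4 9, .tree 6493701, .edge 4 8, .edge 1 3, .edge 3 6, .tree 0736481, .cycle 8 32945806,
    .cycle 8 10654923, .cycle 8 43210658, .cycle 8 43210856, .cycle 8 10654329, .cycle 8 34560129,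
    .edge 1 5, .edge 6 7, .edge 1 7, .edge 3 6, .edge 0 8, .edge 3 8, .tree 0837156, .edge 5 8,
    .tree 0857361, .cycle 8 54701238, .edge 6 8, .edge 1 8, .edge 1 4, .tree 4173685, .edge 3 9,
    .tree 5736819, .edge 0 9, .edge 2 5, .tree 1867523, .edge 6 9, .tree 0963718,
    .cycle 8 60125439, .cycle 8 06541239, .cycle 8 12345608, .cycle 8 65432108, .cycle 8 32107456,
    .cycle 8 12345607, .cycle 8 65432107, .cycle 8 12347065, .cycle 8 56012347, .cycle 8 32106547]
  | _ => []

lemma check_treeBExtension (k : ℕ) (h1 : 1 ≤ k) (h7 : k ≤ 7) :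
    ∃ sts, check ⟨treeBEdges, k + 1, 0, 0⟩ sts [ofCycle 10 k] = true := by
  refine ⟨treeBExtension k, ?_⟩
  interval_cases k <;> decide +kernel

/-! ### Certificates for the tree `C` -/

/-- The edges of the tree `C`, each vertex following its parent. -/
def treeCEdges : List (Fin 7 × Fin 7) :=
  [(0, 1), (1, 2), (2, 3), (3, 4), (1, 5), (2, 6)]

lemma treeC_adj_iff : ∀ i j, treeC.Adj i j ↔ (i, j) ∈ treeCEdges ∨ (j, i) ∈ treeCEdges := by
  simp only [treeC, fromEdgeSet_adj, Set.mem_insert_iff, Set.mem_singleton_iff]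
  decide

lemma treeC_preconnected : treeC.Preconnected :=
  preconnected_of_exists_lt <| by
    simp only [treeC_adj_iff]
    decide

/-- The cases for `exists_small_closure`: minimum degree at least `3`, no tree `C`. -/
def treeCSmallClosure : List CaseStep :=
  [.grow 0, .grow 0, .grow 0, .grow 1, .grow 4, .grow 1, .tree 2014536, .grow 4, .edge 1 2,
  .tree 5410362, .edge 1 3, .tree 5410263, .edge 1 5, .tree 2014635, .degree 1, .grow 2,
  .edge 2 5, .tree 1025436, .edge 0 4, .tree 1402653, .edge 2 4, .tree 1024536, .grow 2,
  .tree 6201473, .edge 4 3, .edge 2 3, .tree 1432650, .edge 1 2, .tree 3412650, .degree 2,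
  .degree 4, .grow 3, .edge 3 4, .tree 1034526, .edge 0 4, .tree 1403652, .edge 3 5,
  .tree 1035426, .grow 3, .tree 6301472, .edge 4 2, .edge 2 3, .tree 1423650, .edge 1 3,
  .tree 2413650, .degree 3, .degree 4, .separate 1234, .grow 2, .grow 1, .tree 4102563, .grow 2,
  .tree 5201463, .grow 3, .edge 3 4, .tree 4302561, .edge 2 4, .tree 4203651, .degree 4,
  .separate 1234, .grow 1, .grow 3, .tree 4103652, .grow 5, .tree 2015634, .separate 2345,
  .grow 3, .grow 3, .tree 5301462, .separate 1234, .separate 1234, .edge 1 2, .edge 1 3, .grow 3,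
  .grow 2, .grow 0, .tree 1203456, .grow 2, .tree 5203461, .grow 3, .tree 4302561, .separate 0123,
  .grow 4, .grow 0, .tree 2034561, .grow 3, .tree 0134526, .separate 0123, .edge 4 2, .grow 0,
  .grow 5, .tree 1205643, .degree 5, .separate 0124, .degree 4, .edge 3 2, .grow 2, .grow 4,
  .grow 0, .tree 1024563, .grow 2, .tree 0124536, .separate 0123, .degree 4, .grow 0, .grow 4,
  .grow 4, .tree 5401263, .degree 4, .degree 4, .separate 0123, .degree 3, .degree 1, .degree 1,
  .degree 0, .degree 0, .degree 0]

lemma check_treeCSmallClosure :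
    check ⟨treeCEdges, 9, 3, 6⟩ treeCSmallClosure [vertex] = true := by
  decide +kernel

/-- The cases for `exists_complCycle`: ten vertices, no tree `C`, and in the complement a cycle of
length `k`, but none of a length between `k + 1` and `8`. -/
def treeCExtension : ℕ → List CaseStep
  | 1 =>
    [.edge 1 4, .edge 2 7, .edge 1 7, .edge 3 5, .edge 0 5, .edge 1 5, .tree 0517234, .cycle 2 15,
    .cycle 2 05, .cycle 2 35, .cycle 2 17, .cycle 2 27, .cycle 2 14]
  | 2 =>
    [.edge 0 8, .edge 1 5, .edge 0 7, .edge 0 4, .edge 7 9, .edge 5 7, .tree 4075189, .edge 1 7,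
    .tree 4071589, .edge 0 5, .edge 3 5, .tree 1507934, .edge 3 7, .tree 3705194, .cycle 3 357,
    .cycle 4 0175, .edge 1 7, .edge 6 7, .tree 4071586, .edge 6 9, .edge 2 7, .tree 4071582,
    .edge 2 6, .edge 1 6, .tree 2617095, .edge 0 6, .tree 2607194, .cycle 3 016, .cycle 3 276,
    .cycle 3 679, .edge 0 9, .edge 1 9, .edge 6 9, .tree 4091576, .edge 8 9, .tree 4091578,
    .edge 6 8, .edge 2 8, .tree 2809164, .edge 2 9, .tree 1908624, .cycle 3 289, .cycle 3 698,
    .cycle 3 179, .cycle 4 0179, .edge 1 4, .edge 1 8, .edge 6 8, .tree 4180756, .edge 8 9,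
    .tree 4180759, .edge 2 8, .tree 4180752, .edge 2 9, .edge 2 6, .edge 3 8, .tree 4180753,
    .edge 3 6, .edge 1 2, .tree 4126359, .edge 0 6, .tree 2608137, .cycle 5 01286, .cycle 3 386,
    .cycle 3 286, .cycle 3 289, .edge 4 8, .edge 0 2, .edge 6 8, .tree 2084176, .edge 1 6,
    .edge 3 4, .tree 5148063, .edge 3 6, .edge 0 6, .tree 0614835, .cycle 4 0186, .cycle 6 340186,
    .cycle 3 186, .edge 1 2, .edge 2 8, .edge 0 3, .tree 3082174, .edge 2 4, .edge 1 3,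
    .tree 3128054, .cycle 3 103, .cycle 3 204, .cycle 4 2018, .cycle 3 102, .cycle 4 4018,
    .cycle 3 104, .edge 1 7, .edge 4 7, .edge 1 2, .edge 7 8, .tree 2178054, .edge 1 8, .edge 5 8,
    .tree 0817452, .edge 3 8, .tree 0817432, .edge 3 5, .edge 5 9, .tree 3517492, .edge 8 9,
    .tree 0815392, .cycle 3 859, .cycle 3 385, .cycle 4 1078, .edge 2 7, .edge 1 8, .tree 2718045,
    .edge 0 2, .edge 2 8, .tree 0271584, .cycle 3 218, .cycle 3 012, .cycle 4 2107, .edge 1 4,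
    .edge 0 4, .edge 4 6, .tree 5140876, .edge 3 4, .tree 5140873, .edge 3 7, .edge 6 7,
    .tree 3714065, .cycle 3 647, .cycle 3 347, .cycle 3 074, .cycle 4 1074, .cycle 3 107,
    .edge 0 5, .edge 3 5, .edge 0 4, .edge 1 2, .edge 2 5, .tree 4052183, .edge 0 2, .edge 2 6,
    .tree 1205364, .edge 5 6, .tree 3502164, .cycle 3 526, .cycle 4 0152, .edge 2 5, .edge 2 7,
    .tree 4052783, .edge 5 7, .edge 1 7, .tree 4057182, .cycle 3 127, .cycle 4 5127, .cycle 3 215,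
    .edge 1 4, .edge 4 5, .edge 0 7, .tree 7054183, .edge 4 7, .tree 1450873, .cycle 3 407,
    .cycle 4 4015, .cycle 3 104, .edge 1 3, .edge 0 3, .edge 1 2, .edge 3 7, .tree 5031287,
    .edge 5 7, .edge 3 6, .tree 1305768, .edge 6 7, .edge 1 7, .tree 2175036, .cycle 4 1537,
    .cycle 3 637, .cycle 3 537, .edge 0 2, .edge 2 3, .edge 5 9, .tree 1305928, .edge 2 9,
    .tree 5023189, .cycle 4 2159, .cycle 4 2153, .cycle 3 012, .cycle 4 0153, .cycle 3 153,
    .cycle 3 015, .edge 1 8, .edge 7 8, .edge 1 4, .edge 8 9, .edge 0 2, .edge 1 2, .tree 7812094,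
    .edge 2 8, .edge 1 3, .tree 3182047, .edge 1 9, .tree 4182097, .edge 3 8, .edge 2 4,
    .tree 3824170, .edge 0 4, .edge 4 9, .edge 0 6, .tree 1402896, .edge 1 6, .tree 0418296,
    .cycle 3 106, .cycle 4 4219, .cycle 4 0124, .cycle 4 3108, .cycle 4 2108, .edge 1 2,
    .edge 0 4, .tree 7814092, .edge 2 6, .tree 7812694, .edge 4 5, .tree 7814592, .edge 6 9,
    .tree 2189647, .edge 5 9, .tree 2189547, .cycle 6 540269, .cycle 3 102, .edge 0 9, .edge 1 9,
    .edge 5 8, .tree 5819074, .edge 5 9, .tree 0918754, .cycle 3 589, .cycle 4 1089, .cycle 3 089,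
    .edge 4 8, .edge 0 4, .edge 0 2, .edge 4 9, .tree 1840279, .edge 1 9, .edge 0 9, .edge 8 9,
    .tree 2098741, .cycle 5 80149, .cycle 4 0149, .cycle 3 149, .edge 2 4, .edge 0 5,
    .tree 1840572, .edge 2 5, .tree 1842570, .cycle 3 205, .cycle 4 2014, .cycle 3 014,
    .cycle 4 4108, .edge 1 7, .edge 0 7, .edge 1 4, .edge 0 2, .edge 6 7, .tree 4170286,
    .edge 7 9, .tree 4170289, .edge 5 7, .tree 4170285, .edge 1 9, .edge 0 5, .edge 6 9,
    .edge 5 9, .tree 4195076, .cycle 3 579, .cycle 3 679, .cycle 4 0875, .cycle 5 10879,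
    .edge 2 7, .edge 0 3, .tree 4170382, .edge 3 8, .tree 0718324, .cycle 3 308, .cycle 4 2087,
    .edge 4 8, .edge 4 7, .edge 0 4, .edge 0 2, .edge 3 4, .tree 2048173, .edge 3 8,
    .tree 1840237, .cycle 5 34108, .edge 2 4, .edge 5 8, .tree 0481725, .edge 1 5, .tree 2471580,
    .cycle 4 1085, .cycle 4 2014, .cycle 3 014, .cycle 5 41087, .cycle 4 4108, .cycle 3 087,
    .cycle 4 1087, .cycle 3 108]
  | 3 =>
    [.edge 1 8, .edge 0 7, .edge 1 4, .edge 0 6, .edge 2 8, .edge 0 8, .tree 6081472, .edge 1 3,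
    .edge 7 8, .tree 3187042, .edge 2 7, .edge 1 7, .tree 3170642, .cycle 4 1087, .cycle 4 2087,
    .edge 3 8, .edge 2 3, .edge 0 3, .tree 6038172, .cycle 4 0213, .cycle 4 2013, .cycle 4 3108,
    .edge 0 8, .edge 8 9, .tree 6081479, .edge 0 9, .edge 7 8, .tree 6081497, .edge 1 7,
    .edge 7 9, .tree 4170689, .edge 2 7, .tree 4170682, .cycle 4 2897, .cycle 4 1287,
    .cycle 4 0289, .cycle 4 0128, .edge 2 6, .edge 1 6, .edge 6 7, .tree 4167082, .edge 2 7,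
    .edge 1 7, .tree 4172680, .cycle 4 1067, .cycle 4 2067, .cycle 4 1206, .cycle 4 2106,
    .edge 2 4, .edge 0 4, .edge 0 3, .edge 4 8, .tree 3048172, .edge 2 8, .edge 0 8,
    .tree 3082471, .cycle 4 0148, .cycle 4 2148, .edge 3 4, .edge 1 3, .edge 0 5, .tree 5043172,
    .edge 4 5, .edge 2 3, .tree 0431852, .cycle 4 2103, .cycle 4 4105, .cycle 4 1203,
    .cycle 4 3014, .cycle 4 0214, .cycle 4 2014, .edge 2 7, .edge 1 7, .edge 1 3, .edge 0 4,
    .edge 4 7, .tree 3174082, .edge 2 4, .edge 1 4, .tree 3142780, .cycle 4 1074, .cycle 4 2074,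
    .edge 2 4, .edge 1 4, .edge 6 7, .tree 3172486, .edge 4 5, .tree 3142785, .edge 1 6,
    .edge 5 7, .tree 3172465, .cycle 4 5407, .cycle 4 1076, .cycle 4 1204, .cycle 4 2104,
    .edge 2 3, .edge 0 3, .edge 3 7, .edge 5 7, .tree 0371825, .edge 4 7, .tree 0371824,
    .edge 2 5, .edge 2 4, .tree 4237150, .cycle 4 2074, .cycle 4 2075, .cycle 4 3107,
    .cycle 4 0213, .cycle 4 2013, .cycle 4 1207, .cycle 4 2107, .edge 0 8, .edge 2 8, .edge 0 5,
    .edge 0 7, .edge 1 3, .edge 3 8, .tree 5083172, .edge 2 3, .edge 0 3, .tree 5032871,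
    .cycle 4 0183, .cycle 4 2183, .edge 0 3, .edge 2 3, .edge 3 6, .tree 5032876, .edge 2 6,
    .edge 8 9, .tree 3082659, .edge 3 9, .tree 5032679, .cycle 4 3189, .cycle 4 2136,
    .cycle 4 2013, .cycle 4 0213, .edge 7 8, .edge 1 7, .edge 2 7, .edge 8 9, .tree 1780529,
    .edge 0 9, .tree 5087192, .cycle 4 0189, .cycle 4 2107, .cycle 4 1207, .cycle 4 7018,
    .edge 5 8, .edge 2 5, .edge 1 5, .edge 0 3, .edge 0 6, .tree 3085162, .edge 7 8,
    .tree 1580327, .edge 2 6, .edge 0 7, .tree 3082675, .cycle 4 0187, .cycle 4 2106, .edge 1 3,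
    .edge 1 9, .tree 3158092, .edge 5 9, .tree 0851329, .cycle 4 5019, .cycle 4 1203,
    .cycle 4 1205, .cycle 4 2105, .cycle 4 5018, .cycle 4 2018, .cycle 4 0218]
  | 4 =>
    [.edge 2 9, .edge 1 8, .edge 2 5, .edge 0 5, .edge 2 4, .edge 5 8, .tree 4258190, .edge 1 5,
    .tree 4251890, .edge 2 8, .edge 3 8, .tree 1825034, .cycle 5 30158, .cycle 6 230158,
    .edge 1 4, .edge 3 4, .edge 1 5, .tree 0514328, .edge 4 5, .tree 0541823, .cycle 6 423015,
    .cycle 5 30124, .cycle 5 10324, .edge 1 5, .edge 3 5, .edge 2 4, .tree 4251893, .edge 1 4,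
    .tree 4152983, .cycle 5 10324, .cycle 5 32105, .cycle 5 12305, .edge 1 5, .edge 3 5,
    .edge 0 9, .edge 1 9, .tree 0915328, .edge 5 9, .tree 0951823, .cycle 6 523019, .edge 1 9,
    .edge 3 9, .edge 4 9, .tree 2915348, .edge 3 4, .tree 4391852, .cycle 6 321094,
    .cycle 5 32109, .cycle 5 12309, .cycle 5 30125, .cycle 5 10325, .edge 0 8, .edge 2 8,
    .edge 2 4, .edge 0 5, .edge 7 8, .tree 4280597, .edge 0 7, .edge 3 8, .tree 4280593,
    .edge 0 2, .edge 3 7, .tree 4207385, .cycle 5 30187, .cycle 5 01832, .cycle 6 032187,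
    .edge 1 5, .edge 5 8, .tree 4285190, .cycle 6 503218, .cycle 5 12305, .edge 3 4, .edge 1 4,
    .edge 4 8, .tree 1482930, .cycle 6 423018, .cycle 5 10324, .cycle 5 30124, .cycle 5 23018,
    .cycle 5 03218, .edge 3 9, .edge 1 9, .edge 1 7, .edge 1 4, .edge 0 5, .edge 0 9,
    .tree 4190573, .edge 5 9, .tree 4195073, .edge 1 3, .edge 3 5, .tree 4135079, .cycle 6 301295,
    .cycle 5 10923, .edge 5 9, .edge 7 8, .tree 3917854, .edge 2 7, .tree 3917254, .edge 3 8,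
    .tree 4193875, .cycle 6 301278, .cycle 5 50129, .edge 4 9, .edge 0 4, .edge 2 4,
    .tree 0491723, .cycle 5 23014, .cycle 5 03214, .cycle 6 410329, .edge 2 7, .edge 7 9,
    .edge 0 7, .edge 3 6, .tree 0793621, .edge 0 6, .tree 1970632, .cycle 5 01236, .cycle 5 03217,
    .cycle 6 710329, .cycle 5 23017, .cycle 5 10329, .cycle 5 30129]
  | 5 =>
    [.edge 2 5, .edge 2 9, .edge 1 7, .edge 4 9, .edge 0 9, .edge 2 7, .tree 0927145, .edge 3 7,
    .edge 7 9, .tree 1792530, .edge 3 9, .edge 2 6, .tree 5293760, .edge 2 4, .tree 4293750,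
    .edge 1 3, .tree 1392570, .edge 3 6, .tree 0937126, .cycle 6 310426, .cycle 7 3401279,
    .cycle 6 340127, .edge 1 9, .edge 2 8, .tree 5291784, .edge 1 8, .tree 7192584,
    .cycle 6 104328, .cycle 6 123409, .edge 3 9, .edge 0 9, .edge 2 7, .tree 0927135, .edge 7 9,
    .edge 3 7, .tree 1792530, .cycle 6 340127, .cycle 6 721049, .cycle 6 012349, .cycle 6 321049,
    .edge 0 7, .edge 2 7, .edge 0 3, .edge 4 7, .tree 5270394, .edge 0 2, .edge 6 7,
    .tree 5207693, .edge 2 6, .edge 4 6, .tree 3026475, .cycle 6 432176, .cycle 6 210476,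
    .cycle 6 017432, .edge 4 7, .edge 0 6, .tree 5270694, .edge 6 7, .edge 1 6, .tree 5276190,
    .cycle 6 123406, .cycle 6 603217, .cycle 6 403217, .cycle 6 234017, .cycle 6 043217,
    .edge 1 9, .edge 3 9, .edge 1 6, .edge 0 5, .edge 5 9, .tree 0591623, .edge 4 5, .edge 3 5,
    .edge 0 3, .tree 2539140, .edge 1 5, .tree 0519326, .cycle 6 103295, .cycle 7 3401295,
    .cycle 6 401295, .edge 5 9, .edge 4 5, .tree 2591643, .cycle 6 432105, .cycle 6 504329,
    .edge 0 6, .edge 2 6, .edge 6 9, .tree 1962530, .cycle 7 6104329, .cycle 6 234016,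
    .cycle 6 043216, .cycle 6 340129, .cycle 6 104329, .edge 3 5, .edge 1 5, .edge 1 8, .edge 5 9,
    .edge 0 6, .edge 1 6, .tree 3516098, .edge 2 6, .edge 5 6, .tree 0651823, .cycle 7 5234016,
    .cycle 6 234016, .edge 1 6, .edge 4 6, .tree 3516498, .cycle 6 432106, .cycle 6 123406,
    .edge 0 9, .edge 4 9, .edge 1 9, .tree 0915348, .cycle 7 1043259, .cycle 6 401259,
    .cycle 6 043259, .edge 0 8, .edge 2 8, .edge 5 8, .edge 1 7, .tree 0851723, .edge 2 7,
    .tree 1582730, .cycle 6 234017, .cycle 7 5234018, .cycle 6 234018, .cycle 6 043218,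
    .cycle 6 104325, .cycle 6 340125]
  | 6 =>
    [.edge 0 6, .edge 4 7, .edge 1 7, .edge 1 8, .edge 0 7, .edge 0 9, .tree 6071894, .edge 1 9,
    .tree 8170694, .cycle 7 1234509, .edge 5 7, .edge 1 6, .tree 4716058, .edge 2 6, .edge 6 7,
    .tree 0671824, .cycle 8 61234507, .cycle 7 2345016, .cycle 7 5432107, .edge 0 8, .edge 2 8,
    .edge 7 8, .tree 1780642, .edge 0 7, .tree 1708246, .cycle 8 05432187, .cycle 7 2345018,
    .cycle 7 0543218, .edge 0 7, .edge 2 7, .edge 0 8, .edge 8 9, .tree 2708946, .edge 2 9,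
    .tree 6072984, .edge 1 8, .tree 2708146, .cycle 8 10543298, .edge 5 8, .edge 7 8, .edge 1 8,
    .tree 1870652, .cycle 7 1234508, .cycle 8 71234508, .cycle 7 5432108, .cycle 7 2345017,
    .cycle 7 0543217, .edge 3 7, .edge 5 7, .edge 6 7, .edge 0 8, .edge 1 6, .tree 3760851,
    .edge 2 6, .tree 3760852, .cycle 7 2345016, .edge 5 8, .edge 7 8, .edge 1 8, .tree 1876053,
    .cycle 7 1234508, .cycle 7 7432108, .cycle 7 5432108, .edge 2 6, .edge 5 6, .edge 1 5,
    .tree 0657321, .edge 0 7, .edge 0 9, .tree 2607359, .edge 5 9, .tree 0657329,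
    .cycle 7 5432109, .cycle 7 0512347, .cycle 8 50123476, .cycle 7 2105476, .cycle 7 5012347,
    .cycle 7 3210547, .edge 1 6, .edge 5 6, .edge 5 9, .edge 2 8, .edge 0 8, .edge 5 8,
    .tree 0856129, .edge 6 8, .tree 0865921, .cycle 8 60123458, .edge 1 8, .edge 5 8, .edge 3 5,
    .tree 3581692, .edge 4 8, .tree 2856149, .cycle 7 4532108, .cycle 7 5432108, .cycle 7 1234508,
    .edge 3 8, .edge 6 8, .edge 4 8, .tree 3865941, .edge 3 6, .edge 2 5, .tree 2563891,
    .edge 0 3, .tree 0365981, .edge 3 7, .tree 7365981, .edge 2 7, .edge 7 8, .tree 1687253,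
    .cycle 8 73012548, .cycle 7 2105437, .cycle 7 3284506, .cycle 7 6054328, .cycle 7 3450128,
    .edge 6 9, .edge 0 9, .edge 4 9, .edge 0 8, .tree 1690854, .edge 5 8, .tree 0965841,
    .cycle 7 5432108, .cycle 7 4321059, .cycle 7 0123459, .cycle 8 60123459, .cycle 7 5432106,
    .cycle 7 1234506]
  | 7 =>
    [.edge 2 9, .edge 6 8, .edge 3 7, .edge 0 7, .edge 2 8, .edge 2 7, .tree 0728639, .edge 7 8,
    .tree 0782936, .edge 1 7, .edge 4 8, .edge 0 8, .edge 2 6, .tree 6280794, .edge 0 4,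
    .tree 1708234, .edge 1 8, .edge 0 9, .tree 1708239, .edge 1 9, .tree 0718239,
    .cycle 8 12345609, .cycle 8 10456278, .cycle 8 06543278, .cycle 8 45601278, .cycle 8 10654327,
    .edge 1 8, .edge 3 8, .edge 3 9, .tree 1837069, .edge 4 9, .edge 3 5, .tree 1837065,
    .edge 4 8, .edge 4 6, .tree 1849236, .edge 8 9, .tree 2983741, .cycle 8 82106439,
    .cycle 8 43560128, .cycle 8 45601239, .cycle 8 34560128, .cycle 8 10654328, .edge 6 7,
    .edge 1 7, .edge 6 9, .tree 1769238, .edge 0 9, .edge 2 6, .tree 1762938, .edge 7 9,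
    .tree 0976821, .edge 4 7, .edge 5 9, .edge 4 9, .edge 2 4, .tree 0947152, .cycle 8 21079654,
    .cycle 8 45621079, .cycle 8 54321069, .cycle 8 43210697, .cycle 8 01234569, .cycle 8 12345607,
    .cycle 8 65432107, .edge 4 7, .edge 2 7, .edge 0 2, .edge 6 7, .tree 0276894, .edge 2 5,
    .edge 7 8, .tree 0278654, .edge 5 8, .edge 5 7, .tree 0257498, .cycle 8 54321067,
    .cycle 8 56012378, .cycle 8 21067345, .edge 1 7, .edge 2 6, .tree 1726849, .edge 2 8,
    .tree 1728649, .edge 0 7, .edge 3 8, .edge 7 8, .tree 3872960, .cycle 8 73456028,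
    .cycle 8 34560128, .cycle 8 01265437, .cycle 8 12065437, .cycle 8 21065437, .cycle 8 45601237,
    .edge 0 8, .edge 5 8, .edge 3 8, .edge 3 7, .edge 3 9, .tree 0839257, .edge 4 9, .edge 8 9,
    .tree 2983740, .edge 0 5, .edge 1 8, .edge 1 9, .edge 0 4, .tree 1804935, .edge 1 5,
    .tree 0819235, .cycle 8 10439865, .cycle 8 12345689, .cycle 8 10654398, .cycle 8 01239865,
    .cycle 8 45601239, .edge 2 7, .edge 4 7, .edge 2 8, .tree 0827439, .edge 7 8, .tree 0872934,
    .edge 0 3, .edge 0 7, .tree 2708543, .cycle 8 06543287, .cycle 8 01286543, .cycle 8 45601237,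
    .cycle 8 21065437, .edge 0 4, .edge 2 8, .edge 4 8, .edge 2 7, .tree 7280495, .edge 4 7,
    .tree 0482975, .cycle 8 43860127, .cycle 8 45601238, .cycle 8 21065438, .cycle 8 01238654,
    .cycle 8 54321068, .cycle 8 01234568, .edge 1 9, .edge 3 9, .edge 6 9, .edge 4 8, .edge 3 7,
    .edge 3 8, .tree 1938467, .edge 2 8, .edge 8 9, .tree 2893741, .edge 0 5, .edge 3 5,
    .tree 1935067, .cycle 8 38921065, .cycle 8 01298345, .cycle 8 21065438, .edge 4 7, .edge 2 7,
    .edge 7 9, .tree 1974832, .edge 0 7, .edge 4 6, .tree 0746928, .cycle 8 43792106,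
    .cycle 8 06543297, .cycle 8 21065437, .cycle 8 45601237, .edge 5 8, .edge 8 9, .edge 3 8,
    .edge 5 7, .tree 1985763, .edge 0 3, .tree 1938560, .edge 1 7, .tree 3891756, .edge 2 8,
    .edge 4 6, .tree 2896431, .cycle 8 45712306, .cycle 8 23017548, .cycle 8 32106548,
    .cycle 8 84560129, .cycle 8 56012348, .edge 1 5, .edge 5 9, .edge 0 3, .edge 0 9, .edge 0 7,
    .edge 0 4, .tree 4091573, .edge 8 9, .tree 3091578, .edge 1 8, .tree 3091875,
    .cycle 8 12340698, .edge 4 7, .edge 1 7, .tree 0917435, .cycle 8 12345607, .cycle 8 45692107,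
    .cycle 8 01234569, .cycle 8 01296543, .cycle 8 54321069, .cycle 8 10692345, .cycle 8 34560129,
    .cycle 8 10654329]
  | _ => []

lemma check_treeCExtension (k : ℕ) (h1 : 1 ≤ k) (h7 : k ≤ 7) :
    ∃ sts, check ⟨treeCEdges, k + 1, 0, 0⟩ sts [ofCycle 10 k] = true := by
  refine ⟨treeCExtension k, ?_⟩
  interval_cases k <;> decide +kernel

/-! ### Certificates for the tree `D` -/

/-- The edges of the tree `D`, each vertex following its parent. -/
def treeDEdges : List (Fin 7 × Fin 7) :=
  [(0, 1), (1, 2), (2, 3), (3, 4), (2, 5), (5, 6)]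

lemma treeD_adj_iff : ∀ i j, treeD.Adj i j ↔ (i, j) ∈ treeDEdges ∨ (j, i) ∈ treeDEdges := by
  simp only [treeD, fromEdgeSet_adj, Set.mem_insert_iff, Set.mem_singleton_iff]
  decide

lemma treeD_preconnected : treeD.Preconnected :=
  preconnected_of_exists_lt <| by
    simp only [treeD_adj_iff]
    decide

/-- The cases for `exists_small_closure`: minimum degree at least `4`, no tree `D`. -/
def treeDSmallClosure : List CaseStep :=
  [.grow 0, .grow 1, .grow 1, .grow 3, .grow 0, .grow 2, .tree 4310526, .grow 3, .edge 2 4,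
  .tree 4210536, .edge 2 3, .edge 2 5, .edge 0 4, .tree 4012536, .edge 4 5, .tree 0123654,
  .edge 1 4, .tree 0521436, .edge 4 6, .tree 0132546, .grow 4, .tree 0132547, .degree 4,
  .degree 2, .degree 2, .grow 4, .edge 3 5, .tree 0531246, .edge 0 3, .tree 2130546, .degree 3,
  .grow 1, .grow 6, .tree 4310567, .degree 6, .separate 1234, .edge 0 2, .edge 0 3, .edge 0 4,
  .grow 1, .grow 2, .tree 3401526, .grow 4, .tree 2031546, .grow 5, .tree 0213456, .separate 0245,
  .grow 3, .grow 5, .tree 0431256, .degree 5, .edge 3 2, .grow 2, .grow 5, .tree 0123456,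
  .degree 5, .separate 0123, .degree 3, .degree 0, .degree 0, .degree 0, .degree 3, .degree 1,
  .degree 1, .degree 0]

/-- Minimum degree `3` would not be enough: `twoK4` has it and contains no `D`, but any four of its
vertices together with their neighbours make up all seven. This is the graph behind the lower bound
`14`. -/
lemma check_treeDSmallClosure :
    check ⟨treeDEdges, 9, 4, 6⟩ treeDSmallClosure [vertex] = true := by
  decide +kernel

/-- The cases for `exists_complCycle`: ten vertices, no tree `D`, and in the complement a cycle of
length `k`, but none of a length between `k + 1` and `8`. -/
def treeDExtension : ℕ → List CaseStep
  | 1 =>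
    [.edge 2 8, .edge 2 7, .edge 1 7, .edge 0 8, .edge 2 9, .edge 3 9, .tree 0827193, .cycle 2 39,
    .cycle 2 29, .cycle 2 08, .cycle 2 17, .cycle 2 27, .cycle 2 28]
  | 2 =>
    [.edge 0 3, .edge 0 5, .edge 1 6, .edge 4 7, .edge 3 4, .edge 1 3, .tree 5031647, .edge 3 6,
    .tree 1630547, .edge 0 6, .edge 5 8, .tree 1603458, .edge 5 7, .tree 1603457, .edge 2 5,
    .tree 1603452, .edge 2 8, .edge 2 7, .edge 0 7, .tree 1603472, .edge 5 6, .edge 6 8,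
    .edge 1 7, .tree 0561782, .cycle 3 107, .cycle 7 6310758, .cycle 6 570136, .cycle 3 257,
    .cycle 3 258, .cycle 4 0136, .edge 4 5, .edge 5 6, .tree 1650347, .edge 1 5, .tree 3051647,
    .edge 0 6, .edge 3 8, .tree 1603854, .edge 3 7, .tree 1603754, .edge 3 9, .tree 1603954,
    .edge 4 8, .edge 7 9, .edge 1 8, .tree 0547981, .edge 0 9, .tree 1605497, .cycle 5 01839,
    .cycle 3 739, .cycle 3 438, .cycle 4 0156, .edge 3 5, .edge 1 3, .edge 3 7, .tree 0531674,
    .edge 5 7, .edge 1 5, .tree 0351674, .edge 0 4, .tree 4031657, .cycle 4 0154, .cycle 4 5437,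
    .edge 1 5, .edge 0 4, .edge 5 7, .tree 0351674, .edge 3 7, .tree 4051637, .cycle 4 3457,
    .cycle 4 0134, .cycle 4 1345, .cycle 3 345, .edge 1 7, .edge 0 7, .edge 3 4, .edge 2 5,
    .tree 1703452, .edge 5 6, .tree 1703456, .edge 5 9, .tree 1703459, .edge 2 6, .edge 2 9,
    .edge 0 6, .tree 1703462, .edge 0 9, .tree 1703492, .cycle 4 0659, .cycle 3 259, .cycle 3 256,
    .edge 3 7, .edge 2 3, .tree 2370516, .edge 2 4, .edge 2 7, .tree 0371624, .cycle 4 2347,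
    .cycle 3 234, .cycle 3 347, .edge 1 4, .edge 0 4, .edge 2 4, .edge 2 9, .tree 3041629,
    .edge 2 5, .tree 3041625, .edge 5 9, .edge 4 5, .tree 3041659, .edge 4 9, .tree 3041695,
    .cycle 4 4529, .cycle 3 529, .edge 2 7, .edge 3 6, .tree 0416372, .edge 6 9, .tree 0416972,
    .edge 0 2, .edge 1 2, .edge 7 9, .tree 3021479, .edge 3 4, .edge 0 6, .tree 0612743,
    .cycle 4 0796, .cycle 5 36974, .cycle 5 10742, .cycle 4 0742, .cycle 3 247, .cycle 3 074,
    .cycle 4 1074, .edge 0 7, .edge 0 4, .edge 1 4, .edge 2 4, .edge 2 7, .tree 3041627,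
    .edge 2 5, .tree 3041625, .edge 4 5, .edge 1 2, .edge 2 3, .tree 0321645, .edge 1 3,
    .edge 2 9, .tree 0312945, .edge 7 9, .tree 1304279, .cycle 3 729, .cycle 4 1723, .cycle 3 172,
    .cycle 4 4725, .edge 2 7, .edge 3 8, .tree 1403872, .edge 5 8, .tree 1405872, .edge 3 5,
    .tree 1403572, .cycle 3 385, .cycle 3 247, .cycle 3 174, .cycle 4 0174, .cycle 3 017,
    .edge 0 6, .edge 6 7, .edge 1 5, .edge 3 4, .tree 1503467, .edge 2 3, .tree 1503267,
    .edge 2 4, .edge 0 2, .tree 1502467, .edge 0 4, .tree 1504267, .cycle 4 0234, .cycle 3 234,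
    .edge 5 6, .edge 1 2, .edge 2 5, .tree 1250367, .edge 0 2, .edge 2 6, .edge 1 9,
    .tree 3021965, .edge 5 9, .tree 1205967, .cycle 3 519, .cycle 4 2516, .cycle 4 0152,
    .edge 2 6, .edge 0 2, .edge 2 5, .edge 3 9, .tree 2503967, .edge 5 9, .tree 3025967,
    .edge 1 3, .tree 1302567, .cycle 4 1593, .cycle 3 215, .cycle 3 012, .cycle 3 216,
    .cycle 3 516, .edge 1 7, .edge 0 7, .edge 6 9, .edge 5 8, .tree 1705869, .edge 4 5,
    .tree 1705469, .edge 3 4, .tree 1703469, .edge 3 8, .tree 1703869, .cycle 4 3458, .edge 1 9,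
    .edge 0 9, .edge 7 9, .edge 1 2, .edge 7 8, .tree 2190378, .edge 8 9, .tree 2170398,
    .cycle 4 8769, .edge 2 9, .edge 1 4, .tree 2970314, .edge 4 6, .tree 1706492, .cycle 3 416,
    .cycle 4 2169, .cycle 3 769, .cycle 4 0169, .cycle 3 169, .cycle 4 0167, .cycle 3 167,
    .cycle 3 016, .edge 1 5, .edge 5 7, .edge 0 2, .edge 1 9, .edge 1 2, .edge 2 5, .tree 3021957,
    .edge 2 7, .tree 3021975, .edge 3 9, .tree 0215793, .edge 0 7, .edge 3 4, .tree 1203475,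
    .edge 4 9, .tree 0215794, .cycle 3 439, .cycle 4 0527, .edge 2 5, .edge 7 8, .tree 0251978,
    .edge 2 9, .tree 1920357, .edge 6 7, .tree 0251976, .edge 6 8, .edge 5 8, .tree 0251986,
    .edge 0 9, .edge 1 6, .tree 0915268, .cycle 6 105876, .cycle 4 0129, .cycle 3 678,
    .cycle 4 2105, .edge 0 9, .edge 5 9, .edge 1 2, .edge 3 6, .tree 1203695, .edge 4 7,
    .tree 0951274, .edge 3 4, .tree 1203495, .edge 6 7, .tree 0951276, .cycle 4 6347, .edge 2 9,
    .edge 2 5, .edge 4 9, .tree 1520394, .edge 4 5, .edge 2 7, .tree 1590327, .edge 1 7,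
    .edge 0 4, .tree 0451729, .cycle 4 0194, .cycle 3 127, .cycle 5 49105, .cycle 4 2105,
    .cycle 3 219, .cycle 4 5019, .cycle 3 019, .edge 1 2, .edge 2 5, .edge 1 3, .edge 2 9,
    .tree 0312957, .edge 2 4, .tree 0312457, .edge 4 9, .edge 1 9, .tree 0312594, .cycle 4 1029,
    .cycle 3 429, .edge 2 3, .edge 1 8, .tree 0321857, .edge 1 4, .tree 0321457, .edge 2 4,
    .edge 4 8, .tree 0321548, .cycle 3 418, .cycle 4 2014, .cycle 4 2013, .cycle 3 205,
    .cycle 3 102, .edge 1 7, .edge 0 7, .edge 2 7, .edge 2 9, .tree 3071529, .edge 2 8,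
    .tree 3071528, .edge 2 4, .tree 3071524, .edge 2 6, .tree 3071526, .edge 8 9, .edge 4 6,
    .edge 4 9, .edge 6 7, .tree 3071564, .edge 0 6, .edge 4 5, .tree 0645198, .cycle 5 42675,
    .cycle 4 0576, .cycle 3 429, .cycle 3 426, .cycle 3 829, .edge 1 2, .edge 2 5, .edge 0 2,
    .edge 4 5, .tree 3021754, .edge 3 6, .tree 1702536, .edge 4 7, .edge 4 6, .tree 2071546,
    .edge 3 5, .tree 0215374, .cycle 4 3645, .cycle 3 457, .cycle 4 0572, .cycle 3 275,
    .cycle 5 10572, .cycle 3 057, .cycle 4 1057, .cycle 3 105, .edge 1 3, .edge 2 3, .edge 1 9,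
    .edge 1 4, .edge 0 4, .edge 6 9, .tree 0413296, .edge 5 9, .tree 0413295, .edge 7 9,
    .tree 0413297, .edge 6 7, .edge 5 7, .edge 1 6, .tree 0413267, .edge 1 7, .tree 0413275,
    .cycle 4 1697, .cycle 3 597, .cycle 3 697, .edge 3 4, .edge 0 5, .edge 4 5, .tree 0541932,
    .edge 3 5, .edge 1 5, .edge 0 9, .tree 2350914, .edge 4 9, .tree 0513249, .cycle 3 409,
    .cycle 4 1045, .cycle 4 3045, .edge 1 5, .edge 3 5, .edge 4 5, .edge 4 7, .tree 2351947,
    .edge 3 7, .edge 0 7, .tree 0731945, .cycle 3 047, .cycle 4 3047, .cycle 3 405, .cycle 3 305,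
    .cycle 3 105, .cycle 3 304, .edge 3 4, .edge 0 4, .edge 2 6, .tree 0431926, .edge 2 8,
    .tree 0431928, .edge 2 5, .tree 0431925, .edge 2 7, .tree 0431927, .edge 7 8, .edge 3 7,
    .tree 0431978, .edge 6 7, .edge 4 6, .edge 4 5, .edge 5 8, .tree 1345867, .cycle 3 528,
    .cycle 7 4103725, .cycle 7 4103726, .cycle 3 627, .cycle 3 728, .cycle 3 014, .cycle 4 3014,
    .edge 3 9, .edge 0 9, .edge 1 6, .edge 2 5, .tree 0931625, .edge 2 4, .tree 0931624,
    .edge 2 7, .tree 0931627, .edge 5 7, .edge 2 8, .tree 0931628, .edge 3 5, .tree 0931657,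
    .edge 4 5, .edge 1 4, .edge 6 8, .tree 2314568, .edge 4 6, .edge 1 7, .tree 2314675,
    .cycle 6 103527, .cycle 4 4286, .cycle 6 103524, .cycle 3 425, .cycle 3 527, .edge 0 6,
    .edge 3 6, .edge 6 9, .edge 0 2, .edge 4 6, .tree 1390264, .edge 3 4, .edge 6 8,
    .tree 1390268, .edge 4 8, .tree 0234869, .cycle 3 468, .cycle 5 30164, .edge 2 9, .edge 2 8,
    .tree 0692831, .edge 8 9, .edge 1 5, .tree 0631529, .edge 5 8, .tree 0692385, .cycle 5 51028,
    .cycle 5 82019, .cycle 4 2019, .cycle 3 619, .cycle 4 3016, .cycle 3 016, .cycle 3 019,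
    .cycle 4 3019, .edge 0 2, .edge 1 2, .edge 1 7, .edge 3 6, .edge 5 7, .tree 0213675,
    .edge 7 8, .tree 0213678, .edge 7 9, .tree 0213679, .edge 4 7, .tree 0213674, .edge 4 5,
    .edge 4 9, .edge 1 4, .tree 0213645, .edge 5 8, .edge 0 8, .edge 3 5, .tree 0853149,
    .cycle 6 301475, .cycle 5 01478, .cycle 3 578, .cycle 3 479, .cycle 3 475, .edge 1 6,
    .edge 2 6, .edge 0 6, .edge 0 4, .edge 2 8, .tree 3160428, .edge 3 8, .edge 6 8,
    .tree 0261783, .cycle 4 6328, .cycle 3 328, .edge 1 4, .edge 2 4, .edge 4 6, .edge 0 9,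
    .tree 2460913, .edge 3 9, .tree 0213946, .cycle 3 309, .cycle 4 4036, .cycle 4 2304,
    .cycle 3 104, .cycle 3 036, .cycle 3 236, .cycle 4 1036, .edge 2 7, .edge 3 7, .edge 0 7,
    .edge 0 4, .edge 3 5, .tree 1270435, .edge 7 8, .tree 3120478, .edge 5 8, .edge 4 8,
    .tree 1204873, .edge 3 4, .edge 0 8, .tree 1204385, .cycle 4 0178, .cycle 6 301784,
    .cycle 6 530178, .edge 1 4, .edge 4 8, .tree 0213748, .edge 7 8, .edge 4 6, .tree 0213746,
    .edge 0 6, .tree 3120678, .cycle 3 046, .cycle 5 71048, .cycle 3 104, .cycle 3 017,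
    .cycle 4 3017, .cycle 5 23017, .cycle 4 1032, .cycle 3 032, .cycle 3 103]
  | 3 =>
    [.edge 1 7, .edge 0 5, .edge 2 3, .edge 1 8, .edge 0 7, .edge 2 7, .tree 3270518, .edge 3 7,
    .tree 2370518, .edge 0 3, .edge 1 3, .edge 2 9, .tree 5031729, .edge 3 9, .edge 5 9,
    .tree 1703259, .edge 2 5, .tree 1703952, .edge 6 9, .tree 5031796, .edge 2 6, .tree 5031726,
    .cycle 4 2596, .cycle 4 3729, .cycle 4 1273, .cycle 4 0273, .edge 2 7, .edge 5 7,
    .tree 0571823, .edge 1 5, .edge 4 8, .tree 0517284, .edge 2 5, .edge 3 9, .tree 0523971,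
    .edge 8 9, .tree 0517289, .edge 3 4, .tree 0523471, .cycle 4 3984, .cycle 4 2075,
    .cycle 4 1075, .cycle 4 2107, .edge 0 8, .edge 2 8, .edge 7 8, .tree 1780523, .edge 2 7,
    .edge 0 7, .edge 3 6, .tree 0823671, .edge 1 9, .tree 3270519, .edge 3 9, .tree 0823971,
    .edge 1 6, .tree 3270516, .cycle 4 1936, .cycle 4 0187, .cycle 4 2187, .cycle 4 2018,
    .cycle 4 0218, .edge 1 3, .edge 0 3, .edge 2 8, .edge 3 8, .tree 2830517, .edge 0 8,
    .edge 1 8, .edge 2 7, .tree 3180527, .edge 7 9, .tree 0317982, .edge 2 5, .tree 3081725,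
    .edge 5 9, .tree 1305982, .cycle 4 5279, .cycle 4 1238, .cycle 4 0238, .edge 1 8, .edge 0 8,
    .edge 3 4, .edge 4 8, .tree 3480517, .edge 2 4, .tree 2430517, .edge 3 8, .tree 4380517,
    .cycle 4 3248, .edge 1 4, .edge 0 4, .edge 4 8, .edge 5 6, .tree 1304856, .edge 6 7,
    .tree 0314876, .edge 4 5, .tree 3081745, .edge 2 7, .tree 0314872, .cycle 6 234567,
    .cycle 4 4328, .cycle 4 0234, .cycle 4 1234, .cycle 4 0128, .cycle 4 1028, .cycle 4 0123,
    .cycle 4 1023, .edge 1 5, .edge 2 5, .edge 1 6, .edge 0 7, .edge 3 6, .tree 0715263,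
    .edge 4 6, .tree 0715264, .edge 0 3, .edge 2 7, .tree 3071625, .edge 5 7, .tree 2570316,
    .cycle 4 5027, .edge 0 4, .edge 2 3, .edge 2 4, .edge 1 4, .tree 3240715, .cycle 5 10364,
    .cycle 5 20364, .cycle 4 2103, .cycle 4 0364, .edge 2 7, .edge 3 5, .edge 6 9, .tree 2715369,
    .edge 3 4, .tree 4351627, .edge 3 9, .tree 6152739, .edge 4 6, .tree 2715364, .cycle 4 4396,
    .edge 2 3, .edge 1 3, .edge 3 7, .edge 7 9, .tree 5231679, .edge 3 9, .tree 5271639,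
    .cycle 5 35079, .cycle 4 3507, .cycle 4 1053, .cycle 4 2053, .cycle 4 2107, .edge 5 6,
    .edge 0 6, .edge 2 9, .tree 0651729, .edge 1 9, .edge 2 8, .tree 0651728, .edge 0 9,
    .edge 6 8, .edge 1 8, .tree 0915286, .cycle 4 1028, .cycle 4 6128, .cycle 4 0129,
    .cycle 4 1029, .cycle 4 0216, .cycle 4 5016, .cycle 4 2105, .cycle 4 1205, .edge 0 7,
    .edge 2 7, .edge 0 8, .edge 2 4, .edge 6 7, .edge 3 6, .tree 3670824, .edge 1 6,
    .tree 1670824, .edge 2 3, .edge 0 3, .edge 3 7, .tree 4230876, .cycle 4 3617, .cycle 4 0163,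
    .cycle 4 2163, .edge 2 6, .edge 0 6, .edge 1 3, .edge 3 6, .tree 1360724, .edge 3 7,
    .tree 1370624, .edge 1 6, .tree 3160724, .cycle 4 1736, .edge 0 3, .edge 3 6, .edge 3 8,
    .tree 4260738, .edge 1 8, .tree 1803672, .edge 3 7, .tree 4260837, .cycle 4 3817,
    .cycle 4 3176, .cycle 4 0213, .cycle 4 0176, .cycle 4 2176, .edge 1 4, .edge 0 4, .edge 6 8,
    .tree 1407286, .edge 3 8, .tree 1407283, .edge 4 7, .edge 2 3, .tree 1470823, .edge 1 6,
    .tree 2740816, .cycle 5 12386, .cycle 4 4217, .cycle 4 0124, .cycle 4 1024, .edge 7 8,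
    .edge 2 8, .edge 1 8, .edge 0 3, .edge 2 4, .tree 1870324, .edge 1 4, .edge 3 8,
    .tree 0381427, .edge 0 4, .edge 1 3, .edge 4 8, .tree 0481327, .cycle 4 4208, .cycle 4 1083,
    .cycle 4 0124, .cycle 4 1024, .edge 2 3, .edge 1 9, .tree 0781923, .edge 3 9, .tree 0723981,
    .cycle 4 3019, .cycle 4 2103, .cycle 4 1208, .cycle 4 2108, .cycle 4 7108, .cycle 4 2017,
    .cycle 4 0217]
  | 4 =>
    [.edge 1 9, .edge 2 5, .edge 2 4, .edge 0 4, .edge 0 7, .edge 1 4, .tree 5240719, .edge 4 9,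
    .tree 1940725, .edge 2 9, .edge 5 7, .tree 0425791, .edge 0 9, .edge 3 9, .edge 1 5,
    .tree 0425193, .edge 3 7, .tree 1904273, .cycle 5 30157, .cycle 5 30149, .cycle 6 032149,
    .cycle 6 230149, .edge 1 7, .edge 3 7, .edge 0 6, .edge 4 7, .tree 1740625, .edge 1 4,
    .tree 5240617, .cycle 6 123074, .edge 1 6, .edge 3 6, .edge 5 7, .tree 2571936, .edge 3 5,
    .edge 1 5, .tree 4251637, .cycle 6 123075, .cycle 6 321075, .cycle 5 32106, .cycle 5 12306,
    .cycle 5 32107, .cycle 5 12307, .edge 1 4, .edge 3 4, .edge 3 8, .tree 5241938, .edge 0 8,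
    .edge 4 8, .tree 0841925, .cycle 6 401238, .cycle 5 01238, .cycle 5 32104, .cycle 5 12304,
    .edge 1 4, .edge 3 4, .edge 1 5, .edge 0 9, .tree 0914352, .edge 6 9, .tree 2514396,
    .edge 2 6, .edge 4 5, .tree 3451926, .edge 3 5, .tree 4351926, .cycle 6 301245,
    .cycle 5 21096, .edge 4 5, .edge 3 7, .tree 2541937, .edge 0 7, .edge 4 7, .tree 0741952,
    .cycle 6 421037, .cycle 5 01237, .cycle 6 423015, .cycle 5 30124, .cycle 5 10324, .edge 3 5,
    .edge 1 5, .edge 3 4, .edge 0 6, .edge 0 5, .tree 4350619, .edge 1 3, .edge 5 6,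
    .tree 0651934, .edge 3 6, .edge 4 5, .tree 0631945, .edge 2 6, .edge 1 4, .edge 5 8,
    .tree 0631458, .edge 3 8, .edge 0 8, .tree 0831462, .cycle 5 01258, .cycle 6 301258,
    .cycle 6 103254, .cycle 5 21056, .cycle 6 301256, .cycle 5 10523, .edge 5 6, .edge 6 7,
    .tree 4351967, .edge 2 6, .tree 2651934, .edge 2 7, .edge 1 6, .edge 5 7, .tree 1653472,
    .cycle 6 521067, .cycle 5 10326, .cycle 5 21067, .cycle 5 52106, .edge 2 4, .edge 0 4,
    .edge 4 5, .edge 3 8, .tree 0451938, .edge 3 6, .tree 0451936, .edge 0 8, .edge 2 6,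
    .tree 1540826, .cycle 5 21036, .cycle 5 01238, .cycle 6 430125, .cycle 5 01234,
    .cycle 5 21034, .cycle 5 10325, .cycle 5 30125, .edge 2 9, .edge 0 9, .edge 2 4, .edge 7 9,
    .edge 0 5, .edge 1 7, .tree 1790524, .edge 0 7, .edge 7 8, .tree 4290578, .edge 2 7,
    .edge 8 9, .tree 4270598, .edge 3 9, .tree 3970524, .cycle 6 301789, .cycle 5 23017,
    .cycle 5 03217, .edge 5 9, .edge 1 5, .edge 0 6, .tree 1590624, .edge 6 9, .edge 3 6,
    .tree 1592463, .cycle 5 32106, .cycle 6 603219, .cycle 5 12305, .cycle 6 503219, .edge 2 7,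
    .edge 0 7, .edge 3 7, .edge 1 4, .tree 0924173, .edge 0 4, .edge 3 8, .tree 4072938,
    .edge 8 9, .tree 0427398, .cycle 5 83019, .cycle 5 03214, .cycle 5 30197, .cycle 6 032197,
    .cycle 6 230197, .edge 4 9, .edge 3 4, .edge 1 4, .edge 0 5, .edge 2 7, .tree 1490527,
    .edge 7 9, .edge 1 7, .tree 1790543, .cycle 5 10327, .cycle 6 723019, .edge 3 5, .edge 1 8,
    .tree 0941835, .edge 0 8, .edge 0 4, .tree 2940835, .edge 1 5, .edge 4 8, .tree 0841592,
    .cycle 6 403218, .cycle 5 12305, .cycle 5 03218, .cycle 5 32105, .cycle 5 10324,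
    .cycle 5 30124, .cycle 6 423019, .cycle 5 03219, .cycle 5 23019]
  | 5 =>
    [.edge 0 8, .edge 1 7, .edge 0 6, .edge 2 8, .edge 4 6, .edge 0 7, .tree 1706482, .edge 4 7,
    .edge 2 4, .tree 0642871, .edge 3 7, .edge 0 3, .tree 2803764, .edge 4 8, .tree 0647182,
    .edge 3 8, .edge 2 9, .tree 6082937, .edge 1 9, .tree 6471938, .cycle 6 103429,
    .cycle 6 301248, .cycle 6 342107, .cycle 6 432107, .edge 3 6, .edge 0 7, .tree 1706382,
    .edge 6 7, .edge 4 7, .edge 3 5, .tree 1760835, .edge 4 5, .edge 1 3, .tree 0671345,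
    .edge 2 7, .tree 0672845, .cycle 6 213407, .cycle 6 401235, .cycle 6 432107, .cycle 7 6432107,
    .cycle 6 321046, .edge 1 8, .edge 3 8, .edge 3 5, .tree 5380617, .edge 4 5, .edge 5 8,
    .tree 4580617, .cycle 7 5340128, .cycle 6 401235, .cycle 6 340128, .cycle 6 104328, .edge 4 6,
    .edge 1 6, .edge 1 8, .edge 3 7, .tree 0816473, .edge 2 7, .tree 0816472, .cycle 6 210437,
    .edge 6 8, .edge 2 4, .tree 0861742, .edge 3 6, .edge 3 5, .tree 0861735, .edge 4 5,
    .tree 0861745, .cycle 6 401235, .cycle 6 342106, .cycle 7 6043218, .cycle 6 123406,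
    .cycle 6 432106, .edge 2 7, .edge 0 7, .edge 3 5, .edge 0 5, .edge 4 8, .tree 2705384,
    .edge 6 8, .tree 2705386, .edge 3 6, .edge 1 6, .edge 3 8, .edge 3 7, .tree 0536172,
    .edge 0 2, .edge 1 8, .tree 1802753, .edge 4 6, .edge 8 9, .tree 0536189, .edge 2 4,
    .edge 1 9, .tree 2461935, .cycle 6 123489, .cycle 6 237104, .cycle 6 432186, .cycle 6 043712,
    .cycle 6 321048, .cycle 6 123486, .cycle 7 3210486, .edge 1 5, .edge 5 7, .edge 2 6,
    .tree 1570826, .edge 2 9, .tree 1570829, .edge 6 7, .edge 7 9, .edge 4 9, .tree 1570894,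
    .edge 6 9, .tree 1570869, .cycle 6 621049, .cycle 7 7104329, .cycle 7 6234017,
    .cycle 7 5043217, .cycle 6 123405, .edge 2 5, .edge 5 7, .edge 4 5, .edge 2 6, .tree 4570826,
    .edge 3 6, .edge 6 7, .tree 2570863, .cycle 7 6234017, .cycle 6 340126, .cycle 6 401235,
    .cycle 6 534017, .cycle 6 210435, .cycle 6 043217, .cycle 6 234017, .edge 1 8, .edge 4 8,
    .edge 1 6, .edge 7 8, .edge 2 7, .edge 4 5, .tree 2781645, .edge 5 8, .edge 3 5,
    .tree 2781653, .cycle 6 321045, .cycle 7 5432108, .edge 3 7, .edge 4 9, .tree 3781649,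
    .edge 0 9, .edge 2 4, .tree 2481673, .edge 8 9, .tree 0981673, .cycle 6 801249,
    .cycle 6 012349, .cycle 6 340127, .edge 3 7, .edge 1 7, .edge 5 6, .tree 3716584, .edge 4 7,
    .edge 2 6, .tree 2617384, .edge 5 7, .edge 0 5, .tree 0571648, .cycle 6 043265,
    .cycle 7 5621087, .cycle 7 4321087, .cycle 7 1234087, .cycle 6 321087, .edge 0 6, .edge 2 6,
    .edge 6 8, .edge 0 5, .edge 2 4, .tree 1860524, .edge 2 7, .tree 1860527, .edge 1 7,
    .edge 6 7, .tree 1760584, .cycle 6 610427, .cycle 6 104327, .edge 4 5, .edge 1 5, .edge 5 6,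
    .edge 2 4, .tree 0651842, .edge 3 5, .edge 0 9, .tree 1560984, .edge 3 9, .tree 0651839,
    .cycle 6 342109, .cycle 6 342105, .cycle 7 5043216, .cycle 6 123405, .cycle 6 432105,
    .cycle 7 6123408, .cycle 6 234016, .cycle 6 043216, .cycle 6 432108, .cycle 6 123408]
  | 6 =>
    [.edge 1 7, .edge 0 9, .edge 0 6, .edge 2 6, .edge 5 9, .edge 0 7, .tree 1706295, .edge 5 7,
    .edge 5 6, .tree 0956271, .edge 6 7, .edge 1 8, .tree 0671859, .edge 2 8, .tree 1760928,
    .cycle 7 2345018, .cycle 8 65432107, .cycle 7 5432107, .edge 4 9, .edge 0 7, .tree 1706294,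
    .edge 7 9, .edge 2 4, .tree 1790642, .edge 5 7, .edge 4 8, .tree 1790648, .edge 8 9,
    .edge 2 8, .tree 1790682, .edge 3 5, .edge 1 8, .tree 0971853, .cycle 7 1054328,
    .cycle 7 3482105, .cycle 7 8421059, .cycle 7 5432107, .cycle 8 70123459, .cycle 7 4321059,
    .edge 3 6, .edge 1 6, .edge 3 5, .tree 5360917, .edge 3 8, .tree 7160938, .edge 6 8,
    .edge 5 8, .tree 5860917, .edge 0 4, .edge 2 8, .tree 2860417, .cycle 7 2105438,
    .cycle 7 0123854, .cycle 7 6210538, .cycle 7 1054326, .cycle 7 3450126, .edge 5 6, .edge 1 6,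
    .edge 1 9, .edge 3 7, .tree 0916573, .edge 4 7, .tree 0916574, .cycle 7 4501237, .edge 6 9,
    .edge 2 5, .tree 0961752, .edge 3 5, .tree 0961753, .edge 4 9, .edge 5 8, .tree 0961758,
    .edge 0 8, .edge 4 6, .edge 6 8, .tree 0861749, .cycle 7 6012358, .cycle 7 4352106,
    .cycle 7 0123458, .cycle 7 4325019, .cycle 8 60543219, .cycle 7 1234506, .cycle 7 5432106,
    .edge 1 9, .edge 5 9, .edge 4 8, .edge 1 8, .edge 2 7, .tree 2718495, .edge 3 7,
    .tree 3718495, .cycle 7 3450127, .edge 0 8, .edge 8 9, .edge 2 5, .tree 0891752, .edge 5 6,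
    .tree 0891756, .edge 3 9, .edge 3 6, .tree 0891736, .edge 4 6, .edge 6 9, .tree 0891764,
    .cycle 8 63452109, .cycle 7 4321056, .cycle 7 3452109, .cycle 8 81234509, .cycle 7 0543218,
    .edge 8 9, .edge 5 8, .edge 3 8, .edge 5 6, .tree 3891756, .edge 6 9, .edge 0 6,
    .tree 0691758, .cycle 7 0123456, .cycle 8 65432109, .cycle 7 3210548, .cycle 7 5012348,
    .cycle 7 8432109, .cycle 7 5432109, .cycle 7 1234509, .edge 2 7, .edge 0 7, .edge 7 9,
    .edge 4 7, .edge 7 8, .edge 0 6, .edge 1 8, .edge 4 9, .tree 1870649, .edge 3 9,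
    .tree 1870693, .cycle 7 3210549, .edge 2 8, .edge 4 9, .tree 2870649, .edge 3 9,
    .tree 2870693, .cycle 7 3210549, .cycle 7 2345018, .edge 6 7, .edge 5 6, .edge 1 6, .edge 0 8,
    .edge 5 9, .tree 0876195, .edge 2 4, .tree 0872461, .edge 3 9, .tree 0876193,
    .cycle 7 3421059, .edge 5 8, .edge 0 3, .tree 1670385, .edge 1 4, .tree 0761458, .edge 3 8,
    .edge 1 9, .tree 0761958, .edge 2 9, .tree 1672983, .cycle 7 2305419, .cycle 7 3214508,
    .cycle 7 5432108, .cycle 7 1234506, .cycle 7 5432106, .cycle 8 60543217, .edge 2 8, .edge 5 8,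
    .edge 0 8, .edge 3 8, .edge 0 6, .edge 3 6, .tree 2706385, .edge 2 6, .tree 0627483,
    .cycle 7 2105436, .edge 6 7, .edge 5 6, .edge 2 9, .tree 2970865, .edge 3 9, .tree 3970865,
    .cycle 7 3450129, .cycle 7 5432106, .cycle 8 60543217, .cycle 7 3450178, .cycle 8 05432178,
    .cycle 7 5432178, .cycle 8 23450178, .edge 3 7, .edge 2 5, .edge 5 7, .edge 0 3, .edge 8 9,
    .tree 0372598, .edge 6 9, .tree 0372596, .edge 1 9, .tree 0372591, .edge 2 6, .edge 5 8,
    .tree 0372658, .cycle 7 5432198, .cycle 7 2347196, .cycle 7 0547123, .cycle 7 5012347,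
    .cycle 7 2347105, .cycle 7 3210547, .edge 0 9, .edge 2 9, .edge 3 9, .edge 0 6, .edge 5 6,
    .tree 2706593, .edge 4 6, .tree 2706493, .cycle 7 4321056, .edge 1 6, .edge 2 6,
    .tree 0726193, .edge 3 7, .edge 3 6, .tree 0736192, .cycle 7 3450126, .cycle 8 34506217,
    .cycle 7 1234506, .cycle 7 3450179, .cycle 8 23450179, .cycle 8 05432179, .cycle 7 0543217,
    .cycle 7 2345017]
  | 7 =>
    [.edge 2 7, .edge 5 9, .edge 3 8, .edge 4 7, .edge 5 8, .edge 6 9, .edge 5 7, .tree 2758396,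
    .edge 6 7, .edge 6 8, .tree 2768395, .edge 0 8, .edge 3 6, .tree 2763895, .edge 0 2,
    .edge 2 6, .tree 0267495, .edge 3 7, .tree 0273869, .edge 1 4, .tree 0274169,
    .cycle 8 10623754, .edge 1 7, .edge 1 8, .edge 1 9, .tree 0817295, .edge 1 6, .tree 0816972,
    .edge 0 7, .edge 0 9, .tree 1708395, .cycle 8 02345619, .cycle 8 02163457, .cycle 8 10234568,
    .cycle 8 12063457, .cycle 8 01234568, .cycle 8 60123457, .edge 0 9, .edge 2 5, .tree 0952783,
    .edge 5 7, .tree 0957283, .edge 3 9, .edge 3 7, .tree 0937285, .edge 6 7, .edge 2 4,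
    .edge 3 6, .tree 0936785, .edge 0 2, .edge 1 4, .tree 1420976, .edge 0 7, .tree 3902476,
    .cycle 8 06321457, .edge 1 4, .edge 1 7, .edge 1 3, .tree 0931485, .edge 7 9, .edge 0 4,
    .tree 1790438, .edge 2 6, .tree 0971426, .cycle 8 21043756, .cycle 8 73102569,
    .cycle 8 12063457, .cycle 8 12063754, .cycle 8 21065734, .cycle 8 60123457, .cycle 8 34521069,
    .cycle 8 01234569, .edge 4 8, .edge 4 9, .tree 2748395, .edge 6 8, .edge 3 9, .edge 2 6,
    .tree 2683947, .edge 1 6, .tree 1683947, .edge 3 7, .tree 2738495, .edge 1 8, .edge 7 9,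
    .edge 2 5, .tree 2593874, .edge 1 9, .edge 1 7, .tree 2718395, .cycle 8 10625437,
    .cycle 8 10652349, .cycle 8 73216549, .cycle 8 10623458, .cycle 8 32106549, .cycle 8 60123458,
    .cycle 8 43210658, .edge 5 7, .edge 3 7, .edge 0 2, .tree 0273859, .edge 2 6, .tree 6273859,
    .edge 0 8, .edge 3 5, .tree 0835972, .edge 0 7, .edge 1 7, .edge 0 9, .tree 1708395,
    .edge 3 9, .tree 0837195, .cycle 8 34562109, .cycle 8 10265347, .cycle 8 01265347, .edge 6 8,
    .edge 3 5, .tree 2735986, .edge 0 7, .edge 3 9, .tree 0738695, .edge 1 8, .edge 1 7,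
    .edge 1 9, .tree 0718395, .cycle 8 10265439, .cycle 8 10265347, .cycle 8 12345608,
    .cycle 8 01265347, .cycle 8 65432108, .cycle 8 32106547, .cycle 8 56012347, .edge 2 8,
    .edge 4 8, .edge 1 7, .edge 2 5, .tree 1725984, .edge 2 9, .tree 1728495, .edge 3 9,
    .edge 1 9, .edge 6 8, .edge 1 8, .tree 2718493, .edge 2 4, .edge 0 4, .tree 0427186,
    .cycle 8 06521834, .cycle 8 23810654, .cycle 8 60125438, .cycle 8 10654329, .cycle 8 34560129,
    .edge 0 7, .edge 2 9, .tree 0728495, .edge 1 9, .edge 3 9, .edge 2 5, .tree 0725984,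
    .edge 4 7, .edge 1 4, .tree 0741982, .edge 4 9, .tree 0748291, .edge 0 8, .edge 0 5,
    .tree 2705984, .edge 3 5, .edge 6 9, .edge 6 8, .edge 7 9, .tree 0793568, .cycle 8 71052349,
    .cycle 8 60125438, .cycle 8 65012349, .cycle 8 32941065, .cycle 8 06521438, .cycle 8 43256017,
    .cycle 8 34560129, .cycle 8 10654329, .cycle 8 06543217, .cycle 8 45601238, .cycle 8 21065438,
    .edge 4 9, .edge 6 9, .edge 2 9, .edge 0 4, .edge 1 6, .tree 0492761, .edge 6 8,
    .tree 0492768, .edge 5 8, .edge 8 9, .tree 0492785, .cycle 8 86123459, .cycle 8 54321068,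
    .edge 1 9, .edge 1 8, .edge 3 6, .tree 3691827, .edge 4 6, .tree 4691827, .edge 0 9,
    .edge 3 9, .edge 3 5, .tree 5391827, .edge 0 7, .edge 2 8, .tree 0728193, .edge 4 8,
    .edge 1 5, .tree 5190748, .edge 6 8, .edge 2 6, .tree 0726891, .edge 0 8, .tree 1807293,
    .cycle 8 01534628, .cycle 8 60154328, .cycle 8 43560128, .edge 1 7, .edge 4 7, .edge 0 8,
    .tree 0817293, .edge 2 6, .tree 2691847, .edge 4 8, .tree 0917284, .cycle 8 43562108,
    .cycle 8 45632107, .cycle 8 12345607, .cycle 8 32104659, .cycle 8 01234659, .edge 2 8,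
    .edge 5 8, .edge 3 7, .tree 1927385, .edge 0 8, .edge 4 7, .tree 0827491, .cycle 8 45601237,
    .cycle 8 06543218, .cycle 8 56043218, .cycle 8 23456018, .cycle 8 12340659, .edge 3 9,
    .edge 3 6, .edge 1 9, .edge 1 4, .edge 7 9, .tree 1493672, .edge 3 7, .edge 4 7, .edge 0 7,
    .edge 4 6, .tree 0736491, .edge 1 5, .tree 0741593, .cycle 8 10643295, .cycle 8 01234597,
    .cycle 8 45601297, .cycle 8 32106597, .cycle 8 10659234, .cycle 8 10654329, .cycle 8 34592106,
    .cycle 8 34560129, .cycle 8 60123459, .cycle 8 43210659, .edge 3 7, .edge 1 7, .edge 6 7,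
    .edge 4 9, .edge 4 7, .edge 3 8, .edge 1 6, .tree 1673849, .edge 0 7, .edge 0 2,
    .tree 2073849, .edge 1 5, .tree 5173849, .edge 2 6, .tree 2673849, .edge 0 8, .edge 3 9,
    .tree 0837194, .edge 3 6, .tree 3670849, .edge 1 9, .edge 4 8, .tree 0748391, .edge 2 8,
    .edge 0 9, .tree 1708294, .cycle 8 01265439, .cycle 8 20156348, .cycle 8 10265439, .edge 4 8,
    .edge 2 9, .tree 0748392, .edge 6 9, .tree 0748396, .cycle 8 60154329, .cycle 8 43215608,
    .cycle 8 01654327, .edge 4 8, .edge 2 8, .edge 6 9, .tree 1748296, .edge 5 9, .tree 1748295,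
    .cycle 8 54321069, .cycle 8 21065438, .cycle 8 45601238, .edge 1 3, .edge 3 5, .edge 5 7,
    .edge 1 4, .tree 5314976, .edge 1 9, .tree 4913576, .edge 0 9, .edge 5 9, .tree 0953176,
    .edge 0 3, .edge 2 6, .edge 2 9, .edge 3 6, .tree 0362971, .cycle 8 32741956,
    .cycle 8 23410659, .cycle 8 23459106, .cycle 8 01954723, .cycle 8 06543219, .cycle 8 56012347,
    .cycle 8 34721065, .cycle 8 10654723, .edge 3 9, .edge 5 9, .edge 7 9, .edge 0 8, .edge 0 3,
    .tree 1730895, .edge 3 8, .tree 0837195, .edge 2 8, .edge 1 9, .edge 4 8, .edge 1 4,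
    .tree 3714895, .edge 1 8, .tree 0817395, .edge 0 2, .edge 2 4, .edge 5 7, .edge 0 5,
    .tree 1750293, .edge 6 8, .edge 4 6, .tree 0864271, .edge 5 8, .tree 0285967,
    .cycle 8 50641238, .cycle 8 60541238, .cycle 8 56014327, .cycle 8 21830654, .cycle 8 06541832,
    .cycle 8 45601238, .cycle 8 12306549, .cycle 8 21065438, .edge 6 8, .edge 1 8, .edge 2 6,
    .tree 2671839, .edge 1 9, .tree 3718695, .edge 1 3, .tree 1376895, .edge 4 8, .edge 3 8,
    .tree 1738495, .cycle 8 31945608, .cycle 8 45623108, .cycle 8 12345608, .cycle 8 65432108,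
    .cycle 8 72106549, .cycle 8 56012349, .cycle 8 32106549, .edge 1 5, .edge 5 7, .edge 0 3,
    .edge 0 7, .edge 0 8, .edge 3 6, .tree 1570836, .edge 0 5, .edge 1 9, .tree 3750819,
    .edge 3 9, .tree 1570839, .cycle 8 34567219, .cycle 8 01276345, .edge 4 8, .edge 7 8,
    .tree 0371584, .cycle 8 72345608, .cycle 8 45672108, .cycle 8 01234567, .cycle 8 01276543,
    .cycle 8 54321067, .cycle 8 10672345, .cycle 8 10654327, .cycle 8 34560127]
  | _ => []

lemma check_treeDExtension (k : ℕ) (h1 : 1 ≤ k) (h7 : k ≤ 7) :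
    ∃ sts, check ⟨treeDEdges, k + 1, 0, 0⟩ sts [ofCycle 10 k] = true := by
  refine ⟨treeDExtension k, ?_⟩
  interval_cases k <;> decide +kernel

/-! ### Certificates for the tree `E` -/

/-- The edges of the tree `E`, each vertex following its parent. -/
def treeEEdges : List (Fin 7 × Fin 7) :=
  [(0, 1), (1, 2), (2, 3), (3, 4), (1, 5), (3, 6)]

lemma treeE_adj_iff : ∀ i j, treeE.Adj i j ↔ (i, j) ∈ treeEEdges ∨ (j, i) ∈ treeEEdges := by
  simp only [treeE, fromEdgeSet_adj, Set.mem_insert_iff, Set.mem_singleton_iff]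
  decide

lemma treeE_preconnected : treeE.Preconnected :=
  preconnected_of_exists_lt <| by
    simp only [treeE_adj_iff]
    decide

/-- The cases for `exists_small_closure`: minimum degree at least `5`, no tree `E`. -/
def treeESmallClosure : List CaseStep :=
  [.grow 0, .grow 0, .grow 1, .edge 1 2, .grow 3, .grow 0, .grow 3, .tree 2013456, .edge 3 2,
  .edge 3 5, .grow 0, .tree 1023465, .grow 1, .tree 0123465, .grow 2, .tree 0213465,
  .separate 0123, .degree 3, .degree 3, .degree 0, .degree 3, .grow 1, .grow 2, .grow 2,
  .tree 3102546, .degree 2, .degree 2, .degree 1, .degree 1, .degree 0, .degree 0]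

/-- Minimum degree `4` would not be enough: `K₄,₄` has it and contains no `E`, but any four of its
vertices together with their neighbours make up all eight. This is the graph behind the lower bound
`15`. -/
lemma check_treeESmallClosure :
    check ⟨treeEEdges, 9, 5, 6⟩ treeESmallClosure [vertex] = true := by
  decide +kernel

/-- The cases for `exists_complCycle`: ten vertices, no tree `E`, and in the complement a cycle of
length `k`, but none of a length between `k + 1` and `8`. -/
def treeEExtension : ℕ → List CaseStep
  | 1 =>
    [.edge 1 4, .edge 1 7, .edge 0 5, .edge 1 5, .edge 0 8, .edge 0 6, .tree 4150678, .cycle 2 06,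
    .cycle 2 08, .cycle 2 15, .cycle 2 05, .cycle 2 17, .cycle 2 14]
  | 2 =>
    [.edge 1 5, .edge 0 4, .edge 0 6, .edge 1 3, .edge 0 7, .edge 1 4, .tree 3140657, .edge 1 6,
    .tree 3160457, .edge 1 7, .tree 3170456, .edge 4 6, .edge 4 7, .edge 0 3, .edge 1 2,
    .tree 2130456, .edge 0 2, .edge 2 4, .edge 1 9, .tree 2031549, .edge 0 9, .tree 2460379,
    .cycle 3 019, .cycle 3 214, .cycle 3 012, .edge 3 7, .edge 3 8, .tree 0473168, .edge 3 6,
    .edge 4 8, .tree 0463187, .cycle 5 41038, .cycle 4 3016, .cycle 4 3017, .cycle 3 417,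
    .cycle 3 416, .edge 1 7, .edge 0 5, .tree 3150476, .edge 0 3, .tree 4031567, .edge 3 7,
    .edge 5 7, .edge 3 5, .edge 1 4, .edge 4 9, .tree 0413597, .edge 0 9, .tree 3140659,
    .edge 3 4, .edge 2 4, .tree 0413527, .edge 2 5, .tree 0415237, .cycle 5 24905, .cycle 4 3094,
    .edge 4 5, .edge 4 9, .tree 0451397, .edge 0 9, .tree 1540639, .cycle 4 0149, .cycle 4 4105,
    .cycle 3 305, .cycle 3 507, .cycle 3 307, .cycle 3 107, .edge 0 3, .edge 1 6, .edge 1 7,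
    .tree 3061547, .edge 1 8, .tree 3061548, .edge 1 2, .tree 2160354, .edge 2 7, .edge 7 8,
    .edge 3 7, .tree 2730486, .cycle 3 317, .cycle 3 718, .cycle 3 217, .edge 3 6, .edge 3 5,
    .edge 2 5, .tree 1530426, .edge 5 7, .tree 1530476, .edge 2 7, .edge 5 9, .tree 1530496,
    .edge 2 9, .edge 5 8, .tree 1530486, .edge 0 2, .tree 5302769, .edge 2 4, .tree 3042769,
    .edge 4 5, .edge 0 8, .tree 1530648, .cycle 4 0258, .cycle 3 425, .cycle 3 259, .cycle 3 257,
    .edge 5 6, .edge 5 9, .tree 1560394, .edge 0 5, .edge 0 9, .edge 5 8, .tree 1560384,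
    .edge 6 8, .tree 3650489, .cycle 5 61358, .cycle 5 01359, .cycle 4 0135, .cycle 4 5316,
    .cycle 3 316, .cycle 3 013, .edge 1 6, .edge 6 8, .edge 1 9, .edge 0 7, .edge 0 9,
    .tree 4091576, .edge 6 9, .edge 0 5, .tree 4051679, .edge 5 6, .edge 0 8, .tree 1680457,
    .edge 5 8, .edge 8 9, .edge 1 8, .edge 0 2, .edge 2 6, .tree 1620457, .edge 2 8,
    .tree 1820457, .cycle 4 2608, .edge 2 5, .edge 4 9, .tree 1569428, .edge 4 6, .tree 1586429,
    .cycle 4 4906, .cycle 3 205, .cycle 3 108, .cycle 3 809, .cycle 3 508, .cycle 3 506,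
    .cycle 3 609, .edge 6 7, .edge 1 7, .edge 2 6, .tree 2671589, .edge 2 7, .edge 3 6,
    .tree 3671589, .edge 2 3, .edge 0 2, .tree 0271536, .cycle 3 062, .cycle 3 263, .cycle 4 2607,
    .cycle 3 107, .cycle 3 607, .edge 0 9, .edge 6 9, .edge 0 2, .tree 1690284, .edge 0 5,
    .tree 1690485, .edge 5 9, .edge 5 6, .edge 2 9, .tree 0956128, .cycle 4 2019, .cycle 3 506,
    .cycle 4 5019, .cycle 4 6019, .cycle 3 019, .edge 0 8, .edge 1 8, .edge 0 3, .tree 3081546,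
    .edge 0 2, .tree 2081546, .edge 3 6, .edge 2 6, .edge 0 7, .tree 4081576, .edge 7 8,
    .tree 0816273, .cycle 4 7068, .cycle 3 206, .cycle 3 306, .cycle 4 1068, .cycle 3 068,
    .cycle 3 106, .edge 1 4, .edge 4 8, .edge 0 7, .edge 2 4, .edge 0 3, .edge 0 8, .tree 1480327,
    .edge 0 2, .tree 1420387, .edge 1 8, .edge 0 5, .tree 3051478, .edge 2 8, .edge 5 8,
    .edge 1 2, .edge 4 5, .edge 2 5, .edge 0 6, .edge 1 6, .tree 2160347, .edge 5 6,
    .tree 1560327, .cycle 4 5016, .edge 2 6, .edge 5 9, .tree 1245869, .edge 1 9, .tree 4152698,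
    .cycle 4 1059, .cycle 3 206, .cycle 3 205, .cycle 3 405, .cycle 3 102, .cycle 3 508,
    .cycle 3 208, .cycle 3 108, .edge 3 4, .edge 1 3, .edge 1 6, .tree 2431586, .edge 1 7,
    .tree 2431587, .edge 4 7, .edge 6 7, .tree 0741365, .cycle 3 617, .cycle 4 4017, .cycle 3 103,
    .cycle 3 304, .edge 0 2, .edge 1 2, .edge 0 9, .tree 4120759, .edge 0 3, .tree 3021475,
    .edge 4 9, .edge 2 3, .tree 0214839, .cycle 4 2403, .cycle 3 409, .cycle 4 1042, .cycle 3 042,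
    .edge 4 7, .edge 1 7, .edge 1 2, .edge 4 9, .tree 2174859, .edge 0 9, .edge 7 9, .edge 1 9,
    .edge 2 9, .tree 0914728, .edge 2 4, .tree 0914278, .cycle 3 294, .cycle 4 1049,
    .cycle 4 7049, .cycle 3 049, .edge 2 7, .edge 0 2, .edge 2 4, .edge 1 6, .tree 0241576,
    .edge 2 6, .tree 0241567, .cycle 3 216, .cycle 4 2104, .cycle 3 012, .cycle 4 2107,
    .cycle 3 107, .cycle 3 407, .edge 1 8, .edge 0 8, .edge 0 2, .edge 0 3, .tree 2081435,
    .edge 0 9, .tree 2081495, .edge 1 3, .edge 8 9, .edge 3 8, .tree 0831495, .cycle 4 3048,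
    .cycle 4 8409, .cycle 3 103, .edge 1 2, .edge 2 4, .edge 2 8, .edge 3 8, .tree 0821435,
    .edge 3 4, .edge 7 8, .tree 0814273, .edge 4 7, .tree 0814327, .cycle 3 487, .cycle 3 384,
    .cycle 4 2048, .cycle 3 204, .cycle 3 102, .cycle 3 048, .cycle 4 1048, .cycle 3 104,
    .edge 0 5, .edge 0 8, .edge 1 7, .edge 3 5, .edge 0 9, .edge 1 4, .edge 1 9, .tree 4190578,
    .edge 1 8, .tree 4180579, .edge 5 8, .edge 1 3, .tree 0531487, .edge 3 8, .edge 5 9,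
    .edge 0 3, .edge 3 9, .edge 0 2, .edge 7 9, .tree 2039587, .edge 0 7, .tree 2035879,
    .cycle 4 0197, .edge 2 5, .edge 5 6, .tree 0385296, .edge 0 6, .tree 2530689, .cycle 4 0156,
    .cycle 4 2015, .cycle 3 319, .cycle 3 013, .cycle 3 519, .cycle 3 318, .cycle 3 518,
    .edge 0 4, .edge 4 5, .edge 5 6, .tree 3540869, .edge 0 6, .edge 5 8, .tree 3540689,
    .edge 6 8, .edge 1 8, .tree 1805364, .cycle 3 158, .cycle 3 658, .cycle 4 0156, .cycle 3 415,
    .cycle 3 014, .edge 1 9, .edge 5 9, .edge 1 4, .tree 0591437, .edge 4 9, .edge 0 2,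
    .tree 1950248, .edge 1 2, .tree 0591237, .cycle 3 102, .cycle 4 4109, .cycle 4 5109,
    .cycle 3 109, .edge 0 3, .edge 1 3, .edge 1 4, .tree 4130578, .edge 3 4, .edge 1 2,
    .tree 2130578, .edge 2 3, .edge 0 4, .tree 1340528, .cycle 3 014, .cycle 4 2153,
    .cycle 4 3514, .cycle 3 153, .cycle 4 0153, .edge 5 7, .edge 0 7, .edge 2 7, .edge 0 3,
    .edge 7 9, .tree 2750398, .edge 1 9, .edge 0 9, .edge 4 9, .tree 1907245, .edge 4 7,
    .tree 2750348, .cycle 3 497, .cycle 4 0179, .cycle 3 179, .edge 3 5, .edge 1 3, .edge 3 9,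
    .tree 0753129, .edge 3 7, .edge 3 6, .tree 0753126, .edge 5 6, .edge 5 9, .tree 0735629,
    .cycle 5 51039, .cycle 5 51036, .cycle 4 3017, .cycle 3 103, .cycle 4 3015, .edge 1 2,
    .edge 0 2, .edge 2 5, .edge 2 4, .tree 1250748, .edge 1 4, .edge 4 7, .edge 1 8,
    .tree 0521478, .edge 4 8, .tree 0214758, .cycle 5 42718, .cycle 3 427, .cycle 4 1724,
    .cycle 4 2715, .cycle 4 0172, .cycle 3 172, .cycle 3 017, .cycle 3 517, .edge 1 8, .edge 5 8,
    .edge 1 4, .edge 1 2, .edge 5 6, .tree 0581264, .edge 6 8, .edge 1 6, .edge 8 9,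
    .tree 2168549, .edge 5 9, .tree 0581294, .cycle 5 51089, .cycle 3 156, .cycle 5 65108,
    .edge 2 8, .edge 2 5, .edge 1 3, .tree 0581324, .edge 1 9, .tree 0581429, .edge 5 9,
    .edge 3 8, .tree 0528193, .cycle 4 3108, .cycle 3 519, .cycle 3 215, .cycle 4 2108, .edge 0 4,
    .edge 4 5, .edge 4 8, .edge 0 2, .edge 6 8, .tree 1840265, .edge 0 6, .tree 1840256,
    .cycle 3 086, .edge 2 4, .edge 7 8, .tree 0458127, .edge 1 7, .edge 1 2, .tree 0421758,
    .cycle 3 102, .cycle 4 1087, .cycle 4 2014, .cycle 4 4108, .cycle 3 415, .cycle 3 014,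
    .cycle 4 5108, .cycle 3 108, .cycle 3 015]
  | 3 =>
    [.edge 1 8, .edge 0 6, .edge 0 5, .edge 2 9, .edge 1 3, .edge 0 4, .edge 1 5, .tree 3150486,
    .edge 2 5, .edge 2 7, .tree 4052769, .edge 1 7, .edge 5 7, .tree 0571328, .cycle 4 5127,
    .cycle 4 1027, .cycle 4 2015, .edge 1 4, .edge 0 3, .tree 4130586, .edge 2 3, .edge 2 4,
    .edge 2 5, .tree 3142589, .edge 1 5, .tree 3241598, .cycle 4 1025, .cycle 4 2104,
    .cycle 4 2103, .cycle 4 1204, .edge 2 3, .edge 0 3, .edge 2 7, .tree 5032769, .edge 3 7,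
    .edge 2 4, .tree 4230596, .edge 3 4, .edge 0 7, .tree 2370546, .cycle 4 0127, .cycle 4 3124,
    .cycle 4 3127, .cycle 4 0213, .cycle 4 2013, .edge 1 9, .edge 0 9, .edge 1 3, .tree 3190586,
    .edge 0 3, .edge 1 7, .tree 3091758, .edge 0 7, .edge 1 4, .tree 3091458, .edge 7 9,
    .edge 4 9, .tree 1970345, .cycle 4 4129, .cycle 4 7129, .cycle 4 0217, .cycle 4 0213,
    .cycle 4 0129, .cycle 4 1029, .edge 2 5, .edge 1 5, .edge 1 3, .edge 2 4, .edge 2 6,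
    .tree 3152486, .edge 5 6, .edge 2 7, .tree 3152487, .edge 6 7, .tree 0651378, .edge 2 9,
    .tree 3152489, .edge 6 9, .tree 0651398, .cycle 4 6729, .cycle 4 5026, .edge 4 5, .edge 0 4,
    .edge 0 7, .tree 1540627, .edge 1 7, .edge 4 9, .tree 0451397, .edge 0 9, .tree 1540629,
    .cycle 4 0249, .cycle 4 1207, .cycle 4 0124, .cycle 4 4205, .edge 2 3, .edge 3 5, .edge 0 3,
    .edge 1 9, .tree 0351829, .edge 0 9, .tree 1530629, .cycle 4 0219, .cycle 4 0213,
    .cycle 4 3105, .cycle 4 2013, .cycle 4 1205, .cycle 4 2105, .edge 2 6, .edge 1 6, .edge 1 7,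
    .edge 2 3, .edge 2 4, .tree 3261748, .edge 4 6, .edge 2 5, .tree 3261758, .edge 1 4,
    .edge 5 6, .tree 2641758, .cycle 4 5206, .cycle 4 1024, .cycle 4 4206, .edge 3 6, .edge 1 3,
    .edge 6 9, .tree 2631798, .edge 3 9, .edge 0 3, .tree 0361798, .cycle 4 0123, .cycle 5 32069,
    .cycle 4 1023, .cycle 4 3206, .edge 2 7, .edge 6 7, .edge 0 7, .edge 1 5, .tree 0761528,
    .edge 2 5, .edge 1 3, .tree 0761328, .edge 5 6, .edge 2 3, .edge 1 9, .tree 0761829,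
    .edge 6 9, .tree 1652397, .cycle 4 6019, .cycle 4 2013, .cycle 4 5106, .cycle 4 2015,
    .cycle 4 0217, .cycle 4 6017, .cycle 4 2017, .cycle 4 1206, .cycle 4 2106, .edge 0 8,
    .edge 2 8, .edge 0 4, .edge 0 9, .edge 2 3, .edge 2 5, .tree 3280459, .edge 5 8, .edge 2 6,
    .tree 3280469, .edge 6 8, .edge 0 5, .tree 2850469, .cycle 4 0125, .cycle 4 6218,
    .cycle 4 5218, .edge 3 8, .edge 1 3, .edge 3 7, .tree 1380479, .edge 0 3, .edge 7 8,
    .tree 2830479, .cycle 5 73218, .cycle 4 0123, .cycle 4 1023, .cycle 4 3218, .edge 1 9,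
    .edge 2 9, .edge 8 9, .edge 0 6, .tree 1980426, .edge 1 6, .edge 1 3, .tree 0891326,
    .edge 0 3, .tree 1980324, .cycle 4 0213, .cycle 4 1206, .cycle 4 8109, .cycle 4 2109,
    .cycle 4 1209, .edge 4 8, .edge 2 4, .edge 1 4, .edge 0 3, .edge 0 9, .tree 1480329,
    .edge 1 9, .edge 8 9, .edge 2 9, .edge 3 9, .tree 0829143, .edge 3 4, .tree 0824193,
    .cycle 4 3904, .cycle 4 2109, .cycle 4 8109, .cycle 4 1209, .edge 1 3, .edge 3 8, .edge 4 6,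
    .tree 0824136, .edge 1 6, .tree 0831426, .cycle 4 1046, .cycle 4 3018, .cycle 4 1203,
    .cycle 4 1204, .cycle 4 2104, .cycle 4 4018, .cycle 4 2018, .cycle 4 0218]
  | 4 =>
    [.edge 3 9, .edge 0 8, .edge 0 6, .edge 3 5, .edge 0 4, .edge 3 8, .tree 4083569, .edge 3 4,
    .tree 5340698, .edge 2 8, .edge 3 6, .tree 4063589, .edge 2 6, .edge 2 4, .edge 0 5,
    .edge 0 7, .tree 4260587, .edge 3 7, .tree 4053769, .cycle 5 32107, .edge 5 6, .edge 1 5,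
    .tree 1560438, .cycle 5 12305, .cycle 6 501236, .cycle 5 21034, .cycle 5 21036,
    .cycle 5 21038, .edge 3 4, .edge 1 4, .edge 0 9, .tree 4390658, .edge 1 9, .edge 0 5,
    .tree 4350698, .edge 1 5, .edge 0 7, .edge 4 7, .tree 1470638, .edge 1 7, .tree 4170658,
    .cycle 6 123047, .edge 3 7, .edge 1 8, .tree 4153789, .edge 7 8, .edge 4 8, .tree 0841579,
    .cycle 6 403218, .cycle 6 703218, .cycle 5 32107, .cycle 5 12305, .cycle 5 12309,
    .cycle 5 12304, .cycle 5 32104, .edge 2 5, .edge 0 5, .edge 1 9, .edge 6 9, .tree 1960538,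
    .edge 5 9, .tree 1950638, .edge 1 6, .edge 2 9, .edge 5 6, .tree 0529163, .edge 6 7,
    .tree 0619273, .edge 1 7, .tree 5061789, .cycle 6 103567, .cycle 6 210359, .cycle 6 103596,
    .edge 5 9, .edge 2 9, .tree 2950638, .cycle 5 23019, .cycle 5 53019, .cycle 5 01235,
    .cycle 5 21035, .edge 3 6, .edge 1 6, .edge 3 5, .edge 1 4, .edge 1 7, .tree 4163579,
    .edge 1 8, .tree 4163589, .edge 6 7, .edge 2 7, .edge 6 8, .edge 3 8, .tree 1683579,
    .edge 2 6, .edge 0 2, .tree 0263579, .cycle 5 01832, .cycle 6 218306, .cycle 6 603218,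
    .cycle 5 23017, .cycle 6 603217, .edge 2 4, .edge 0 4, .edge 4 6, .tree 0463529,
    .cycle 6 412306, .cycle 5 03214, .cycle 5 23014, .edge 2 5, .edge 0 5, .edge 5 6, .edge 3 7,
    .tree 0563729, .edge 0 7, .tree 1650738, .cycle 5 01237, .cycle 6 532106, .cycle 5 01235,
    .cycle 5 21035, .cycle 5 12306, .cycle 5 32106, .edge 1 8, .edge 3 8, .edge 1 5, .edge 1 4,
    .edge 3 7, .tree 4183759, .edge 2 7, .edge 0 7, .edge 7 8, .tree 0781425, .cycle 6 732108,
    .cycle 5 01237, .cycle 5 21037, .edge 4 8, .edge 0 4, .edge 2 4, .edge 1 3, .tree 0481325,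
    .edge 3 5, .tree 0483529, .edge 2 8, .edge 4 5, .tree 0428153, .cycle 5 41035, .cycle 5 21308,
    .cycle 5 23014, .cycle 5 03214, .cycle 6 412308, .edge 0 5, .edge 2 5, .edge 5 8, .edge 1 3,
    .tree 0583129, .edge 3 4, .tree 0583429, .edge 4 8, .edge 4 5, .tree 0548123, .cycle 5 43015,
    .cycle 5 43108, .cycle 6 512308, .cycle 5 23015, .cycle 5 03215, .cycle 5 32108,
    .cycle 5 12308, .edge 2 9, .edge 0 9, .edge 2 6, .edge 0 8, .edge 0 4, .edge 2 7,
    .tree 4092687, .edge 3 7, .edge 1 7, .edge 7 9, .tree 1790438, .cycle 6 721039,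
    .cycle 5 10327, .cycle 5 30127, .edge 4 9, .edge 3 4, .edge 1 4, .edge 0 2, .tree 0294163,
    .edge 2 5, .tree 1492536, .edge 3 5, .edge 1 3, .tree 0943125, .edge 0 7, .tree 1490738,
    .edge 3 7, .tree 0943527, .cycle 5 31207, .cycle 5 30125, .cycle 5 12304, .cycle 5 32104,
    .cycle 6 401239, .edge 3 8, .edge 8 9, .edge 1 8, .edge 2 7, .tree 1892637, .edge 7 9,
    .edge 7 8, .tree 0978123, .cycle 5 72108, .cycle 6 721039, .cycle 5 12308, .cycle 6 801239,
    .cycle 5 32108, .edge 6 9, .edge 3 6, .edge 1 6, .edge 0 2, .edge 0 7, .tree 1690237,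
    .edge 6 7, .edge 7 9, .tree 0976123, .cycle 6 701239, .cycle 5 62107, .edge 1 9, .edge 6 7,
    .tree 0916327, .edge 3 7, .edge 5 6, .tree 0916325, .edge 3 5, .tree 0963517, .cycle 5 30265,
    .cycle 5 30267, .cycle 5 10239, .cycle 5 10326, .cycle 5 30126, .cycle 6 621039,
    .cycle 5 01239, .cycle 5 21039]
  | 5 =>
    [.edge 0 9, .edge 1 5, .edge 2 9, .edge 4 5, .edge 2 5, .edge 3 9, .tree 0925134, .edge 6 9,
    .tree 0925164, .edge 8 9, .tree 0925184, .edge 7 9, .tree 0925174, .edge 2 6, .edge 1 6,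
    .edge 1 8, .edge 1 7, .tree 5261798, .cycle 6 104397, .cycle 6 104398, .cycle 6 104396,
    .cycle 7 2104396, .edge 3 5, .edge 4 9, .tree 0945123, .edge 3 9, .tree 0935124,
    .cycle 6 321049, .cycle 6 340125, .edge 0 5, .edge 3 5, .edge 8 9, .tree 1509238, .edge 7 9,
    .tree 1509237, .edge 4 9, .tree 1509234, .edge 2 8, .edge 0 8, .edge 6 9, .tree 1509236,
    .edge 0 7, .edge 6 8, .tree 1508236, .edge 4 8, .tree 1508234, .edge 3 8, .edge 1 8,
    .edge 5 9, .tree 0518293, .edge 1 6, .tree 5180769, .cycle 6 104596, .cycle 6 104968,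
    .cycle 6 321048, .cycle 7 0123497, .cycle 7 0123498, .cycle 6 210498, .cycle 6 321045,
    .cycle 6 012345, .edge 3 9, .edge 1 9, .edge 4 5, .edge 2 5, .tree 0915234, .edge 5 8,
    .tree 0915438, .edge 5 6, .tree 0915436, .edge 1 8, .edge 3 6, .edge 5 7, .tree 0915437,
    .edge 3 7, .tree 5193687, .cycle 7 3401257, .cycle 7 3401256, .cycle 7 1043258, .edge 0 5,
    .edge 3 5, .edge 5 9, .edge 0 6, .edge 0 2, .tree 1590236, .edge 0 8, .tree 1590638,
    .edge 1 8, .edge 0 3, .tree 3051869, .edge 2 5, .edge 5 8, .tree 0915238, .cycle 6 543208,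
    .cycle 6 210345, .cycle 6 123408, .edge 6 9, .edge 1 6, .edge 4 6, .tree 0516439,
    .cycle 6 432106, .cycle 6 123406, .cycle 6 604329, .cycle 6 540129, .cycle 6 321045,
    .cycle 6 012345, .cycle 6 104329, .cycle 6 340129, .edge 0 5, .edge 2 5, .edge 0 7, .edge 2 6,
    .edge 2 8, .tree 6250789, .edge 3 8, .edge 2 4, .tree 4250769, .edge 5 8, .edge 3 5,
    .edge 4 8, .tree 3850749, .edge 0 3, .tree 2530789, .cycle 6 012843, .cycle 6 324015,
    .cycle 6 510428, .cycle 6 340128, .edge 1 6, .edge 5 6, .edge 3 6, .tree 1650739,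
    .cycle 6 340126, .cycle 7 5104326, .cycle 6 104326, .edge 5 7, .edge 1 7, .edge 4 7,
    .edge 0 6, .tree 1750649, .edge 0 8, .tree 1750849, .edge 0 3, .tree 1750349, .edge 1 6,
    .edge 5 6, .edge 1 8, .tree 0561728, .cycle 6 123408, .cycle 6 512306, .cycle 6 123406,
    .cycle 6 432107, .cycle 6 123407, .cycle 7 5123407, .cycle 6 234015, .cycle 6 043215,
    .edge 1 9, .edge 4 9, .edge 6 9, .edge 7 9, .edge 2 8, .edge 0 8, .edge 1 8, .tree 0819426,
    .edge 4 8, .tree 0849126, .edge 2 9, .edge 3 8, .tree 0829134, .cycle 6 321048,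
    .cycle 6 218409, .edge 4 8, .edge 1 8, .tree 1849627, .cycle 6 123408, .cycle 6 432108,
    .edge 3 8, .edge 1 8, .edge 4 8, .tree 1849637, .edge 0 8, .tree 0819436, .cycle 6 012348,
    .cycle 6 104328, .cycle 6 340128, .edge 4 7, .edge 2 7, .edge 3 7, .tree 1947263,
    .cycle 6 321097, .cycle 6 234097, .cycle 7 4321097, .edge 3 6, .edge 4 6, .edge 2 6,
    .edge 5 9, .tree 1946253, .edge 1 6, .edge 8 9, .tree 1946283, .edge 4 5, .edge 3 5,
    .edge 1 8, .edge 2 5, .edge 3 7, .tree 5361879, .edge 7 9, .tree 1945273, .cycle 6 732109,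
    .cycle 6 234095, .cycle 7 1234098, .cycle 6 321095, .cycle 7 4321095, .cycle 7 1234096,
    .cycle 6 234096, .cycle 7 4321096, .cycle 6 321096, .cycle 6 432109, .cycle 6 123409]
  | 6 =>
    [.edge 1 6, .edge 5 6, .edge 2 8, .edge 5 8, .edge 3 6, .edge 7 8, .tree 1658237, .edge 0 8,
    .tree 0856123, .edge 4 8, .tree 1658234, .edge 3 8, .edge 1 7, .edge 4 6, .tree 1638245,
    .edge 3 7, .edge 0 6, .tree 0638215, .edge 2 7, .edge 3 5, .tree 1735628, .cycle 7 3210645,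
    .cycle 7 2105487, .cycle 8 32105487, .cycle 8 12345087, .cycle 7 3210548, .edge 4 6,
    .edge 2 6, .edge 7 8, .tree 1628547, .edge 0 8, .tree 0826154, .edge 6 7, .edge 1 8,
    .tree 1826457, .cycle 7 1234508, .cycle 7 6321087, .cycle 7 2105436, .cycle 7 4501236,
    .edge 0 8, .edge 4 8, .edge 4 6, .tree 0846125, .edge 3 6, .edge 0 6, .tree 1608234,
    .edge 3 8, .tree 0836125, .cycle 8 32106458, .cycle 7 3210546, .cycle 7 4321058,
    .cycle 7 0123458, .edge 3 8, .edge 1 8, .edge 7 8, .edge 0 6, .tree 0618357, .edge 4 6,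
    .tree 3816475, .edge 6 9, .tree 3816579, .edge 5 9, .edge 3 5, .tree 1835679,
    .cycle 7 3210645, .cycle 8 50123469, .edge 1 7, .edge 4 7, .edge 0 7, .edge 3 7, .edge 4 6,
    .tree 0716435, .edge 3 6, .tree 0716345, .cycle 7 3210546, .cycle 8 34501287,
    .cycle 7 0543287, .cycle 7 4501287, .cycle 8 10543287, .cycle 7 1054328, .cycle 7 3450128,
    .edge 0 6, .edge 4 6, .edge 4 8, .edge 2 8, .edge 7 8, .tree 0648217, .edge 3 8,
    .tree 0648213, .edge 5 8, .tree 0648215, .edge 0 8, .edge 6 7, .tree 0846127,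
    .cycle 8 65012387, .cycle 7 0123458, .edge 1 8, .edge 3 8, .edge 7 8, .tree 0618347,
    .edge 6 7, .tree 0618374, .cycle 7 6501287, .cycle 7 3450128, .cycle 7 1054328, .edge 3 8,
    .edge 5 8, .edge 1 8, .tree 0618345, .edge 0 8, .tree 1608345, .cycle 7 0543218,
    .cycle 7 5012348, .cycle 7 3210548, .cycle 7 4321056, .cycle 7 0123456, .edge 0 6, .edge 2 6,
    .edge 6 8, .edge 4 7, .edge 0 7, .edge 7 9, .tree 2607489, .edge 3 7, .tree 2607384,
    .edge 1 7, .tree 1706248, .edge 3 9, .edge 4 9, .edge 2 9, .tree 0629384, .cycle 8 21054379,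
    .cycle 8 45012379, .cycle 7 3450179, .edge 1 7, .edge 5 7, .edge 5 6, .tree 0657124,
    .edge 2 7, .tree 0627184, .cycle 8 23456107, .cycle 7 5432107, .cycle 7 1234507, .edge 5 7,
    .edge 3 7, .edge 7 8, .tree 0687325, .edge 2 8, .edge 3 8, .edge 1 7, .tree 1738256,
    .edge 7 9, .tree 2837569, .edge 3 9, .tree 0683729, .cycle 7 3450179, .cycle 8 32105478,
    .cycle 7 2105478, .cycle 7 3210547, .cycle 7 5012347, .edge 5 8, .edge 2 8, .edge 3 8,
    .edge 6 7, .tree 0628375, .edge 0 7, .edge 0 3, .tree 2830657, .edge 4 6, .tree 0628345,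
    .cycle 7 4503216, .cycle 8 05432167, .cycle 7 3450168, .cycle 8 23450168, .cycle 7 5432168,
    .cycle 7 2345016, .cycle 7 0543216]
  | 7 =>
    [.edge 0 8, .edge 2 9, .edge 5 9, .edge 3 8, .edge 0 9, .edge 1 8, .tree 1809235, .edge 4 8,
    .tree 2908354, .edge 7 8, .tree 2908357, .edge 5 8, .edge 4 9, .tree 0859234, .edge 2 8,
    .edge 7 9, .tree 0829537, .cycle 8 78106549, .cycle 8 23456018, .cycle 8 56012348, .edge 1 9,
    .edge 1 8, .tree 0819235, .edge 2 8, .tree 0829135, .cycle 8 23456018, .cycle 8 12345609,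
    .edge 2 8, .edge 4 8, .edge 7 9, .tree 0829547, .edge 6 9, .tree 0829546, .edge 4 7,
    .edge 1 9, .tree 0829145, .edge 6 7, .edge 3 7, .tree 0847326, .cycle 8 34560197,
    .cycle 8 65432197, .cycle 8 43210697, .cycle 8 45601238, .cycle 8 21065438, .edge 6 9,
    .edge 4 9, .edge 1 8, .edge 6 8, .tree 0869214, .edge 4 8, .tree 0849216, .edge 5 8,
    .edge 1 9, .tree 0819254, .cycle 8 12348659, .cycle 8 54321068, .edge 2 8, .edge 5 8,
    .tree 0829456, .edge 7 8, .tree 0829476, .edge 6 8, .edge 7 9, .tree 0829467,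
    .cycle 8 78123459, .cycle 8 60123458, .cycle 8 23456018, .cycle 8 43210659, .cycle 8 60123459,
    .edge 1 9, .edge 3 9, .edge 3 8, .edge 4 8, .edge 6 9, .tree 0839146, .edge 5 9,
    .tree 0839145, .cycle 8 54321069, .edge 5 8, .edge 7 9, .tree 0839157, .edge 6 9,
    .tree 0839156, .edge 1 7, .edge 4 9, .tree 0839154, .edge 1 3, .tree 0831759,
    .cycle 8 10654923, .cycle 8 12345697, .cycle 8 56012348, .edge 2 8, .edge 4 8, .edge 0 9,
    .tree 1908234, .edge 6 9, .edge 6 8, .tree 0869123, .edge 1 8, .tree 0819326, .edge 4 9,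
    .tree 0849123, .cycle 8 43218609, .cycle 8 65432109, .cycle 8 45601238, .cycle 8 21065438,
    .cycle 8 34560129, .cycle 8 10654329, .edge 6 8, .edge 1 8, .edge 3 8, .edge 6 9, .edge 4 9,
    .edge 2 9, .tree 1869234, .edge 5 9, .tree 1869435, .edge 3 6, .edge 7 9, .tree 1869437,
    .edge 1 4, .edge 3 9, .edge 2 4, .tree 1493628, .edge 4 7, .tree 1493678, .cycle 8 42106597,
    .cycle 8 34560129, .cycle 8 10659234, .cycle 8 34592106, .edge 5 9, .edge 3 9, .edge 7 9,
    .tree 1839567, .edge 7 8, .tree 1839576, .cycle 8 79432108, .cycle 8 32106549,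
    .cycle 8 56012349, .edge 5 9, .edge 0 9, .edge 1 9, .tree 0918356, .edge 2 9, .edge 3 9,
    .tree 0938126, .edge 4 9, .edge 4 8, .tree 0948123, .cycle 8 43219608, .cycle 8 45601239,
    .cycle 8 23456019, .cycle 8 01234569, .cycle 8 54321069, .edge 2 8, .edge 1 4, .edge 4 8,
    .edge 2 6, .edge 1 7, .edge 2 9, .tree 4182679, .edge 6 9, .tree 2681497, .edge 4 9,
    .edge 0 4, .tree 0418296, .cycle 8 08329654, .cycle 8 45608329, .edge 6 7, .edge 1 3,
    .tree 2681374, .edge 4 9, .tree 1486297, .edge 0 4, .tree 0486217, .edge 7 8, .edge 7 9,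
    .edge 2 4, .tree 1487629, .cycle 8 21380654, .cycle 8 71238049, .cycle 8 71065438,
    .cycle 8 65438017, .cycle 8 21083456, .cycle 8 45601238, .cycle 8 12380654, .cycle 8 21065438,
    .cycle 8 12345608, .cycle 8 65432108]
  | _ => []

lemma check_treeEExtension (k : ℕ) (h1 : 1 ≤ k) (h7 : k ≤ 7) :
    ∃ sts, check ⟨treeEEdges, k + 1, 0, 0⟩ sts [ofCycle 10 k] = true := by
  refine ⟨treeEExtension k, ?_⟩
  interval_cases k <;> decide +kernel

/-! ### The Ramsey numbers -/

/-- The bounds match because `K₆` and `H` together have `6 + (d + 3) = (10 + d) - 1` vertices. -/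
lemma isRamseyNumber_of_top_sum {T : SimpleGraph (Fin 7)} {E : List (Fin 7 × Fin 7)}
    (hE : ∀ i j, T.Adj i j ↔ (i, j) ∈ E ∨ (j, i) ∈ E)
    (hk : ∀ k, 1 ≤ k → k ≤ 7 → ∃ sts, check ⟨E, k + 1, 0, 0⟩ sts [ofCycle 10 k] = true)
    {d : ℕ} {sts : List CaseStep} (hsts : check ⟨E, 9, d, 6⟩ sts [vertex] = true) (hd : 3 ≤ d)
    (hT : T.Preconnected) {W : Type*} [Fintype W] {H : SimpleGraph W}
    (hW : Fintype.card W = d + 3) (hH : ¬ T.IsContained H)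
    (hdeg : ∀ v, ∀ S : Finset W, (∀ u ∈ S, u ≠ v ∧ ¬ H.Adj v u) → S.card ≤ 3)
    (hcyc : ∀ f : Fin 8 → W, f.Injective → ¬ ∀ i, ¬ H.Adj (f i) (f (i + 1))) :
    IsRamseyNumber T (wheelGraph 8) (10 + d) := by
  refine ⟨fun F => or_iff_not_imp_left.2 fun hF =>
    wheelGraph_isContained_compl_of_card (fun i j => (hE i j).1) hk hsts hd (by simp) hF,
    fun k hk' => ?_⟩
  have := card_lt_of_not_isContained (not_isContained_top_sum hT hH)
    (not_wheelGraph_isContained_compl_top_sum hdeg hcyc) hk'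
  rw [Fintype.card_sum, Fintype.card_fin, hW] at this
  omega

/-- Two disjoint copies of `K₆` give the lower bound for all trees of order `7`. -/
lemma isRamseyNumber_thirteen {T : SimpleGraph (Fin 7)} {E : List (Fin 7 × Fin 7)}
    (hE : ∀ i j, T.Adj i j ↔ (i, j) ∈ E ∨ (j, i) ∈ E)
    (hk : ∀ k, 1 ≤ k → k ≤ 7 → ∃ sts, check ⟨E, k + 1, 0, 0⟩ sts [ofCycle 10 k] = true)
    {sts : List CaseStep} (hsts : check ⟨E, 9, 3, 6⟩ sts [vertex] = true)
    (hT : T.Preconnected) : IsRamseyNumber T (wheelGraph 8) 13 := by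
  refine isRamseyNumber_of_top_sum (d := 3) (H := (⊤ : SimpleGraph (Fin 6))) hE hk hsts le_rfl hT
    (by simp) (not_isContained_of_card_lt (by simp)) (fun v S hS => ?_) fun f hf _ => ?_
  -- In `K₆` distinct vertices are adjacent, so there are no non-neighbours at all.
  · rw [Finset.eq_empty_of_forall_notMem fun u hu => (hS u hu).2 (hS u hu).1.symm]
    simp
  · simpa using Fintype.card_le_of_injective f hf

theorem theorem2p1 :
    IsRamseyNumber treeA (wheelGraph 8) 13 ∧
    IsRamseyNumber treeB (wheelGraph 8) 13 ∧
    IsRamseyNumber treeC (wheelGraph 8) 13 ∧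
    IsRamseyNumber treeD (wheelGraph 8) 14 ∧
    IsRamseyNumber treeE (wheelGraph 8) 15 := by
  refine ⟨isRamseyNumber_thirteen treeA_adj_iff check_treeAExtension check_treeASmallClosure
      treeA_preconnected,
    isRamseyNumber_thirteen treeB_adj_iff check_treeBExtension check_treeBSmallClosure
      treeB_preconnected,
    isRamseyNumber_thirteen treeC_adj_iff check_treeCExtension check_treeCSmallClosure
      treeC_preconnected,
    isRamseyNumber_of_top_sum (d := 4) treeD_adj_iff check_treeDExtension check_treeDSmallClosure
      (by norm_num) treeD_preconnected (by simp) not_treeD_isContained_twoK4 card_le_three_twoK4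
      fun f hf _ => ?_,
    isRamseyNumber_of_top_sum (d := 5) treeE_adj_iff check_treeEExtension check_treeESmallClosure
      (by norm_num) treeE_preconnected (by simp) not_treeE_isContained_K44 card_le_three_K44
      not_complCycle_K44⟩
  -- What remains is the cycle condition for `D`: `twoK4` has seven vertices, too few for an
  -- 8-cycle.
  simpa using Fintype.card_le_of_injective f hf
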